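/- Let $d\in\mathbb N$ and let $a:\mathbb R^d\to[0,\infty)$ be integrable with $\int_{\mathbb R^d}a(z)\,dz=1$, with $a(z)\le Ce^{-k|z|^p}$ for some $p>1$, $k>0$, $C>0$, and with $\int_{\{z\cdot\alpha>0\}}a(z)\,dz>0$ for every unit vector $\alpha\in\mathbb R^d$. Let $\Lambda:\mathbb R^d\times\mathbb R^d\to\mathbb R$ be measurable, $\mathbb Z^d$-periodic in each of its two variables, and satisfy $0<\Lambda^-\le\Lambda(x,y)\le\Lambda^+<\infty$ for some constants $\Lambda^\pm$. Put $$G(x)=\int_{\mathbb R^d}a(x-y)\Lambda(x,y)\,dy,\qquad g_{\min}=\operatorname*{ess\,inf}_{x\in\mathbb T^d}G(x),\qquad \mathbb T^d=\mathbb R^d/\mathbb Z^d ,$$ and for $\lambda\in\mathbb R^d$ let $A_\lambda$ be the bounded operator on the complex space $L^2(\mathbb T^d)$ given by $$A_\lambda v(x)=\int_{\mathbb R^d}a(x-y)\Lambda(x,y)e^{\lambda\cdot(y-x)}v(y)\,dy-G(x)v(x),$$ where $v$ is extended periodically to $\mathbb R^d$. Let $\theta(\lambda)$ be the maximum of the real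 parts of the elements of the spectrum of $A_\lambda$, and let $\Gamma=\{\lambda\in\mathbb R^d:\theta(\lambda)>-g_{\min}\}$. Theorem. For every $\lambda\in\Gamma$ the number $\theta(\lambda)$ is the principal eigenvalue of $A_\lambda$, i.e. it is an eigenvalue of $A_\lambda$ and every other element $z$ of the spectrum of $A_\lambda$ satisfies $\operatorname{Re}z<\theta(\lambda)$. The set $\Gamma$ is open, $\theta$ is twice continuously differentiable on $\Gamma$, and $\theta$ is strictly convex on $\Gamma$: the Hessian matrix $\big(\frac{\partial^2\theta}{\partial\lambda_i\partial\lambda_j}(\lambda)\big)_{i,j}$ is positive definite for every $\lambda\in\Gamma$, and $$\theta(t\lambda_1+(1-t)\lambda_2)<t\,\theta(\lambda_1)+(1-t)\,\theta(\lambda_2)$$ whenever $\lambda_1\ne\lambda_2$ belong to $\Gamma$, $0<t<1$ and $t\lambda_1+(1-t)\lambda_2\in\Gamma$. -/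

import Mathlib

open MeasureTheory

/-- The space `ℝ^d` with its Euclidean structure. -/
abbrev Rd (d : ℕ) : Type := EuclideanSpace ℝ (Fin d)

/-- The torus `𝕋^d = ℝ^d / ℤ^d`, with its Haar probability measure as `volume`. -/
abbrev Td (d : ℕ) : Type := UnitAddTorus (Fin d)

/-- The complex Hilbert space `L²(𝕋^d)`. -/
abbrev L2Td (d : ℕ) : Type := Lp ℂ 2 (volume : Measure (Td d))

/-- The quotient map `ℝ^d → 𝕋^d`. -/
def toTorus {d : ℕ} (x : Rd d) : Td d := fun i => ((x i : ℝ) : UnitAddCircle)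

/-- The representative in the cell `(0,1]^d` of a point of the torus. -/
noncomputable def cellRep {d : ℕ} (ξ : Td d) : Rd d :=
  WithLp.toLp 2 (fun i => (AddCircle.measurableEquivIoc (1 : ℝ) 0 (ξ i) : ℝ))

/-- The vector of `ℝ^d` with the integer coordinates `j`. -/
def intVec {d : ℕ} (j : Fin d → ℤ) : Rd d := WithLp.toLp 2 (fun i => (j i : ℝ))

/-- The standing assumptions on the jump kernel `a (x - y) * Λ x y`: `a` is a probability density
with super-exponential decay which charges every open half-space, and `Λ` is measurable,
`ℤ^d`-periodic in both variables and bounded between two positive constants. -/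
structure IsPeriodicJumpKernel {d : ℕ} (a : Rd d → ℝ) (Λ : Rd d → Rd d → ℝ) : Prop where
  integrable : Integrable a
  nonneg : ∀ z, 0 ≤ a z
  integral_eq_one : ∫ z, a z = 1
  decay : ∃ p k C : ℝ, 1 < p ∧ 0 < k ∧ 0 < C ∧ ∀ z, a z ≤ C * Real.exp (-(k * ‖z‖ ^ p))
  halfspace : ∀ α : Rd d, ‖α‖ = 1 → 0 < ∫ z in {z : Rd d | 0 < inner ℝ z α}, a z
  measurable : Measurable (Function.uncurry Λ)
  periodic : ∀ (x y : Rd d) (j j' : Fin d → ℤ), Λ (x + intVec j) (y + intVec j') = Λ x y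
  lower : ∃ m : ℝ, 0 < m ∧ ∀ x y, m ≤ Λ x y
  upper : ∃ M : ℝ, ∀ x y, Λ x y ≤ M

/-- `G x = ∫ a (x - y) Λ (x, y) dy`. -/
noncomputable def jumpRate {d : ℕ} (a : Rd d → ℝ) (Λ : Rd d → Rd d → ℝ) (x : Rd d) : ℝ :=
  ∫ y, a (x - y) * Λ x y

/-- `g_min`: the (essential) minimum of `G` over the torus. -/
noncomputable def gMin {d : ℕ} (a : Rd d → ℝ) (Λ : Rd d → Rd d → ℝ) : ℝ :=
  essInf (fun ξ : Td d => jumpRate a Λ (cellRep ξ)) volume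

/-- The formula of the skewed operator, for a function `v` on the torus, at the point `x ∈ ℝ^d`:
`∫ a (x - y) Λ (x, y) e^{l · (y - x)} v (y) dy - G x * v x`. -/
noncomputable def skewedFormula {d : ℕ} (a : Rd d → ℝ) (Λ : Rd d → Rd d → ℝ) (l : Rd d)
    (v : Td d → ℂ) (x : Rd d) : ℂ :=
  (∫ y, ((a (x - y) * Λ x y * Real.exp (inner ℝ l (y - x)) : ℝ) : ℂ) * v (toTorus y))
    - (jumpRate a Λ x : ℂ) * v (toTorus x)

/-! ### Boundedness of the skewed operator on `L²(𝕋^d)` -/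

theorem measurable_toTorus {d : ℕ} : Measurable (toTorus (d := d)) := by
  refine measurable_pi_lambda _ fun i => ?_
  exact AddCircle.measurable_mk'.comp (by fun_prop)

theorem measurable_cellRep {d : ℕ} : Measurable (cellRep (d := d)) := by
  refine (WithLp.measurable_toLp 2 _).comp (measurable_pi_lambda _ fun i => ?_)
  exact measurable_subtype_coe.comp
    ((AddCircle.measurableEquivIoc (1 : ℝ) 0).measurable.comp (measurable_pi_apply i))

theorem toTorus_cellRep {d : ℕ} (ξ : Td d) : toTorus (cellRep ξ) = ξ := by
  funext i
  exact (AddCircle.equivIoc (1 : ℝ) 0).symm_apply_apply (ξ i)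

theorem toTorus_sub {d : ℕ} (x y : Rd d) : toTorus (x - y) = toTorus x - toTorus y := by
  funext i
  simp [toTorus]

theorem integrable_exp_decay {d : ℕ} {p k : ℝ} (hp : 1 < p) (hk : 0 < k) (c : ℝ) :
    Integrable (fun z : Rd d => Real.exp (c * ‖z‖ - k * ‖z‖ ^ p)) := by
  obtain ⟨R, hR0, hR⟩ : ∃ R : ℝ, 0 < R ∧ ∀ r, R ≤ r → (|c| + 1) ≤ k * r ^ (p - 1) := by
    have h := (tendsto_rpow_atTop (sub_pos.2 hp)).const_mul_atTop hk
    obtain ⟨R, hR⟩ := Filter.eventually_atTop.1 (h.eventually_ge_atTop (|c| + 1))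
    exact ⟨max R 1, by positivity, fun r hr => hR r ((le_max_left _ _).trans hr)⟩
  have key : ∀ r : ℝ, 0 ≤ r → c * r - k * r ^ p ≤ (|c| + 1) * R - r := by
    intro r hr
    have hc : c * r ≤ |c| * r := mul_le_mul_of_nonneg_right (le_abs_self c) hr
    have hc0 := abs_nonneg c
    rcases le_total R r with h | h
    · have hr0 : 0 < r := hR0.trans_le h
      have h1 : r ^ p = r ^ (p - 1) * r := by
        rw [← Real.rpow_add_one hr0.ne']; congr 1; ring
      have h2 := mul_le_mul_of_nonneg_right (hR r h) hr
      rw [h1]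
      nlinarith [mul_nonneg (add_nonneg hc0 zero_le_one) hR0.le]
    · have h1 : 0 ≤ k * r ^ p := by positivity
      nlinarith [mul_le_mul_of_nonneg_left h (add_nonneg hc0 zero_le_one)]
  set n : ℕ := d + 1 with hn
  have hint : Integrable (fun z : Rd d => (1 + ‖z‖) ^ (-((n : ℕ) : ℝ))) := by
    apply integrable_one_add_norm
    rw [finrank_euclideanSpace_fin, hn]
    push_cast
    linarith
  refine (hint.const_mul (Real.exp ((|c| + 1) * R + 1) * n.factorial)).mono'
    (by fun_prop (disch := linarith)) ?_
  filter_upwards with z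
  have hz := norm_nonneg z
  rw [Real.norm_eq_abs, abs_of_pos (Real.exp_pos _)]
  have h1 : Real.exp (c * ‖z‖ - k * ‖z‖ ^ p) ≤
      Real.exp ((|c| + 1) * R + 1) * Real.exp (-(1 + ‖z‖)) := by
    rw [← Real.exp_add]
    exact Real.exp_le_exp.2 (by linarith [key ‖z‖ hz])
  have h2 : Real.exp (-(1 + ‖z‖)) ≤ n.factorial * (1 + ‖z‖) ^ (-((n : ℕ) : ℝ)) := by
    have h3 := Real.pow_div_factorial_le_exp (x := 1 + ‖z‖) (by linarith) n
    rw [Real.rpow_neg (by linarith), Real.rpow_natCast, Real.exp_neg]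
    have h4 : (0 : ℝ) < (1 + ‖z‖) ^ n := by positivity
    have h5 : (0 : ℝ) < n.factorial := by positivity
    have h6 : (n.factorial : ℝ) * ((1 + ‖z‖) ^ n)⁻¹ = ((1 + ‖z‖) ^ n / n.factorial)⁻¹ := by
      field_simp
    rw [h6]
    exact inv_anti₀ (by positivity) h3
  calc _ ≤ _ := h1
    _ ≤ Real.exp ((|c| + 1) * R + 1) * (n.factorial * (1 + ‖z‖) ^ (-((n : ℕ) : ℝ))) := by gcongr
    _ = _ := by ring

/-- The kernel of the integral part after the substitution `y = cellRep ξ - z`. -/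
noncomputable def shiftKernel {d : ℕ} (a : Rd d → ℝ) (Λ : Rd d → Rd d → ℝ) (l : Rd d)
    (ξ : Td d) (z : Rd d) : ℝ :=
  a z * Λ (cellRep ξ) (cellRep ξ - z) * Real.exp (inner ℝ l (-z))

theorem skewedFormula_cellRep {d : ℕ} (a : Rd d → ℝ) (Λ : Rd d → Rd d → ℝ) (l : Rd d)
    (v : Td d → ℂ) (ξ : Td d) :
    skewedFormula a Λ l v (cellRep ξ) =
      (∫ z, (shiftKernel a Λ l ξ z : ℂ) * v (ξ - toTorus z))
        - (jumpRate a Λ (cellRep ξ) : ℂ) * v ξ := by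
  rw [skewedFormula, toTorus_cellRep]
  congr 1
  rw [← integral_sub_left_eq_self _ volume (cellRep ξ)]
  refine integral_congr_ae (Filter.Eventually.of_forall fun z => ?_)
  simp only [shiftKernel, toTorus_sub, toTorus_cellRep, sub_sub_cancel]
  congr 4
  abel_nf

namespace IsPeriodicJumpKernel

variable {d : ℕ} {a : Rd d → ℝ} {Λ : Rd d → Rd d → ℝ}

theorem exists_dominating (h : IsPeriodicJumpKernel a Λ) (l : Rd d) :
    ∃ w : Rd d → ℝ, Integrable w ∧ (∀ z, 0 ≤ w z) ∧ ∀ ξ z, |shiftKernel a Λ l ξ z| ≤ w z := by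
  obtain ⟨p, k, C, hp, hk, hC, hdec⟩ := h.decay
  obtain ⟨m, hm, hlow⟩ := h.lower
  obtain ⟨M, hup⟩ := h.upper
  have hM : 0 < M := hm.trans_le ((hlow 0 0).trans (hup 0 0))
  refine ⟨fun z => (C * M) * Real.exp (‖l‖ * ‖z‖ - k * ‖z‖ ^ p),
    (integrable_exp_decay hp hk _).const_mul _, fun z => by positivity, fun ξ z => ?_⟩
  have h0 : 0 ≤ Λ (cellRep ξ) (cellRep ξ - z) := hm.le.trans (hlow _ _)
  have ha := h.nonneg z
  rw [shiftKernel, abs_of_nonneg (by positivity)]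
  have h1 : inner ℝ l (-z) ≤ ‖l‖ * ‖z‖ := by
    simpa using real_inner_le_norm l (-z)
  calc a z * Λ (cellRep ξ) (cellRep ξ - z) * Real.exp (inner ℝ l (-z))
      ≤ (C * Real.exp (-(k * ‖z‖ ^ p))) * M * Real.exp (‖l‖ * ‖z‖) := by
        gcongr
        · exact hdec z
        · exact hup _ _
    _ = _ := by
        simp only [sub_eq_add_neg, Real.exp_add]; ring

theorem aestronglyMeasurable_shiftKernel (h : IsPeriodicJumpKernel a Λ) (l : Rd d) :
    AEStronglyMeasurable (fun q : Td d × Rd d => shiftKernel a Λ l q.1 q.2)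
      ((volume : Measure (Td d)).prod volume) := by
  have h1 : AEStronglyMeasurable (fun q : Td d × Rd d => a q.2)
      ((volume : Measure (Td d)).prod volume) := h.integrable.aestronglyMeasurable.comp_snd
  have h2 : Measurable (fun q : Td d × Rd d => Λ (cellRep q.1) (cellRep q.1 - q.2)) :=
    h.measurable.comp ((measurable_cellRep.comp measurable_fst).prodMk
      ((measurable_cellRep.comp measurable_fst).sub measurable_snd))
  have h3 : Measurable (fun q : Td d × Rd d => Real.exp (inner ℝ l (-q.2))) := by fun_prop
  exact (h1.mul h2.aestronglyMeasurable).mul h3.aestronglyMeasurable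

theorem aestronglyMeasurable_integrand (h : IsPeriodicJumpKernel a Λ) (l : Rd d)
    {v : Td d → ℂ} (hv : Measurable v) :
    AEStronglyMeasurable
      (fun q : Td d × Rd d => (shiftKernel a Λ l q.1 q.2 : ℂ) * v (q.1 - toTorus q.2))
      ((volume : Measure (Td d)).prod volume) := by
  refine (Complex.continuous_ofReal.comp_aestronglyMeasurable
    (h.aestronglyMeasurable_shiftKernel l)).mul ?_
  exact (hv.comp (measurable_fst.sub (measurable_toTorus.comp measurable_snd))).aestronglyMeasurable

/-- Schur-type bound for the integral part. -/
theorem exists_lintegral_bound (h : IsPeriodicJumpKernel a Λ) (l : Rd d) :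
    ∃ W : ℝ, 0 ≤ W ∧ ∀ v : Td d → ℂ, Measurable v →
      ∫⁻ ξ, (∫⁻ z, ‖(shiftKernel a Λ l ξ z : ℂ) * v (ξ - toTorus z)‖ₑ) ^ (2 : ℝ)
        ≤ (ENNReal.ofReal W * eLpNorm v 2 volume) ^ (2 : ℝ) := by
  obtain ⟨w, hw, hw0, hwK⟩ := h.exists_dominating l
  refine ⟨∫ z, w z, integral_nonneg hw0, fun v hv => ?_⟩
  have hWeq : ∫⁻ z, ‖w z‖ₑ = ENNReal.ofReal (∫ z, w z) := by
    rw [ofReal_integral_eq_lintegral_ofReal hw (Filter.Eventually.of_forall hw0)]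
    refine lintegral_congr fun z => ?_
    rw [Real.enorm_eq_ofReal (hw0 z)]
  set W := ENNReal.ofReal (∫ z, w z) with hW
  have hwm : AEMeasurable (fun z => ‖w z‖ₑ) := hw.aestronglyMeasurable.enorm
  have hmeas : Measurable (fun q : Td d × Rd d => ‖v (q.1 - toTorus q.2)‖ₑ) :=
    (hv.comp (measurable_fst.sub (measurable_toTorus.comp measurable_snd))).enorm
  have step : ∀ ξ : Td d,
      (∫⁻ z, ‖(shiftKernel a Λ l ξ z : ℂ) * v (ξ - toTorus z)‖ₑ) ^ (2 : ℝ) ≤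
        W * ∫⁻ z, ‖w z‖ₑ * ‖v (ξ - toTorus z)‖ₑ ^ (2 : ℝ) := by
    intro ξ
    have hmξ : Measurable (fun z : Rd d => ‖v (ξ - toTorus z)‖ₑ) :=
      hmeas.comp measurable_prodMk_left
    have e1 : ∫⁻ z, ‖(shiftKernel a Λ l ξ z : ℂ) * v (ξ - toTorus z)‖ₑ ≤
        ∫⁻ z, ((fun z => ‖w z‖ₑ ^ (1 / 2 : ℝ)) *
          (fun z => ‖w z‖ₑ ^ (1 / 2 : ℝ) * ‖v (ξ - toTorus z)‖ₑ)) z := by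
      refine lintegral_mono fun z => ?_
      rw [enorm_mul, Pi.mul_apply, ← mul_assoc, ← ENNReal.rpow_add_of_nonneg _ _ (by norm_num)
        (by norm_num)]
      norm_num
      gcongr
      rw [← ofReal_norm, ← ofReal_norm, Complex.norm_real]
      refine ENNReal.ofReal_le_ofReal ?_
      rw [Real.norm_eq_abs, Real.norm_eq_abs, abs_of_nonneg (hw0 z)]
      exact hwK ξ z
    have e2 := ENNReal.lintegral_mul_le_Lp_mul_Lq (volume : Measure (Rd d))
      (p := 2) (q := 2) Real.HolderConjugate.two_two
      (f := fun z => ‖w z‖ₑ ^ (1 / 2 : ℝ))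
      (g := fun z => ‖w z‖ₑ ^ (1 / 2 : ℝ) * ‖v (ξ - toTorus z)‖ₑ)
      (hwm.pow_const _) ((hwm.pow_const _).mul hmξ.aemeasurable)
    refine (ENNReal.rpow_le_rpow (e1.trans e2) (by norm_num)).trans (le_of_eq ?_)
    rw [ENNReal.mul_rpow_of_nonneg _ _ (by norm_num), ← ENNReal.rpow_mul, ← ENNReal.rpow_mul]
    norm_num
    congr 1
    · rw [← hWeq]
      refine lintegral_congr fun z => ?_
      rw [← ENNReal.rpow_natCast, ← ENNReal.rpow_mul]
      norm_num
    · refine lintegral_congr fun z => ?_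
      rw [mul_pow]
      congr 1
      rw [← ENNReal.rpow_natCast, ← ENNReal.rpow_mul]
      norm_num
  have hprod : AEMeasurable (Function.uncurry fun (ξ : Td d) (z : Rd d) =>
      ‖w z‖ₑ * ‖v (ξ - toTorus z)‖ₑ ^ (2 : ℝ)) ((volume : Measure (Td d)).prod volume) := by
    exact (hw.aestronglyMeasurable.comp_snd.enorm).mul (hmeas.pow_const _).aemeasurable
  calc _ ≤ ∫⁻ ξ : Td d, W * ∫⁻ z, ‖w z‖ₑ * ‖v (ξ - toTorus z)‖ₑ ^ (2 : ℝ) :=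
        lintegral_mono step
    _ = W * ∫⁻ z, ∫⁻ ξ : Td d, ‖w z‖ₑ * ‖v (ξ - toTorus z)‖ₑ ^ (2 : ℝ) := by
        rw [lintegral_const_mul' _ _ ENNReal.ofReal_ne_top, lintegral_lintegral_swap hprod]
    _ = W * ∫⁻ z, ‖w z‖ₑ * ∫⁻ ξ : Td d, ‖v ξ‖ₑ ^ (2 : ℝ) := by
        congr 1
        refine lintegral_congr fun z => ?_
        rw [lintegral_const_mul' _ _ enorm_ne_top,
          lintegral_sub_right_eq_self (fun ξ => ‖v ξ‖ₑ ^ (2 : ℝ)) (toTorus z)]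
    _ = W * (W * ∫⁻ ξ : Td d, ‖v ξ‖ₑ ^ (2 : ℝ)) := by
        rw [lintegral_mul_const'' _ hwm, hWeq]
    _ = _ := by
        rw [ENNReal.mul_rpow_of_nonneg _ _ (by norm_num),
          eLpNorm_eq_lintegral_rpow_enorm_toReal (by norm_num) (by norm_num), ← ENNReal.rpow_mul]
        norm_num
        ring

theorem ae_integrable (h : IsPeriodicJumpKernel a Λ) (l : Rd d) (v : L2Td d) :
    ∀ᵐ ξ : Td d, Integrable
      (fun z : Rd d => (shiftKernel a Λ l ξ z : ℂ) * v (ξ - toTorus z)) := by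
  obtain ⟨W, -, hW⟩ := h.exists_lintegral_bound l
  have hv : Measurable v := (Lp.stronglyMeasurable v).measurable
  have hm := h.aestronglyMeasurable_integrand l hv
  have hfin : ∫⁻ ξ : Td d,
      (∫⁻ z, ‖(shiftKernel a Λ l ξ z : ℂ) * v (ξ - toTorus z)‖ₑ) ^ (2 : ℝ) ≠ ⊤ := by
    refine ne_top_of_le_ne_top ?_ (hW v hv)
    exact ENNReal.rpow_ne_top_of_nonneg (by norm_num)
      (ENNReal.mul_ne_top ENNReal.ofReal_ne_top (Lp.memLp v).eLpNorm_ne_top)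
  have hae := ae_lt_top' (hm.enorm.lintegral_prod_right'.pow_const _) hfin
  filter_upwards [hae, hm.prodMk_left] with ξ h1 h2
  refine ⟨h2, ?_⟩
  by_contra hcon
  rw [HasFiniteIntegral, not_lt, top_le_iff] at hcon
  simp only [hcon] at h1
  norm_num at h1

theorem ae_ae_shift {P : Td d → Prop} (hP : MeasurableSet {ξ | P ξ}) (h : ∀ᵐ ξ : Td d, P ξ) :
    ∀ᵐ ξ : Td d, ∀ᵐ z : Rd d, P (ξ - toTorus z) := by
  rw [Measure.ae_ae_comm]
  · refine Filter.Eventually.of_forall fun z => ?_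
    exact (measurePreserving_sub_right (volume : Measure (Td d)) (toTorus z)).quasiMeasurePreserving.ae h
  · exact (measurable_fst.sub (measurable_toTorus.comp measurable_snd)) hP

theorem jumpRate_cellRep (a : Rd d → ℝ) (Λ : Rd d → Rd d → ℝ) (ξ : Td d) :
    jumpRate a Λ (cellRep ξ) = ∫ z, shiftKernel a Λ 0 ξ z := by
  rw [jumpRate, ← integral_sub_left_eq_self _ volume (cellRep ξ)]
  refine integral_congr_ae (Filter.Eventually.of_forall fun z => ?_)
  simp [shiftKernel]

theorem aestronglyMeasurable_jumpRate (h : IsPeriodicJumpKernel a Λ) :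
    AEStronglyMeasurable (fun ξ : Td d => jumpRate a Λ (cellRep ξ)) volume := by
  simp only [jumpRate_cellRep]
  exact (h.aestronglyMeasurable_shiftKernel 0).integral_prod_right'

theorem exists_jumpRate_bound (h : IsPeriodicJumpKernel a Λ) :
    ∃ B : ℝ, 0 ≤ B ∧ ∀ ξ : Td d, |jumpRate a Λ (cellRep ξ)| ≤ B := by
  obtain ⟨w, hw, hw0, hwK⟩ := h.exists_dominating 0
  refine ⟨∫ z, w z, integral_nonneg hw0, fun ξ => ?_⟩
  rw [jumpRate_cellRep]
  rw [← Real.norm_eq_abs]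
  refine norm_integral_le_of_norm_le hw (Filter.Eventually.of_forall fun z => ?_)
  rw [Real.norm_eq_abs]
  exact hwK ξ z

theorem exists_eLpNorm_bound (h : IsPeriodicJumpKernel a Λ) (l : Rd d) :
    ∃ W : ℝ, 0 ≤ W ∧ ∀ v : L2Td d,
      AEStronglyMeasurable (fun ξ : Td d => skewedFormula a Λ l v (cellRep ξ)) volume ∧
      eLpNorm (fun ξ : Td d => skewedFormula a Λ l v (cellRep ξ)) 2 volume ≤
        ENNReal.ofReal W * eLpNorm v 2 volume := by
  obtain ⟨W, hW0, hW⟩ := h.exists_lintegral_bound l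
  obtain ⟨B, hB0, hB⟩ := h.exists_jumpRate_bound
  refine ⟨W + B, add_nonneg hW0 hB0, fun v => ?_⟩
  have hv : Measurable v := (Lp.stronglyMeasurable v).measurable
  have hI := (h.aestronglyMeasurable_integrand l hv).integral_prod_right'
  have hG : AEStronglyMeasurable (fun ξ : Td d => (jumpRate a Λ (cellRep ξ) : ℂ) * v ξ) volume :=
    (Complex.continuous_ofReal.comp_aestronglyMeasurable h.aestronglyMeasurable_jumpRate).mul
      hv.aestronglyMeasurable
  simp only [skewedFormula_cellRep]
  refine ⟨hI.sub hG, (eLpNorm_sub_le hI hG (by norm_num)).trans ?_⟩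
  rw [ENNReal.ofReal_add hW0 hB0, add_mul]
  refine add_le_add ?_ ?_
  · rw [← ENNReal.rpow_le_rpow_iff (z := 2) (by norm_num)]
    refine le_trans ?_ (hW v hv)
    rw [eLpNorm_eq_lintegral_rpow_enorm_toReal (by norm_num) (by norm_num), ← ENNReal.rpow_mul]
    norm_num
    refine lintegral_mono fun ξ => ?_
    gcongr
    have := enorm_integral_le_lintegral_enorm (μ := (volume : Measure (Rd d)))
      (fun z : Rd d => (shiftKernel a Λ l ξ z : ℂ) * v (ξ - toTorus z))
    simpa using this
  · refine eLpNorm_le_mul_eLpNorm_of_ae_le_mul (Filter.Eventually.of_forall fun ξ => ?_) 2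
    rw [norm_mul, Complex.norm_real]
    exact mul_le_mul_of_nonneg_right (hB ξ) (norm_nonneg _)

theorem memLp_skewedFormula (h : IsPeriodicJumpKernel a Λ) (l : Rd d) (v : L2Td d) :
    MemLp (fun ξ : Td d => skewedFormula a Λ l v (cellRep ξ)) 2 volume := by
  obtain ⟨W, -, hW⟩ := h.exists_eLpNorm_bound l
  exact ⟨(hW v).1, (hW v).2.trans_lt
    (ENNReal.mul_lt_top ENNReal.ofReal_lt_top (Lp.memLp v).eLpNorm_lt_top)⟩

theorem skewedFormula_add_ae (h : IsPeriodicJumpKernel a Λ) (l : Rd d) (v w : L2Td d) :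
    (fun ξ : Td d => skewedFormula a Λ l (v + w : L2Td d) (cellRep ξ)) =ᵐ[volume]
      (fun ξ : Td d => skewedFormula a Λ l v (cellRep ξ)) +
        (fun ξ : Td d => skewedFormula a Λ l w (cellRep ξ)) := by
  have hP : MeasurableSet {ξ : Td d | (v + w : L2Td d) ξ = v ξ + w ξ} :=
    measurableSet_eq_fun (Lp.stronglyMeasurable _).measurable
      ((Lp.stronglyMeasurable v).measurable.add (Lp.stronglyMeasurable w).measurable)
  have hae : ∀ᵐ ξ : Td d, (v + w : L2Td d) ξ = v ξ + w ξ := Lp.coeFn_add v w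
  filter_upwards [hae, ae_ae_shift hP hae, h.ae_integrable l v, h.ae_integrable l w]
    with ξ h1 h2 h3 h4
  simp only [Pi.add_apply, skewedFormula_cellRep, h1]
  have : ∫ z, (shiftKernel a Λ l ξ z : ℂ) * (v + w : L2Td d) (ξ - toTorus z) =
      (∫ z, (shiftKernel a Λ l ξ z : ℂ) * v (ξ - toTorus z)) +
        ∫ z, (shiftKernel a Λ l ξ z : ℂ) * w (ξ - toTorus z) := by
    rw [← integral_add h3 h4]
    refine integral_congr_ae ?_
    filter_upwards [h2] with z hz
    rw [hz, mul_add]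
  rw [this]
  ring

theorem skewedFormula_smul_ae (_h : IsPeriodicJumpKernel a Λ) (l : Rd d) (c : ℂ) (v : L2Td d) :
    (fun ξ : Td d => skewedFormula a Λ l (c • v : L2Td d) (cellRep ξ)) =ᵐ[volume]
      c • (fun ξ : Td d => skewedFormula a Λ l v (cellRep ξ)) := by
  have hP : MeasurableSet {ξ : Td d | (c • v : L2Td d) ξ = c * v ξ} :=
    measurableSet_eq_fun (Lp.stronglyMeasurable _).measurable
      ((Lp.stronglyMeasurable v).measurable.const_mul c)
  have hae : ∀ᵐ ξ : Td d, (c • v : L2Td d) ξ = c * v ξ := Lp.coeFn_smul c v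
  filter_upwards [hae, ae_ae_shift hP hae] with ξ h1 h2
  simp only [Pi.smul_apply, smul_eq_mul, skewedFormula_cellRep, h1]
  have : ∫ z, (shiftKernel a Λ l ξ z : ℂ) * (c • v : L2Td d) (ξ - toTorus z) =
      c * ∫ z, (shiftKernel a Λ l ξ z : ℂ) * v (ξ - toTorus z) := by
    rw [← integral_const_mul]
    refine integral_congr_ae ?_
    filter_upwards [h2] with z hz
    rw [hz]
    ring
  rw [this]
  ring

end IsPeriodicJumpKernel

/-- The skewed operator `A_l` as a bounded operator on `L²(𝕋^d)`:
`(A_l v)(x) = ∫ a (x - y) Λ (x, y) e^{l · (y - x)} v (y) dy - G x * v x` for almost every `x`, where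
points of the torus are identified with their representatives in the cell (by periodicity of `Λ`
and `v`, the right-hand side does not depend on the choice of the representative). -/
noncomputable def skewedOperator {d : ℕ} {a : Rd d → ℝ} {Λ : Rd d → Rd d → ℝ}
    (h : IsPeriodicJumpKernel a Λ) (l : Rd d) : L2Td d →L[ℂ] L2Td d :=
  LinearMap.mkContinuousOfExistsBound
    { toFun := fun v => (h.memLp_skewedFormula l v).toLp
        (fun ξ : Td d => skewedFormula a Λ l v (cellRep ξ))
      map_add' := fun v w => by
        rw [← MemLp.toLp_add]
        exact MemLp.toLp_congr _ _ (h.skewedFormula_add_ae l v w)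
      map_smul' := fun c v => by
        rw [RingHom.id_apply, ← MemLp.toLp_const_smul]
        exact MemLp.toLp_congr _ _ (h.skewedFormula_smul_ae l c v) }
    (by
      obtain ⟨W, hW0, hW⟩ := h.exists_eLpNorm_bound l
      refine ⟨W, fun v => ?_⟩
      have h2 := ENNReal.toReal_mono
        (ENNReal.mul_ne_top ENNReal.ofReal_ne_top (Lp.memLp v).eLpNorm_ne_top) (hW v).2
      rw [ENNReal.toReal_mul, ENNReal.toReal_ofReal hW0] at h2
      rw [← Lp.norm_def] at h2
      exact (Lp.norm_toLp _ (h.memLp_skewedFormula l v)).trans_le h2)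

theorem skewedOperator_ae_eq {d : ℕ} {a : Rd d → ℝ} {Λ : Rd d → Rd d → ℝ}
    (h : IsPeriodicJumpKernel a Λ) (l : Rd d) (v : L2Td d) :
    skewedOperator h l v =ᵐ[volume] fun ξ : Td d => skewedFormula a Λ l v (cellRep ξ) :=
  (h.memLp_skewedFormula l v).coeFn_toLp

/-- `𝚜(T)`: the maximum of the real parts of the elements of the spectrum of `T`. -/
noncomputable def spectralBound {d : ℕ} (T : L2Td d →L[ℂ] L2Td d) : ℝ :=
  sSup (Complex.re '' spectrum ℂ T)

/-- `t` is an eigenvalue of `T` which strictly exceeds the real part of any other element of the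
spectrum of `T`. -/
def IsPrincipalEigenvalue {d : ℕ} (T : L2Td d →L[ℂ] L2Td d) (t : ℝ) : Prop :=
  Module.End.HasEigenvalue (T : L2Td d →ₗ[ℂ] L2Td d) (t : ℂ) ∧
    ∀ z ∈ spectrum ℂ T, z ≠ (t : ℂ) → z.re < t

/-- The function `θ`: the largest real part of the spectrum of the skewed operator. -/
noncomputable def theta {d : ℕ} {a : Rd d → ℝ} {Λ : Rd d → Rd d → ℝ}
    (h : IsPeriodicJumpKernel a Λ) (l : Rd d) : ℝ :=
  spectralBound (skewedOperator h l)

/-- The set `Γ = {l | θ l > -g_min}`. -/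
def GammaSet {d : ℕ} {a : Rd d → ℝ} {Λ : Rd d → Rd d → ℝ} (h : IsPeriodicJumpKernel a Λ) :
    Set (Rd d) :=
  {l | -gMin a Λ < theta h l}

/-- The Hessian matrix `∂²f / ∂l_i ∂l_j` of `f` at `l`. -/
noncomputable def hessianMatrix {d : ℕ} (f : Rd d → ℝ) (l : Rd d) : Matrix (Fin d) (Fin d) ℝ :=
  Matrix.of fun i j =>
    iteratedFDeriv ℝ 2 f l ![EuclideanSpace.single i (1 : ℝ), EuclideanSpace.single j (1 : ℝ)]

/-! ### Domination and positive operators on complex `L²` -/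

/-! Write A_λ = K_λ - G, where K_λ is the integral part after the substitution y = x - z. The
operator K_λ is positive. It is compact, because its density is an L¹ limit of bounded compactly
supported densities, and those give operators from L² to L^∞, hence Hilbert–Schmidt ones. It is
irreducible, because a set invariant under the jumps z with a(z) > 0 is invariant under all
translations. For Re z > -g_min multiplication by G + z is boundedly invertible, so by the Fredholm
alternative every spectral point of A_λ in that half-plane is an eigenvalue.

Perron–Frobenius (`PerronData.exists_perronPair`, `PerronData.eq_of_re_eq`). Let λ ∈ Γ and s = θ(λ).
Since A_λ + c is positive for large c, the resolvent is positive to the right of s. Applied to |f|,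
with f an eigenvector whose eigenvalue has real part s, it produces nonnegative approximate
eigenvectors. Compactness turns them into a true one, and irreducibility makes it strictly positive.
The adjoint likewise has a positive eigenvector ψ. Pairing with ψ upgrades (A_λ - s)|f| ≥ 0 to an
equality, which excludes other spectrum on the line Re z = s and makes s simple.

Regularity (`exists_smooth_eigenpair`). All exponential moments of a are finite, so λ ↦ K_λ is
smooth in operator norm. The implicit function theorem gives a smooth local branch of eigenpairs.
Upper semicontinuity of the spectrum makes θ continuous, and uniqueness of the branch identifies it
with θ and its positive eigenfunction.

Convexity (`lintegral_gapDensity`). For λ = tλ₁ + (1-t)λ₂ take the positive eigenfunctions u₁, u₂ at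
λ₁, λ₂ and test with U = u₁^t u₂^(1-t). Pairing (tθ(λ₁) + (1-t)θ(λ₂) - A_λ)U with ψ writes (tθ(λ₁) +
(1-t)θ(λ₂) - θ(λ))⟨ψ, U⟩ as the integral of a positive density times the Jensen gap of exp at the
increments X_i = -(λ_i - λ)·z + log u_i(ξ - z) - log u_i(ξ). If it vanishes, then X₁ = X₂ whenever
a(z) > 0, so log(u₁/u₂) is a function on the torus with increments (λ₁ - λ₂)·z. This identity
extends to all z, and z = e_i gives λ₁ = λ₂. For the Hessian, the same identity at λ ± sα with t =
1/2 is divided by s². By Fatou, a nonpositive second derivative along α would give a function on the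
torus with increments α·z, so α = 0. -/

section Domination

variable {α : Type*} [MeasurableSpace α] {μ : Measure α}

/-- `f` is dominated by `g`: almost everywhere, `g` is real and `‖f‖ ≤ g`. -/
def Dominated (f g : Lp ℂ 2 μ) : Prop := ∀ᵐ x ∂μ, ‖f x‖ ≤ (g x).re ∧ (g x).im = 0

/-- An operator is positive if it preserves domination. -/
def IsPositiveOp (T : Lp ℂ 2 μ →L[ℂ] Lp ℂ 2 μ) : Prop :=
  ∀ f g, Dominated f g → Dominated (T f) (T g)

/-- The absolute value of an element of `L²`, as an element of `L²`. -/
noncomputable def absL2 (f : Lp ℂ 2 μ) : Lp ℂ 2 μ :=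
  (Lp.memLp f).norm.ofReal.toLp (fun x => ((‖f x‖ : ℝ) : ℂ))

theorem absL2_ae (f : Lp ℂ 2 μ) : ∀ᵐ x ∂μ, absL2 f x = (‖f x‖ : ℂ) := MemLp.coeFn_toLp _

theorem dominated_absL2 (f : Lp ℂ 2 μ) : Dominated f (absL2 f) := by
  filter_upwards [absL2_ae f] with x hx
  simp [hx]

theorem norm_absL2 (f : Lp ℂ 2 μ) : ‖absL2 f‖ = ‖f‖ := by
  refine le_antisymm (Lp.norm_le_norm_of_ae_le ?_) (Lp.norm_le_norm_of_ae_le ?_) <;>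
  · filter_upwards [absL2_ae f] with x hx
    simp [hx]

theorem Dominated.norm_le {f g : Lp ℂ 2 μ} (h : Dominated f g) : ‖f‖ ≤ ‖g‖ := by
  refine Lp.norm_le_norm_of_ae_le ?_
  filter_upwards [h] with x hx
  exact hx.1.trans (Complex.re_le_norm _)

theorem Dominated.nonneg {f g : Lp ℂ 2 μ} (h : Dominated f g) : Dominated g g := by
  filter_upwards [h] with x hx
  refine ⟨?_, hx.2⟩
  have h0 : 0 ≤ (g x).re := (norm_nonneg _).trans hx.1
  rw [← Complex.re_add_im (g x), hx.2]
  simp [abs_of_nonneg h0]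

theorem Dominated.add {f g f' g' : Lp ℂ 2 μ} (h : Dominated f g) (h' : Dominated f' g') :
    Dominated (f + f') (g + g') := by
  filter_upwards [h, h', Lp.coeFn_add f f', Lp.coeFn_add g g'] with x h1 h2 h3 h4
  rw [h3, h4]
  simp only [Pi.add_apply, Complex.add_re, Complex.add_im, h1.2, h2.2, add_zero, and_true]
  exact (norm_add_le _ _).trans (add_le_add h1.1 h2.1)

theorem Dominated.smul {f g : Lp ℂ 2 μ} (h : Dominated f g) {c : ℝ} (hc : 0 ≤ c) :
    Dominated ((c : ℂ) • f) ((c : ℂ) • g) := by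
  filter_upwards [h, Lp.coeFn_smul (c : ℂ) f, Lp.coeFn_smul (c : ℂ) g] with x h1 h3 h4
  rw [h3, h4]
  simp only [Pi.smul_apply, smul_eq_mul, norm_mul, Complex.norm_real, Real.norm_eq_abs,
    abs_of_nonneg hc, Complex.re_ofReal_mul, Complex.im_ofReal_mul, h1.2, mul_zero, and_true]
  exact mul_le_mul_of_nonneg_left h1.1 hc

theorem dominated_zero : Dominated (0 : Lp ℂ 2 μ) 0 := by
  filter_upwards [Lp.coeFn_zero ℂ 2 μ] with x hx
  rw [hx]
  simp

theorem dominated_self_of_eq {g : Lp ℂ 2 μ} (u : α → ℝ) (hu : ∀ᵐ x ∂μ, 0 ≤ u x)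
    (h : ∀ᵐ x ∂μ, g x = (u x : ℂ)) : Dominated g g := by
  filter_upwards [hu, h] with x h1 h2
  simp [h2, abs_of_nonneg h1]

theorem integrable_conj_mul (f g : Lp ℂ 2 μ) :
    Integrable (fun x => (starRingEnd ℂ) (f x) * g x) μ := by
  simpa [mul_comm] using L2.integrable_inner (𝕜 := ℂ) f g

theorem inner_L2_eq (f g : Lp ℂ 2 μ) :
    inner ℂ f g = ∫ x, (starRingEnd ℂ) (f x) * g x ∂μ := by
  rw [L2.inner_def]
  simp [mul_comm]

theorem Dominated.inner_le {f g φ φ' : Lp ℂ 2 μ} (h : Dominated f g) (h' : Dominated φ φ') :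
    ‖inner ℂ φ f‖ ≤ (inner ℂ φ' g : ℂ).re ∧ (inner ℂ φ' g : ℂ).im = 0 := by
  have e : inner ℂ φ' g = ((∫ x, (φ' x).re * (g x).re ∂μ : ℝ) : ℂ) := by
    rw [inner_L2_eq, ← integral_complex_ofReal]
    refine integral_congr_ae ?_
    filter_upwards [h, h'] with x h1 h2
    apply Complex.ext <;> simp [h1.2, h2.2]
  have hint : Integrable (fun x => (φ' x).re * (g x).re) μ := by
    refine (integrable_conj_mul φ' g).re.congr ?_
    filter_upwards [h, h'] with x h1 h2
    simp [h1.2, h2.2]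
  rw [e, Complex.ofReal_re, Complex.ofReal_im, inner_L2_eq]
  refine ⟨norm_integral_le_of_norm_le hint ?_, rfl⟩
  filter_upwards [h, h'] with x h1 h2
  rw [norm_mul, RCLike.norm_conj]
  exact mul_le_mul h2.1 h1.1 (norm_nonneg _) ((norm_nonneg _).trans h2.1)

/-- Converse of `Dominated.inner_le`. Testing f with its own phase on s, and g with the indicator of
s, gives ∫_s |f| ≤ Re ∫_s g and Im ∫_s g = 0 for every measurable s. Domination is thus a condition
on inner products, which is why it survives limits and passes to adjoints. -/
theorem dominated_of_forall_inner [IsFiniteMeasure μ] {f g : Lp ℂ 2 μ}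
    (H : ∀ φ φ' : Lp ℂ 2 μ, Dominated φ φ' →
      ‖inner ℂ φ f‖ ≤ (inner ℂ φ' g : ℂ).re ∧ (inner ℂ φ' g : ℂ).im = 0) :
    Dominated f g := by
  have hf1 : Integrable f μ := (Lp.memLp f).integrable (by norm_num)
  have hg1 : Integrable g μ := (Lp.memLp g).integrable (by norm_num)
  have key : ∀ s : Set α, MeasurableSet s →
      ∫ x in s, ‖f x‖ ∂μ ≤ (∫ x in s, g x ∂μ).re ∧ (∫ x in s, g x ∂μ).im = 0 := by
    intro s hs
    have hs' : μ s ≠ ⊤ := measure_ne_top μ s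
    -- The phase f/|f| on s. Where f = 0 the inverse is 0 by convention, so the test function
    -- vanishes there and still has modulus at most 1.
    have hmem : MemLp (s.indicator fun x => f x * ((‖f x‖⁻¹ : ℝ) : ℂ)) 2 μ := by
      have hm : AEStronglyMeasurable (fun x => f x * ((‖f x‖⁻¹ : ℝ) : ℂ)) μ := by
        have := (Lp.stronglyMeasurable f).measurable
        exact (by fun_prop : Measurable fun x => f x * ((‖f x‖⁻¹ : ℝ) : ℂ)).aestronglyMeasurable
      refine MemLp.of_bound (hm.indicator hs) 1 (Filter.Eventually.of_forall fun x => ?_)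
      refine (norm_indicator_le_norm_self _ x).trans ?_
      by_cases h0 : f x = 0 <;> simp [h0]
    set φ : Lp ℂ 2 μ := hmem.toLp
    set φ' : Lp ℂ 2 μ := indicatorConstLp 2 hs hs' (1 : ℂ)
    have hφ : ∀ᵐ x ∂μ, φ x = s.indicator (fun x => f x * ((‖f x‖⁻¹ : ℝ) : ℂ)) x :=
      MemLp.coeFn_toLp _
    have hφ' : ∀ᵐ x ∂μ, φ' x = s.indicator (fun _ => (1 : ℂ)) x := indicatorConstLp_coeFn
    have hd : Dominated φ φ' := by
      filter_upwards [hφ, hφ'] with x h1 h2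
      rw [h1, h2]
      by_cases hx : x ∈ s
      · by_cases h0 : f x = 0 <;> simp [hx, h0]
      · simp [hx]
    have h1 : inner ℂ φ' g = ∫ x in s, g x ∂μ := L2.inner_indicatorConstLp_one hs hs' g
    have h2 : inner ℂ φ f = ((∫ x in s, ‖f x‖ ∂μ : ℝ) : ℂ) := by
      rw [inner_L2_eq, ← integral_indicator hs, ← integral_complex_ofReal]
      refine integral_congr_ae ?_
      filter_upwards [hφ] with x h1
      rw [h1]
      by_cases hx : x ∈ s
      · by_cases h0 : f x = 0
        · simp [hx, h0]
        · have hn : (‖f x‖ : ℂ) ≠ 0 := by simpa using h0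
          have := Complex.conj_mul' (f x)
          rw [Set.indicator_of_mem hx, Set.indicator_of_mem hx, map_mul, Complex.conj_ofReal,
            mul_right_comm, this, Complex.ofReal_inv, pow_two, mul_assoc, mul_inv_cancel₀ hn,
            mul_one]
      · simp [hx]
    have := H φ φ' hd
    rw [h1, h2, Complex.norm_real, Real.norm_eq_abs] at this
    exact ⟨(le_abs_self _).trans this.1, this.2⟩
  have hre : ∀ s : Set α, (∫ x in s, g x ∂μ).re = ∫ x in s, (g x).re ∂μ := fun s =>
    (integral_re (𝕜 := ℂ) hg1.integrableOn).symm
  have him : ∀ s : Set α, (∫ x in s, g x ∂μ).im = ∫ x in s, (g x).im ∂μ := fun s =>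
    (integral_im (𝕜 := ℂ) hg1.integrableOn).symm
  have h1 : (fun x => ‖f x‖) ≤ᵐ[μ] fun x => (g x).re := by
    refine ae_le_of_forall_setIntegral_le hf1.norm hg1.re fun s hs _ => ?_
    exact (key s hs).1.trans (hre s).le
  have h2 : (fun x => (g x).im) =ᵐ[μ] 0 := by
    refine ae_eq_zero_of_forall_setIntegral_eq_of_sigmaFinite
      (fun s _ _ => hg1.im.integrableOn) fun s hs _ => ?_
    exact (him s).symm.trans (key s hs).2
  filter_upwards [h1, h2] with x a b using ⟨a, b⟩

theorem dominated_of_tendsto [IsFiniteMeasure μ] {ι : Type*} {l : Filter ι} [l.NeBot]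
    {f g : ι → Lp ℂ 2 μ} {f₀ g₀ : Lp ℂ 2 μ} (hf : Filter.Tendsto f l (nhds f₀))
    (hg : Filter.Tendsto g l (nhds g₀)) (h : ∀ᶠ i in l, Dominated (f i) (g i)) :
    Dominated f₀ g₀ := by
  refine dominated_of_forall_inner fun φ φ' hφ => ?_
  have t1 : Filter.Tendsto (fun i => (inner ℂ φ (f i) : ℂ)) l (nhds (inner ℂ φ f₀)) :=
    ((innerSL ℂ φ).continuous.tendsto _).comp hf
  have t2 : Filter.Tendsto (fun i => (inner ℂ φ' (g i) : ℂ)) l (nhds (inner ℂ φ' g₀)) :=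
    ((innerSL ℂ φ').continuous.tendsto _).comp hg
  constructor
  · exact le_of_tendsto_of_tendsto t1.norm ((Complex.continuous_re.tendsto _).comp t2)
      (h.mono fun i hi => (hi.inner_le hφ).1)
  · exact tendsto_nhds_unique ((Complex.continuous_im.tendsto _).comp t2)
      (tendsto_const_nhds.congr' (h.mono fun i hi => (hi.inner_le hφ).2.symm))

namespace IsPositiveOp

variable {S T : Lp ℂ 2 μ →L[ℂ] Lp ℂ 2 μ}

theorem one : IsPositiveOp (1 : Lp ℂ 2 μ →L[ℂ] Lp ℂ 2 μ) := fun _ _ h => h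

theorem zero : IsPositiveOp (0 : Lp ℂ 2 μ →L[ℂ] Lp ℂ 2 μ) := fun _ _ _ => dominated_zero

theorem add (hS : IsPositiveOp S) (hT : IsPositiveOp T) : IsPositiveOp (S + T) :=
  fun f g h => (hS f g h).add (hT f g h)

theorem mul (hS : IsPositiveOp S) (hT : IsPositiveOp T) : IsPositiveOp (S * T) :=
  fun f g h => hS _ _ (hT f g h)

theorem smul (hS : IsPositiveOp S) {c : ℝ} (hc : 0 ≤ c) : IsPositiveOp ((c : ℂ) • S) :=
  fun f g h => (hS f g h).smul hc

theorem pow (hS : IsPositiveOp S) (n : ℕ) : IsPositiveOp (S ^ n) := by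
  induction n with
  | zero => simpa using one
  | succ n ih => rw [pow_succ]; exact ih.mul hS

theorem sum {ι : Type*} (s : Finset ι) {F : ι → Lp ℂ 2 μ →L[ℂ] Lp ℂ 2 μ}
    (hF : ∀ i, IsPositiveOp (F i)) : IsPositiveOp (∑ i ∈ s, F i) := by
  classical
  induction s using Finset.induction_on with
  | empty => simpa using zero
  | insert i s hi ih => rw [Finset.sum_insert hi]; exact (hF i).add ih

theorem of_hasSum [IsFiniteMeasure μ] {ι : Type*} {F : ι → Lp ℂ 2 μ →L[ℂ] Lp ℂ 2 μ}
    (hF : ∀ i, IsPositiveOp (F i)) (h : HasSum F T) : IsPositiveOp T := by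
  intro f g hfg
  have e : ∀ v : Lp ℂ 2 μ, Filter.Tendsto (fun s : Finset ι => (∑ i ∈ s, F i) v)
      Filter.atTop (nhds (T v)) := fun v =>
    ((ContinuousLinearMap.apply ℂ (Lp ℂ 2 μ) v).continuous.tendsto T).comp h
  exact dominated_of_tendsto (e f) (e g) (Filter.Eventually.of_forall fun s => sum s hF f g hfg)

theorem adjoint [IsFiniteMeasure μ] (hT : IsPositiveOp T) :
    IsPositiveOp (ContinuousLinearMap.adjoint T) := by
  intro f g hfg
  refine dominated_of_forall_inner fun φ φ' hφ => ?_
  rw [ContinuousLinearMap.adjoint_inner_right, ContinuousLinearMap.adjoint_inner_right]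
  exact hfg.inner_le (hT _ _ hφ)

end IsPositiveOp

end Domination

/-! ### Multiplication operators and the Fredholm alternative -/

section Multiplication

open scoped ENNReal

variable {α : Type*} [MeasurableSpace α] {μ : Measure α}

/-- Multiplication by an essentially bounded function, as an operator on `L²`. -/
noncomputable def mulOp (g : α → ℂ) (hg : MemLp g ∞ μ) : Lp ℂ 2 μ →L[ℂ] Lp ℂ 2 μ :=
  (ContinuousLinearMap.mul ℂ ℂ).holderL μ ∞ 2 2 hg.toLp

theorem mulOp_ae (g : α → ℂ) (hg : MemLp g ∞ μ) (f : Lp ℂ 2 μ) :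
    ∀ᵐ x ∂μ, mulOp g hg f x = g x * f x := by
  filter_upwards [(ContinuousLinearMap.mul ℂ ℂ).coeFn_holder (r := 2) hg.toLp f, hg.coeFn_toLp]
    with x h1 h2
  rw [mulOp, ContinuousLinearMap.holderL_apply_apply, h1, h2]
  rfl

theorem mulOp_mul_mulOp_eq_one {g g' : α → ℂ} (hg : MemLp g ∞ μ) (hg' : MemLp g' ∞ μ)
    (h : ∀ᵐ x ∂μ, g x * g' x = 1) : mulOp g hg * mulOp g' hg' = 1 := by
  ext1 f
  refine Lp.ext ?_
  filter_upwards [mulOp_ae g hg (mulOp g' hg' f), mulOp_ae g' hg' f, h] with x h1 h2 h3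
  rw [mul_apply_eq_comp, h1, h2, ← mul_assoc, h3, one_mul]
  rfl

theorem adjoint_mulOp_real (G : α → ℝ) (hG : MemLp (fun x => (G x : ℂ)) ∞ μ) :
    ContinuousLinearMap.adjoint (mulOp _ hG) = mulOp _ hG := by
  symm
  rw [ContinuousLinearMap.eq_adjoint_iff]
  intro f g
  rw [inner_L2_eq, inner_L2_eq]
  refine integral_congr_ae ?_
  filter_upwards [mulOp_ae _ hG f, mulOp_ae _ hG g] with x h1 h2
  rw [h1, h2]
  simp
  ring

theorem isPositiveOp_mulOp (G : α → ℝ) (hG : MemLp (fun x => (G x : ℂ)) ∞ μ)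
    (h0 : ∀ᵐ x ∂μ, 0 ≤ G x) : IsPositiveOp (mulOp _ hG) := by
  intro f g hfg
  filter_upwards [mulOp_ae _ hG f, mulOp_ae _ hG g, h0, hfg] with x h1 h2 h3 h4
  rw [h1, h2]
  simp only [norm_mul, Complex.norm_real, Real.norm_eq_abs, abs_of_nonneg h3,
    Complex.re_ofReal_mul, Complex.im_ofReal_mul, h4.2, mul_zero, and_true]
  exact mul_le_mul_of_nonneg_left h4.1 h3

/-- Fredholm alternative for a compact perturbation of an invertible multiplication operator. -/
theorem isUnit_compact_sub_mulOp {C : Lp ℂ 2 μ →L[ℂ] Lp ℂ 2 μ} (hC : IsCompactOperator C)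
    {g : α → ℂ} (hg : MemLp g ∞ μ) {δ : ℝ} (hδ : 0 < δ) (hgδ : ∀ᵐ x ∂μ, δ ≤ ‖g x‖)
    (hinj : ∀ f, C f = mulOp g hg f → f = 0) : IsUnit (C - mulOp g hg) := by
  have hg' : MemLp (fun x => (g x)⁻¹) ∞ μ := by
    refine memLp_top_of_bound hg.1.aemeasurable.inv.aestronglyMeasurable δ⁻¹ ?_
    filter_upwards [hgδ] with x hx
    rw [norm_inv]
    exact inv_anti₀ hδ hx
  have e1 : mulOp g hg * mulOp _ hg' = 1 := by
    refine mulOp_mul_mulOp_eq_one hg hg' ?_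
    filter_upwards [hgδ] with x hx
    exact mul_inv_cancel₀ (norm_pos_iff.1 (hδ.trans_le hx))
  have e2 : mulOp _ hg' * mulOp g hg = 1 := by
    refine mulOp_mul_mulOp_eq_one hg' hg ?_
    filter_upwards [hgδ] with x hx
    exact inv_mul_cancel₀ (norm_pos_iff.1 (hδ.trans_le hx))
  have hcomp : IsCompactOperator (C * mulOp _ hg') := hC.comp_clm (mulOp _ hg')
  have hu : IsUnit (mulOp g hg) := ⟨⟨_, _, e1, e2⟩, rfl⟩
  -- C - M_g = (C M_{1/g} - 1) M_g, and C M_{1/g} is compact. If 1 were an eigenvalue of it with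
  -- eigenvector w, then M_{1/g} w would lie in the kernel of C - M_g.
  have h1 : IsUnit (C * mulOp _ hg' - 1) := by
    rcases hcomp.hasEigenvalue_or_mem_resolventSet (one_ne_zero (α := ℂ)) with h | h
    · obtain ⟨w, hw, hw0⟩ := h.exists_hasEigenvector
      rw [Module.End.mem_eigenspace_iff] at hw
      have hw' : C (mulOp _ hg' w) = w := by simpa using hw
      refine absurd ?_ hw0
      have hm : mulOp g hg (mulOp _ hg' w) = w := DFunLike.congr_fun e1 w
      have := hinj (mulOp _ hg' w) (by rw [hw', hm])
      rw [← hm, this, map_zero]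
    · rw [spectrum.mem_resolventSet_iff, map_one] at h
      simpa using h.neg
  have : C - mulOp g hg = (C * mulOp _ hg' - 1) * mulOp g hg := by
    rw [sub_mul, mul_assoc, e2, mul_one, one_mul]
  rw [this]
  exact h1.mul hu

end Multiplication

/-! ### Perron–Frobenius theory for `K - G` with `K` compact, positive and irreducible -/

section Resolvent

open Filter Topology
open scoped ENNReal NNReal

variable {α : Type*} [MeasurableSpace α] {μ : Measure α}

/-- The Neumann series under mere summability of the powers: in the application the spectral radius
of y is below one, but its norm need not be. -/
theorem exists_inverse_of_summable_pow {R : Type*} [NormedRing R] [CompleteSpace R] {y : R}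
    (h : Summable fun n : ℕ => y ^ n) :
    (1 - y) * ∑' n : ℕ, y ^ n = 1 ∧ (∑' n : ℕ, y ^ n) * (1 - y) = 1 := by
  have h0 := h.tsum_eq_zero_add
  rw [pow_zero] at h0
  have h1 : ∑' n : ℕ, y ^ (n + 1) = y * ∑' n : ℕ, y ^ n := by
    rw [← h.tsum_mul_left]
    exact tsum_congr fun n => pow_succ' y n
  have h2 : ∑' n : ℕ, y ^ (n + 1) = (∑' n : ℕ, y ^ n) * y := by
    rw [← h.tsum_mul_right]
    exact tsum_congr fun n => pow_succ y n
  constructor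
  · rw [sub_mul, one_mul, ← h1]
    exact sub_eq_of_eq_add h0
  · rw [mul_sub, mul_one, ← h2]
    exact sub_eq_of_eq_add h0

/-- Gelfand's formula: for r strictly between the spectral radius and ρ, ‖P^n‖ ≤ r^n eventually, and
the series is dominated by a geometric one of ratio r/ρ. -/
theorem summable_pow_of_spectrum_lt {R : Type*} [NormedRing R] [NormedAlgebra ℂ R]
    [CompleteSpace R] [Nontrivial R] (P : R) {ρ : ℝ} (hρ : 0 < ρ)
    (h : ∀ w ∈ spectrum ℂ P, ‖w‖ < ρ) :
    Summable fun n : ℕ => (((ρ⁻¹ : ℝ) : ℂ) • P) ^ n := by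
  obtain ⟨r, hr0, hr⟩ : ∃ r : ℝ≥0, spectralRadius ℂ P < r ∧ (r : ℝ) < ρ := by
    have hlt : spectralRadius ℂ P < (ρ.toNNReal : ℝ≥0∞) := by
      refine spectrum.spectralRadius_lt_of_forall_lt P fun z hz => ?_
      rw [← NNReal.coe_lt_coe, coe_nnnorm, Real.coe_toNNReal _ hρ.le]
      exact h z hz
    obtain ⟨r, hr1, hr2⟩ := ENNReal.lt_iff_exists_nnreal_btwn.1 hlt
    refine ⟨r, hr1, ?_⟩
    have := NNReal.coe_lt_coe.2 (ENNReal.coe_lt_coe.1 hr2)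
    rwa [Real.coe_toNNReal _ hρ.le] at this
  have hg := spectrum.pow_nnnorm_pow_one_div_tendsto_nhds_spectralRadius P
  have hev : ∀ᶠ n : ℕ in atTop, ‖P ^ n‖ ≤ (r : ℝ) ^ n := by
    filter_upwards [hg.eventually_lt_const hr0, eventually_gt_atTop 0] with n hn hn0
    have h1 : ((‖P ^ n‖₊ : ℝ≥0∞) ^ (1 / n : ℝ)) ^ (n : ℝ) ≤ (r : ℝ≥0∞) ^ (n : ℝ) :=
      ENNReal.rpow_le_rpow hn.le (by positivity)
    rw [← ENNReal.rpow_mul, one_div_mul_cancel (by positivity), ENNReal.rpow_one,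
      ENNReal.rpow_natCast, ← ENNReal.coe_pow, ENNReal.coe_le_coe] at h1
    exact_mod_cast h1
  have hgeom : Summable fun n : ℕ => ((r : ℝ) / ρ) ^ n :=
    summable_geometric_of_lt_one (by positivity) ((div_lt_one hρ).2 hr)
  refine Summable.of_norm_bounded_eventually_nat hgeom ?_
  filter_upwards [hev] with n hn
  rw [smul_pow, norm_smul, norm_pow, Complex.norm_real, Real.norm_eq_abs,
    abs_of_pos (inv_pos.2 hρ), div_pow, div_eq_inv_mul, inv_pow]
  gcongr

/-- For c large the open disc of centre -c and radius m + c contains the spectrum, which lies in a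
bounded part of Re z ≤ s < m. Hence m - A = (m + c) - (A + c) is inverted by a Neumann series in the
positive operator A + c, and every term of it is positive. -/
theorem exists_isPositiveOp_resolvent [IsFiniteMeasure μ] [Nontrivial (Lp ℂ 2 μ)]
    {A : Lp ℂ 2 μ →L[ℂ] Lp ℂ 2 μ} {c₀ : ℝ}
    (hA : ∀ c : ℝ, c₀ ≤ c → IsPositiveOp (A + (c : ℂ) • 1)) {s m : ℝ}
    (hs : ∀ z ∈ spectrum ℂ A, z.re ≤ s) (hm : s < m) :
    ∃ R, IsPositiveOp R ∧ R * ((m : ℂ) • 1 - A) = 1 ∧ ((m : ℂ) • 1 - A) * R = 1 := by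
  -- The four bounds serve, in order: positivity of A + c; Re w ≥ 0 for w in the spectrum of A + c;
  -- m + c > 0 and c > 0; and (m + c)² - (s + c)² > ‖A‖², which beats the contribution of the
  -- imaginary part to |w|².
  set c : ℝ := max (max c₀ ‖A‖) (max (|m| + 1) (|m + s| + ‖A‖ ^ 2 / (m - s))) with hc
  have hc0 : c₀ ≤ c := (le_max_left _ _).trans (le_max_left _ _)
  have hc1 : ‖A‖ ≤ c := (le_max_right _ _).trans (le_max_left _ _)
  have hc2 : |m| + 1 ≤ c := (le_max_left _ _).trans (le_max_right _ _)
  have hc3 : |m + s| + ‖A‖ ^ 2 / (m - s) ≤ c := (le_max_right _ _).trans (le_max_right _ _)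
  have hρ : 0 < m + c := by linarith [neg_abs_le m]
  have hcpos : 0 < c := by linarith [abs_nonneg m]
  set P := A + (c : ℂ) • (1 : Lp ℂ 2 μ →L[ℂ] Lp ℂ 2 μ) with hP
  have hms : 0 < m - s := sub_pos.2 hm
  have hsp : ∀ w ∈ spectrum ℂ P, ‖w‖ < m + c := by
    intro w hw
    have hz : w - c ∈ spectrum ℂ A := by
      have h1 : w ∈ spectrum ℂ (algebraMap ℂ (Lp ℂ 2 μ →L[ℂ] Lp ℂ 2 μ) c + A) := by
        rwa [Algebra.algebraMap_eq_smul_one, add_comm]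
      rw [← spectrum.singleton_add_eq] at h1
      obtain ⟨a, ha, b, hb, hab⟩ := Set.mem_add.1 h1
      rw [Set.mem_singleton_iff] at ha
      rw [← hab, ha, add_sub_cancel_left]
      exact hb
    have hre := hs _ hz
    have hn : ‖w - c‖ ≤ ‖A‖ := spectrum.norm_le_norm_of_mem hz
    have hre' := (Complex.abs_re_le_norm (w - c)).trans hn
    have him := (Complex.abs_im_le_norm (w - c)).trans hn
    simp only [Complex.sub_re, Complex.ofReal_re, Complex.sub_im, Complex.ofReal_im,
      sub_zero] at hre hre' him
    have h4 : ‖A‖ ^ 2 ≤ (c - |m + s|) * (m - s) := by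
      rw [← div_le_iff₀ hms]; linarith
    have hw0 : 0 ≤ w.re := by linarith [(abs_le.1 hre').1]
    have h5 : w.im ^ 2 ≤ ‖A‖ ^ 2 := by
      rw [← sq_abs w.im]; exact pow_le_pow_left₀ (abs_nonneg _) him 2
    have h6 : w.re ^ 2 ≤ (s + c) ^ 2 := pow_le_pow_left₀ hw0 (by linarith) 2
    refine lt_of_pow_lt_pow_left₀ 2 hρ.le ?_
    rw [Complex.sq_norm, Complex.normSq_apply]
    have h7 := mul_le_mul_of_nonneg_right (neg_abs_le (m + s)) hms.le
    have h8 : 0 < c * (m - s) := mul_pos hcpos hms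
    nlinarith
  have hsum := summable_pow_of_spectrum_lt P hρ hsp
  set y := (((m + c)⁻¹ : ℝ) : ℂ) • P with hy
  obtain ⟨e1, e2⟩ := exists_inverse_of_summable_pow hsum
  have hpos : IsPositiveOp (∑' n : ℕ, y ^ n) :=
    IsPositiveOp.of_hasSum (fun n => ((hA c hc0).smul (inv_pos.2 hρ).le).pow n) hsum.hasSum
  have hne : ((m + c : ℝ) : ℂ) ≠ 0 := by exact_mod_cast hρ.ne'
  have e3 : (m : ℂ) • 1 - A = ((m + c : ℝ) : ℂ) • (1 - y) := by
    rw [smul_sub, hy, smul_smul, Complex.ofReal_inv, mul_inv_cancel₀ hne, one_smul, hP,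
      Complex.ofReal_add, add_smul]
    abel
  refine ⟨(((m + c)⁻¹ : ℝ) : ℂ) • ∑' n : ℕ, y ^ n, hpos.smul (inv_pos.2 hρ).le, ?_, ?_⟩
  · rw [e3, smul_mul_smul_comm, e2, Complex.ofReal_inv, inv_mul_cancel₀ hne, one_smul]
  · rw [e3, smul_mul_smul_comm, e1, Complex.ofReal_inv, mul_inv_cancel₀ hne, one_smul]

theorem isGreatest_sSup_re_spectrum {R : Type*} [NormedRing R] [NormedAlgebra ℂ R]
    [CompleteSpace R] [Nontrivial R] (A : R) :
    IsGreatest (Complex.re '' spectrum ℂ A) (sSup (Complex.re '' spectrum ℂ A)) :=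
  ((spectrum.isCompact A).image Complex.continuous_re).isGreatest_sSup
    ((spectrum.nonempty A).image _)

end Resolvent

/-! ### Adjoints of compact operators -/

section CompactAdjoint

open Filter Topology

variable {E : Type*} [NormedAddCommGroup E] [InnerProductSpace ℂ E] [CompleteSpace E]

/-- With S = T*, ‖Sx‖² = ⟨x, TSx⟩ ≤ ‖x‖ ‖TSx‖. On differences of points of the unit ball, where ‖x‖
≤ 2, a net of mesh ε²/2 for the image under the compact operator TS therefore yields a net of mesh ε
for the image under S. -/
theorem isCompactOperator_adjoint {T : E →L[ℂ] E} (hT : IsCompactOperator T) :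
    IsCompactOperator (ContinuousLinearMap.adjoint T) := by
  set S := ContinuousLinearMap.adjoint T with hS
  have hTS : IsCompactOperator (T ∘L S) := hT.comp_clm S
  refine (isCompactOperator_iff_isCompact_closure_image_closedBall (S : E →ₗ[ℂ] E) one_pos).2 ?_
  have htb : TotallyBounded ((T ∘L S) '' Metric.closedBall 0 1) :=
    (hTS.isCompact_closure_image_closedBall 1).totallyBounded.subset subset_closure
  refine TotallyBounded.isCompact_of_isClosed (TotallyBounded.closure ?_) isClosed_closure
  rw [Metric.totallyBounded_iff]
  intro ε hε
  obtain ⟨t, ht, htf, htc⟩ := totallyBounded_iff_subset.1 htb _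
    (Metric.dist_mem_uniformity (half_pos (pow_pos hε 2)))
  have ht' : ∀ y ∈ t, ∃ x, x ∈ Metric.closedBall (0 : E) 1 ∧ T (S x) = y := fun y hy => ht hy
  choose! p hp1 hp2 using ht'
  refine ⟨S '' (p '' t), (htf.image p).image S, ?_⟩
  rintro _ ⟨x, hx, rfl⟩
  obtain ⟨y, hy, hxy⟩ := Set.mem_iUnion₂.1 (htc ⟨x, hx, rfl⟩)
  refine Set.mem_iUnion₂.2 ⟨S (p y), ⟨p y, ⟨y, hy, rfl⟩, rfl⟩, ?_⟩
  have h1 : ‖T (S (x - p y))‖ < ε ^ 2 / 2 := by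
    have h2 : T (S (p y)) = y := hp2 y hy
    rw [map_sub, map_sub, h2, ← dist_eq_norm]
    exact hxy
  have h3 : ‖x - p y‖ ≤ 2 := by
    refine (norm_sub_le _ _).trans ?_
    have e1 : ‖x‖ ≤ 1 := by simpa using hx
    have e2 : ‖p y‖ ≤ 1 := by simpa using hp1 y hy
    linarith
  have h4 : ‖S (x - p y)‖ ^ 2 < ε ^ 2 := by
    have h5 : ‖S (x - p y)‖ ^ 2 = (inner ℂ (x - p y) (T (S (x - p y))) : ℂ).re := by
      rw [← ContinuousLinearMap.adjoint_inner_left, ← hS]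
      exact norm_sq_eq_re_inner (𝕜 := ℂ) (S (x - p y))
    rw [h5]
    calc _ ≤ ‖(inner ℂ (x - p y) (T (S (x - p y))) : ℂ)‖ := Complex.re_le_norm _
      _ ≤ ‖x - p y‖ * ‖T (S (x - p y))‖ := norm_inner_le_norm _ _
      _ ≤ 2 * ‖T (S (x - p y))‖ := by gcongr
      _ < ε ^ 2 := by linarith
  rw [Metric.mem_ball, dist_eq_norm]
  have h6 : S x - S (p y) = S (x - p y) := (map_sub S x (p y)).symm
  exact lt_of_pow_lt_pow_left₀ 2 hε.le ((congrArg (fun v => ‖v‖ ^ 2) h6).trans_lt h4)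

end CompactAdjoint

/-! ### Existence of a positive eigenvector -/

section PerronFrobenius

open Filter Topology
open scoped ENNReal NNReal

variable {α : Type*} [MeasurableSpace α] {μ : Measure α}

/-- No set of positive measure with a non-null complement is invariant under `K`. -/
def IsIrreducibleOp (K : Lp ℂ 2 μ →L[ℂ] Lp ℂ 2 μ) : Prop :=
  ∀ f g : Lp ℂ 2 μ, Dominated f f → Dominated g g → inner ℂ f (K g) = 0 →
    (∀ᵐ x ∂μ, f x = 0 ↔ g x ≠ 0) → f = 0 ∨ g = 0

theorem IsIrreducibleOp.adjoint {K : Lp ℂ 2 μ →L[ℂ] Lp ℂ 2 μ} (hK : IsIrreducibleOp K) :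
    IsIrreducibleOp (ContinuousLinearMap.adjoint K) := by
  intro f g hf hg h1 h2
  refine (hK g f hg hf ?_ ?_).symm
  · rw [ContinuousLinearMap.adjoint_inner_right] at h1
    rw [← inner_conj_symm, h1, map_zero]
  · filter_upwards [h2] with x hx
    tauto

theorem memLp_top_add_const [IsFiniteMeasure μ] {G : α → ℝ}
    (hG : MemLp (fun x => (G x : ℂ)) ∞ μ) (z : ℂ) :
    MemLp (fun x => (G x : ℂ) + z) ∞ μ := hG.add (memLp_const z)

theorem mulOp_add_const [IsFiniteMeasure μ] {G : α → ℝ}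
    (hG : MemLp (fun x => (G x : ℂ)) ∞ μ) (z : ℂ) :
    mulOp _ (memLp_top_add_const hG z) = mulOp _ hG + z • 1 := by
  ext1 f
  refine Lp.ext ?_
  filter_upwards [mulOp_ae _ (memLp_top_add_const hG z) f, mulOp_ae _ hG f,
    Lp.coeFn_add (mulOp _ hG f) (z • f), Lp.coeFn_smul z f] with x h1 h2 h3 h4
  simp only [add_apply, smul_apply, one_apply_eq_self]
  rw [h1, h3, Pi.add_apply, h2, h4, Pi.smul_apply, smul_eq_mul, add_mul]

theorem Dominated.zero_left {g : Lp ℂ 2 μ} (h : Dominated g g) : Dominated 0 g := by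
  filter_upwards [h, Lp.coeFn_zero ℂ 2 μ] with x hx h0
  rw [h0]
  simpa using ⟨(norm_nonneg _).trans hx.1, hx.2⟩

theorem le_norm_ofReal_add (x : ℝ) (z : ℂ) : x + z.re ≤ ‖(x : ℂ) + z‖ := by
  simpa using Complex.re_le_norm ((x : ℂ) + z)

/-- The hypotheses of Perron–Frobenius theory for `K - G`. -/
structure PerronData [IsFiniteMeasure μ] (K : Lp ℂ 2 μ →L[ℂ] Lp ℂ 2 μ) (G : α → ℝ)
    (γ s : ℝ) : Prop where
  compact : IsCompactOperator K
  pos : IsPositiveOp K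
  irred : IsIrreducibleOp K
  memLp : MemLp (fun x => (G x : ℂ)) ∞ μ
  le : ∀ᵐ x ∂μ, γ ≤ G x
  isGreatest : IsGreatest (Complex.re '' spectrum ℂ (K - mulOp _ memLp)) s
  lt : -γ < s

namespace PerronData

variable [IsFiniteMeasure μ] {K : Lp ℂ 2 μ →L[ℂ] Lp ℂ 2 μ}
  {G : α → ℝ} {γ s : ℝ}

theorem sub_smul_one_eq (h : PerronData K G γ s) (z : ℂ) :
    (K - mulOp _ h.memLp) - z • 1 = K - mulOp _ (memLp_top_add_const h.memLp z) := by
  rw [mulOp_add_const h.memLp]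
  abel

/-- To the right of -γ one has |G + z| ≥ γ + Re z > 0, so the Fredholm alternative applies. The
compact operator C is left free because it is needed both for K and for a rank-one modification of
K. -/
theorem isUnit_of_injective (h : PerronData K G γ s) {C : Lp ℂ 2 μ →L[ℂ] Lp ℂ 2 μ}
    (hC : IsCompactOperator C) {z : ℂ} (hz : -γ < z.re)
    (hinj : ∀ f, C f = mulOp _ (memLp_top_add_const h.memLp z) f → f = 0) :
    IsUnit (C - mulOp _ (memLp_top_add_const h.memLp z)) := by
  refine isUnit_compact_sub_mulOp hC _ (δ := γ + z.re) (by linarith) ?_ hinj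
  filter_upwards [h.le] with x hx
  exact (le_norm_ofReal_add _ _).trans' (by linarith)

theorem exists_eigenvector (h : PerronData K G γ s) {z : ℂ}
    (hz : z ∈ spectrum ℂ (K - mulOp _ h.memLp)) (hre : -γ < z.re) :
    ∃ f, f ≠ 0 ∧ K f = mulOp _ (memLp_top_add_const h.memLp z) f := by
  by_contra! hcon
  refine hz ?_
  have := h.isUnit_of_injective h.compact hre fun f hf => by
    by_contra h0
    exact hcon f h0 hf
  rw [← h.sub_smul_one_eq] at this
  rw [spectrum.mem_resolventSet_iff, Algebra.algebraMap_eq_smul_one]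
  simpa using this.neg

theorem eigen_iff (h : PerronData K G γ s) (z : ℂ) (f : Lp ℂ 2 μ) :
    (K - mulOp _ h.memLp) f = z • f ↔ K f = mulOp _ (memLp_top_add_const h.memLp z) f := by
  rw [mulOp_add_const]
  simp only [sub_apply, add_apply, smul_apply, one_apply_eq_self]
  rw [sub_eq_iff_eq_add, add_comm]

theorem eigen_ae (h : PerronData K G γ s) {z : ℂ} {f : Lp ℂ 2 μ}
    (hf : (K - mulOp _ h.memLp) f = z • f) : ∀ᵐ x ∂μ, K f x = (G x + z) * f x := by
  rw [h.eigen_iff] at hf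
  rw [hf]
  exact mulOp_ae _ _ _

theorem abs_ae (h : PerronData K G γ s) {z : ℂ} {f : Lp ℂ 2 μ}
    (hf : (K - mulOp _ h.memLp) f = z • f) :
    ∀ᵐ x ∂μ, ‖(G x : ℂ) + z‖ * ‖f x‖ ≤ (K (absL2 f) x).re ∧ (K (absL2 f) x).im = 0 := by
  filter_upwards [h.eigen_ae hf, h.pos _ _ (dominated_absL2 f)] with x h1 h2
  rw [h1, norm_mul] at h2
  exact h2

theorem sub_smul_ae (h : PerronData K G γ s) (r : ℝ) (f : Lp ℂ 2 μ) :
    ∀ᵐ x ∂μ, ((K - mulOp _ h.memLp) f - (r : ℂ) • f) x = K f x - (G x + r) * f x := by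
  have e : (K - mulOp _ h.memLp) f - (r : ℂ) • f =
      K f - mulOp _ (memLp_top_add_const h.memLp r) f :=
    DFunLike.congr_fun (h.sub_smul_one_eq r) f
  rw [e]
  filter_upwards [Lp.coeFn_sub (K f) (mulOp _ (memLp_top_add_const h.memLp r) f),
    mulOp_ae _ (memLp_top_add_const h.memLp r) f] with x h1 h2
  rw [h1, Pi.sub_apply, h2]

/-- Positivity gives K|f| ≥ |Kf| = |G + z| |f|, and |G + z| ≥ Re(G + z) = G + s. Hence (A - s)|f| ≥
0: the modulus of an eigenvector is a subsolution. -/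
theorem dominated_sub (h : PerronData K G γ s) {z : ℂ} (hz : z.re = s) {f : Lp ℂ 2 μ}
    (hf : (K - mulOp _ h.memLp) f = z • f) :
    Dominated ((K - mulOp _ h.memLp) (absL2 f) - (s : ℂ) • absL2 f)
      ((K - mulOp _ h.memLp) (absL2 f) - (s : ℂ) • absL2 f) := by
  refine dominated_self_of_eq (fun x => (K (absL2 f) x).re - (G x + s) * ‖f x‖) ?_ ?_
  · filter_upwards [h.abs_ae hf] with x hx
    have := mul_le_mul_of_nonneg_right (le_norm_ofReal_add (G x) z) (norm_nonneg (f x))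
    rw [hz] at this
    linarith [hx.1]
  · filter_upwards [h.abs_ae hf, h.sub_smul_ae s (absL2 f), absL2_ae f] with x h1 h2 h3
    rw [h2, h3]
    apply Complex.ext <;> simp [h1.2]

/-- K - G + c is the sum of K and multiplication by c - G, which is nonnegative once c ≥ ‖G‖_∞. -/
theorem isPositiveOp_add (h : PerronData K G γ s) :
    ∃ c₀ : ℝ, ∀ c : ℝ, c₀ ≤ c → IsPositiveOp (K - mulOp _ h.memLp + (c : ℂ) • 1) := by
  refine ⟨(eLpNorm (fun x => (G x : ℂ)) ∞ μ).toReal, fun c hc => ?_⟩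
  have hGb : ∀ᵐ x ∂μ, |G x| ≤ (eLpNorm (fun x => (G x : ℂ)) ∞ μ).toReal := by
    have h1 := ae_le_eLpNormEssSup (f := fun x => (G x : ℂ)) (μ := μ)
    filter_upwards [h1] with x hx
    rw [← eLpNorm_exponent_top, ← ofReal_norm, Complex.norm_real] at hx
    exact (ENNReal.ofReal_le_iff_le_toReal h.memLp.2.ne).1 hx
  have hmem : MemLp (fun x => ((c - G x : ℝ) : ℂ)) ∞ μ := by
    have := (memLp_const (c : ℂ)).sub h.memLp
    exact (memLp_congr_ae (Eventually.of_forall fun x => by simp)).1 this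
  have e : K - mulOp _ h.memLp + (c : ℂ) • 1 = K + mulOp _ hmem := by
    rw [sub_add]
    rw [sub_eq_add_neg]
    congr 1
    ext1 f
    refine Lp.ext ?_
    have e2 : (-(mulOp _ h.memLp - (c : ℂ) • 1)) f = (c : ℂ) • f - mulOp _ h.memLp f := by
      simp only [neg_sub, sub_apply, smul_apply, one_apply_eq_self]
    rw [e2]
    filter_upwards [mulOp_ae _ hmem f, mulOp_ae _ h.memLp f,
      Lp.coeFn_sub ((c : ℂ) • f) (mulOp _ h.memLp f), Lp.coeFn_smul (c : ℂ) f] with x h1 h2 h3 h4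
    rw [h1, h3, Pi.sub_apply, h2, h4, Pi.smul_apply, smul_eq_mul]
    push_cast
    ring
  rw [e]
  refine h.pos.add (isPositiveOp_mulOp _ hmem ?_)
  filter_upwards [hGb] with x hx
  linarith [le_abs_self (G x)]

/-- On {v = 0} the eigenvalue equation gives Kv = (G + s)v = 0, so the indicator of that set is
orthogonal to Kv. Irreducibility then makes the indicator vanish, since v ≠ 0. -/
theorem pos_of_nonneg (h : PerronData K G γ s) {v : Lp ℂ 2 μ} (hv0 : v ≠ 0)
    (hv : Dominated v v) (hvs : (K - mulOp _ h.memLp) v = (s : ℂ) • v) :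
    ∀ᵐ x ∂μ, 0 < (v x).re ∧ (v x).im = 0 := by
  have hZ : MeasurableSet {x | v x = 0} :=
    (Lp.stronglyMeasurable v).measurable (measurableSet_singleton 0)
  set f : Lp ℂ 2 μ := indicatorConstLp 2 hZ (measure_ne_top μ _) (1 : ℂ)
  have hf : ∀ᵐ x ∂μ, f x = {x | v x = 0}.indicator (fun _ => (1 : ℂ)) x := indicatorConstLp_coeFn
  have h0 : f = 0 := by
    refine (h.irred f v ?_ hv ?_ ?_).resolve_right hv0
    · refine dominated_self_of_eq ({x | v x = 0}.indicator fun _ => 1) ?_ ?_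
      · exact Eventually.of_forall fun x => Set.indicator_nonneg (fun _ _ => zero_le_one) x
      · filter_upwards [hf] with x hx
        rw [hx]
        by_cases hx0 : x ∈ {x | v x = 0} <;> simp [hx0]
    · rw [inner_L2_eq]
      rw [← integral_zero α ℂ (μ := μ)]
      refine integral_congr_ae ?_
      filter_upwards [hf, h.eigen_ae hvs] with x h1 h2
      rw [h1, h2]
      by_cases hx0 : v x = 0 <;> simp [hx0]
    · filter_upwards [hf] with x h1
      rw [h1]
      by_cases hx0 : v x = 0 <;> simp [hx0]
  filter_upwards [hf, hv, Lp.coeFn_zero ℂ 2 μ] with x h1 h2 h3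
  refine ⟨?_, h2.2⟩
  rw [h0, h3] at h1
  have hx0 : v x ≠ 0 := by
    intro hx
    simp [hx] at h1
  exact (norm_pos_iff.2 hx0).trans_le h2.1

theorem adjoint_sub (h : PerronData K G γ s) : ContinuousLinearMap.adjoint K - mulOp _ h.memLp =
    ContinuousLinearMap.adjoint (K - mulOp _ h.memLp) := by
  rw [map_sub, adjoint_mulOp_real]

theorem adjoint (h : PerronData K G γ s) :
    PerronData (ContinuousLinearMap.adjoint K) G γ s where
  compact := isCompactOperator_adjoint h.compact
  pos := h.pos.adjoint
  irred := h.irred.adjoint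
  memLp := h.memLp
  le := h.le
  lt := h.lt
  isGreatest := by
    rw [h.adjoint_sub, ← ContinuousLinearMap.star_eq_adjoint, spectrum.map_star]
    convert h.isGreatest using 1
    ext r
    constructor
    · rintro ⟨z, hz, rfl⟩
      exact ⟨star z, hz, by simp⟩
    · rintro ⟨z, hz, rfl⟩
      exact ⟨star z, by simpa using hz, by simp⟩

variable [Nontrivial (Lp ℂ 2 μ)]

/-- Let f be an eigenvector for a spectral value of real part s, let R be the positive resolvent at
m, and put w = (m - s)R|f|. Then w = |f| + R(A - s)|f| ≥ |f|, so ‖w‖ ≥ ‖f‖. Also (A - s)w = (m -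
s)(w - |f|), of norm at most 2(m - s)‖w‖. It remains to normalize w. -/
theorem exists_approx_eigenvector (h : PerronData K G γ s) {m : ℝ} (hm : s < m) :
    ∃ v, Dominated v v ∧ ‖v‖ = 1 ∧
      ‖(K - mulOp _ h.memLp) v - (s : ℂ) • v‖ ≤ 2 * (m - s) := by
  obtain ⟨z, hz, hzs⟩ := h.isGreatest.1
  obtain ⟨f, hf0, hf⟩ := h.exists_eigenvector hz (hzs.symm ▸ h.lt)
  rw [← h.eigen_iff] at hf
  obtain ⟨c₀, hc₀⟩ := h.isPositiveOp_add
  obtain ⟨R, hR, hR1, hR2⟩ := exists_isPositiveOp_resolvent hc₀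
    (fun z hz => h.isGreatest.2 ⟨z, hz, rfl⟩) hm
  have hd := h.dominated_sub hzs hf
  set A := K - mulOp _ h.memLp
  set d := A (absL2 f) - (s : ℂ) • absL2 f with hdef
  have hms : 0 < m - s := sub_pos.2 hm
  set w : Lp ℂ 2 μ := ((m - s : ℝ) : ℂ) • R (absL2 f) with hw
  have e1 : w = absL2 f + R d := by
    have h1 := DFunLike.congr_fun hR1 (absL2 f)
    simp only [mul_apply_eq_comp, sub_apply, smul_apply,
      one_apply_eq_self] at h1
    have h2 : (m : ℂ) • absL2 f - A (absL2 f) = ((m - s : ℝ) : ℂ) • absL2 f - d := by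
      rw [hdef, Complex.ofReal_sub, sub_smul]; abel
    rw [h2, map_sub, map_smul] at h1
    rw [hw]
    exact sub_eq_iff_eq_add.1 h1
  have e2 : A w - (s : ℂ) • w = ((m - s : ℝ) : ℂ) • w - ((m - s : ℝ) : ℂ) • absL2 f := by
    have h1 := DFunLike.congr_fun hR2 (absL2 f)
    simp only [mul_apply_eq_comp, sub_apply, smul_apply,
      one_apply_eq_self] at h1
    have h2 : A w = (m : ℂ) • w - ((m - s : ℝ) : ℂ) • absL2 f := by
      rw [← h1, hw, map_smul, smul_sub, smul_comm]; abel
    rw [h2, Complex.ofReal_sub, sub_smul, sub_smul]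
    abel
  have hRd : Dominated (R d) (R d) := hR _ _ hd
  have hfw : Dominated (absL2 f) w := by
    have := (dominated_absL2 f).nonneg.add hRd.zero_left
    rwa [add_zero, ← e1] at this
  have hnw : ‖f‖ ≤ ‖w‖ := by rw [← norm_absL2]; exact hfw.norm_le
  have hf1 : 0 < ‖f‖ := norm_pos_iff.2 hf0
  have hw1 : 0 < ‖w‖ := hf1.trans_le hnw
  have hinv : ‖((‖w‖⁻¹ : ℝ) : ℂ)‖ = ‖w‖⁻¹ := by simp
  refine ⟨((‖w‖⁻¹ : ℝ) : ℂ) • w, hfw.nonneg.smul (inv_pos.2 hw1).le, ?_, ?_⟩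
  · rw [norm_smul, hinv, inv_mul_cancel₀ hw1.ne']
  · rw [map_smul, smul_comm, ← smul_sub, e2, ← smul_sub, norm_smul _ (_ • _),
      hinv, norm_smul _ (w - _), Complex.norm_real, Real.norm_eq_abs, abs_of_pos hms]
    have h3 : ‖w - absL2 f‖ ≤ 2 * ‖w‖ := by
      refine (norm_sub_le _ _).trans ?_
      rw [norm_absL2]; linarith
    calc ‖w‖⁻¹ * ((m - s) * ‖w - absL2 f‖) ≤ ‖w‖⁻¹ * ((m - s) * (2 * ‖w‖)) := by gcongr
      _ = 2 * (m - s) := by field_simp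

/-- Let m decrease to s. The unit vectors v_n satisfy v_n = (G + s)⁻¹(K v_n - residual), where the
residual tends to 0 and K v_n converges along a subsequence. So v_n itself converges in norm, which
keeps the limit nonzero and nonnegative. -/
theorem exists_nonneg_eigenvector (h : PerronData K G γ s) :
    ∃ v, v ≠ 0 ∧ Dominated v v ∧ (K - mulOp _ h.memLp) v = (s : ℂ) • v := by
  have hm : ∀ n : ℕ, s < s + 1 / ((n : ℝ) + 1) := fun n => by
    have : (0 : ℝ) < 1 / ((n : ℝ) + 1) := by positivity
    linarith
  choose v hv1 hv2 hv3 using fun n : ℕ => h.exists_approx_eigenvector (hm n)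
  set g : α → ℂ := fun x => (G x : ℂ) + (s : ℂ)
  have hg := memLp_top_add_const h.memLp (s : ℂ)
  have hsmall : Tendsto (fun n => (K - mulOp _ h.memLp) (v n) - (s : ℂ) • v n) atTop (𝓝 0) := by
    refine squeeze_zero_norm hv3 ?_
    have := (tendsto_one_div_add_atTop_nhds_zero_nat (𝕜 := ℝ)).const_mul 2
    simpa using this
  obtain ⟨S, hS, hSK⟩ := h.compact.image_closedBall_subset_compact 1
  obtain ⟨y, -, φ, hφ, hy⟩ := hS.tendsto_subseq (x := fun n => K (v n))
    (fun n => hSK ⟨v n, by simp [hv2 n], rfl⟩)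
  have hge : ∀ᵐ x ∂μ, γ + s ≤ ‖(G x : ℂ) + (s : ℂ)‖ := by
    filter_upwards [h.le] with x hx
    have := le_norm_ofReal_add (G x) (s : ℂ)
    rw [Complex.ofReal_re] at this
    linarith
  have hδ : 0 < γ + s := by linarith [h.lt]
  have hg' : MemLp (fun x => ((G x : ℂ) + (s : ℂ))⁻¹) ∞ μ := by
    refine memLp_top_of_bound hg.1.aemeasurable.inv.aestronglyMeasurable (γ + s)⁻¹ ?_
    filter_upwards [hge] with x hx
    rw [norm_inv]
    exact inv_anti₀ hδ hx
  have e2 : mulOp _ hg' * mulOp _ hg = 1 := by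
    refine mulOp_mul_mulOp_eq_one hg' hg ?_
    filter_upwards [hge] with x hx
    exact inv_mul_cancel₀ (norm_pos_iff.1 (hδ.trans_le hx))
  have e3 : ∀ n, v n = mulOp _ hg' (K (v n) - ((K - mulOp _ h.memLp) (v n) - (s : ℂ) • v n)) := by
    intro n
    have e4 : (K - mulOp _ h.memLp) (v n) - (s : ℂ) • v n = K (v n) - mulOp _ hg (v n) :=
      DFunLike.congr_fun (h.sub_smul_one_eq s) (v n)
    rw [e4, sub_sub_cancel]
    exact (DFunLike.congr_fun e2 (v n)).symm
  set v₀ := mulOp _ hg' y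
  have hlim : Tendsto (fun n => v (φ n)) atTop (𝓝 v₀) := by
    have h1 := hy.sub (hsmall.comp hφ.tendsto_atTop)
    rw [sub_zero] at h1
    have h2 := ((mulOp _ hg').continuous.tendsto y).comp h1
    refine h2.congr fun n => ?_
    exact (e3 (φ n)).symm
  refine ⟨v₀, ?_, dominated_of_tendsto hlim hlim (Eventually.of_forall fun n => hv1 _), ?_⟩
  · have : ‖v₀‖ = 1 := tendsto_nhds_unique hlim.norm (by simp [hv2])
    intro h0
    simp [h0] at this
  · rw [← sub_eq_zero]
    refine tendsto_nhds_unique ?_ (hsmall.comp hφ.tendsto_atTop)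
    exact (((K - mulOp _ h.memLp).continuous.tendsto _).comp hlim).sub (hlim.const_smul _)

theorem exists_pos_eigenvector (h : PerronData K G γ s) :
    ∃ v, (∀ᵐ x ∂μ, 0 < (v x).re ∧ (v x).im = 0) ∧ (K - mulOp _ h.memLp) v = (s : ℂ) • v := by
  obtain ⟨v, h0, h1, h2⟩ := h.exists_nonneg_eigenvector
  exact ⟨v, h.pos_of_nonneg h0 h1 h2, h2⟩

end PerronData

end PerronFrobenius

/-! ### Real parts and pairings with strictly positive functions -/

section RealPart

variable {α : Type*} [MeasurableSpace α] {μ : Measure α}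

/-- The real part of an element of `L²`, as an element of the complex `L²`. -/
noncomputable def reL2 (f : Lp ℂ 2 μ) : Lp ℂ 2 μ :=
  (Lp.memLp f).re.ofReal.toLp (fun x => (((f x).re : ℝ) : ℂ))

theorem reL2_ae (f : Lp ℂ 2 μ) : ∀ᵐ x ∂μ, reL2 f x = ((f x).re : ℂ) := MemLp.coeFn_toLp _

theorem reL2_add_I_smul (f : Lp ℂ 2 μ) :
    f = reL2 f + Complex.I • reL2 (-(Complex.I • f)) := by
  refine Lp.ext ?_
  filter_upwards [reL2_ae f, reL2_ae (-(Complex.I • f)), Lp.coeFn_smul Complex.I f,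
    Lp.coeFn_neg (Complex.I • f), Lp.coeFn_add (reL2 f) (Complex.I • reL2 (-(Complex.I • f))),
    Lp.coeFn_smul Complex.I (reL2 (-(Complex.I • f)))] with x h1 h2 h3 h4 h5 h6
  rw [h5, Pi.add_apply, h6, Pi.smul_apply, h1, h2, h4, Pi.neg_apply, h3, Pi.smul_apply]
  apply Complex.ext <;> simp

/-- For real f, both f + |f| and |f| are nonnegative, so Tf = T(f + |f|) - T|f| is a difference of
real functions. -/
theorem IsPositiveOp.im_eq_zero {T : Lp ℂ 2 μ →L[ℂ] Lp ℂ 2 μ} (hT : IsPositiveOp T)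
    {f : Lp ℂ 2 μ} (hf : ∀ᵐ x ∂μ, (f x).im = 0) : ∀ᵐ x ∂μ, (T f x).im = 0 := by
  have h1 : Dominated (f + absL2 f) (f + absL2 f) := by
    refine dominated_self_of_eq (fun x => (f x).re + ‖f x‖) ?_ ?_
    · refine Filter.Eventually.of_forall fun x => ?_
      linarith [neg_abs_le (f x).re, Complex.abs_re_le_norm (f x)]
    · filter_upwards [hf, absL2_ae f, Lp.coeFn_add f (absL2 f)] with x a b c
      rw [c, Pi.add_apply, b]
      apply Complex.ext <;> simp [a]
  have h2 := hT _ _ h1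
  rw [map_add] at h2
  filter_upwards [h2, hT _ _ (dominated_absL2 f), Lp.coeFn_add (T f) (T (absL2 f))] with x a b c
  rw [c, Pi.add_apply, Complex.add_im, b.2, add_zero] at a
  exact a.2

theorem IsPositiveOp.map_reL2 {T : Lp ℂ 2 μ →L[ℂ] Lp ℂ 2 μ} (hT : IsPositiveOp T)
    (f : Lp ℂ 2 μ) : T (reL2 f) = reL2 (T f) := by
  have him : ∀ g : Lp ℂ 2 μ, ∀ᵐ x ∂μ, (reL2 g x).im = 0 := fun g => by
    filter_upwards [reL2_ae g] with x hx
    simp [hx]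
  have h := congrArg T (reL2_add_I_smul f)
  rw [map_add, map_smul] at h
  refine Lp.ext ?_
  filter_upwards [hT.im_eq_zero (him f), hT.im_eq_zero (him (-(Complex.I • f))), reL2_ae (T f),
    Lp.coeFn_add (T (reL2 f)) (Complex.I • T (reL2 (-(Complex.I • f)))),
    Lp.coeFn_smul Complex.I (T (reL2 (-(Complex.I • f))))] with x h1 h2 h3 h4 h5
  rw [h3, h, h4, Pi.add_apply, h5, Pi.smul_apply]
  apply Complex.ext <;> simp [h1, h2]

/-- A nonnegative integrand ψd of zero integral vanishes almost everywhere, and ψ > 0 can be divided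
out. This is how the left eigenvector turns inequalities between functions into equalities. -/
theorem eq_zero_of_inner_eq_zero {ψ d : Lp ℂ 2 μ} (hψ : ∀ᵐ x ∂μ, 0 < (ψ x).re ∧ (ψ x).im = 0)
    (hd : Dominated d d) (h : inner ℂ ψ d = 0) : d = 0 := by
  have e : inner ℂ ψ d = ((∫ x, (ψ x).re * (d x).re ∂μ : ℝ) : ℂ) := by
    rw [inner_L2_eq, ← integral_complex_ofReal]
    refine integral_congr_ae ?_
    filter_upwards [hψ, hd] with x h1 h2
    apply Complex.ext <;> simp [h1.2, h2.2]
  have hint : Integrable (fun x => (ψ x).re * (d x).re) μ := by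
    refine (integrable_conj_mul ψ d).re.congr ?_
    filter_upwards [hψ, hd] with x h1 h2
    simp [h1.2, h2.2]
  rw [e, Complex.ofReal_eq_zero, integral_eq_zero_iff_of_nonneg_ae ?_ hint] at h
  · refine Lp.ext ?_
    filter_upwards [h, hψ, hd, Lp.coeFn_zero ℂ 2 μ] with x h1 h2 h3 h4
    rw [h4]
    have h5 : (d x).re = 0 := (mul_eq_zero.1 h1).resolve_left h2.1.ne'
    have := h3.1
    rw [h5] at this
    exact norm_le_zero_iff.1 this
  · filter_upwards [hψ, hd] with x h1 h2
    exact mul_nonneg h1.1.le ((norm_nonneg _).trans h2.1)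

theorem inner_pos_of_pos [NeZero μ] {ψ v : Lp ℂ 2 μ} (hψ : ∀ᵐ x ∂μ, 0 < (ψ x).re ∧ (ψ x).im = 0)
    (hv : ∀ᵐ x ∂μ, 0 < (v x).re ∧ (v x).im = 0) :
    ∃ r : ℝ, 0 < r ∧ inner ℂ ψ v = (r : ℂ) := by
  have hd : ∀ u : Lp ℂ 2 μ, (∀ᵐ x ∂μ, 0 < (u x).re ∧ (u x).im = 0) → Dominated u u := by
    intro u hu
    refine dominated_self_of_eq (fun x => (u x).re) (hu.mono fun x hx => hx.1.le) ?_
    filter_upwards [hu] with x hx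
    apply Complex.ext <;> simp [hx.2]
  have h1 := (hd v hv).inner_le (hd ψ hψ)
  have h2 : (inner ℂ ψ v : ℂ) = (((inner ℂ ψ v : ℂ).re : ℝ) : ℂ) := by
    apply Complex.ext <;> simp [h1.2]
  refine ⟨_, lt_of_le_of_ne ((norm_nonneg _).trans h1.1) fun h0 => ?_, h2⟩
  rw [← h0, Complex.ofReal_zero] at h2
  have h3 := eq_zero_of_inner_eq_zero hψ (hd v hv) h2
  obtain ⟨x, hx1, hx2⟩ := (hv.and (Lp.coeFn_zero ℂ 2 μ)).exists
  rw [h3, hx2] at hx1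
  simp at hx1

end RealPart

/-! ### Simplicity and dominance of the principal eigenvalue -/

section PerronPair

variable {α : Type*} [MeasurableSpace α] {μ : Measure α}

/-- Positive right and left eigenvectors for a simple eigenvalue. -/
structure PerronPair (A : Lp ℂ 2 μ →L[ℂ] Lp ℂ 2 μ) (s : ℝ) (v ψ : Lp ℂ 2 μ) : Prop where
  pos : ∀ᵐ x ∂μ, 0 < (v x).re ∧ (v x).im = 0
  pos' : ∀ᵐ x ∂μ, 0 < (ψ x).re ∧ (ψ x).im = 0
  eigen : A v = (s : ℂ) • v
  eigen' : ContinuousLinearMap.adjoint A ψ = (s : ℂ) • ψ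
  inner_eq_one : inner ℂ ψ v = 1
  simple : ∀ w, A w = (s : ℂ) • w → inner ℂ ψ w = 0 → w = 0

theorem inner_sub_smul_eq_zero {s : ℝ} {A : Lp ℂ 2 μ →L[ℂ] Lp ℂ 2 μ} {ψ : Lp ℂ 2 μ}
    (hψs : ContinuousLinearMap.adjoint A ψ = (s : ℂ) • ψ) (u : Lp ℂ 2 μ) :
    inner ℂ ψ (A u - (s : ℂ) • u) = 0 := by
  rw [inner_sub_right, ← ContinuousLinearMap.adjoint_inner_left, hψs, inner_smul_left,
    inner_smul_right, Complex.conj_ofReal, sub_self]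

namespace PerronData

variable [IsFiniteMeasure μ] {K : Lp ℂ 2 μ →L[ℂ] Lp ℂ 2 μ} {G : α → ℝ} {γ s : ℝ}

/-- (A - s)|f| is nonnegative, and it is orthogonal to ψ because ψ annihilates the range of A - s;
hence it is zero. -/
theorem abs_eigen (h : PerronData K G γ s) {ψ : Lp ℂ 2 μ}
    (hψ : ∀ᵐ x ∂μ, 0 < (ψ x).re ∧ (ψ x).im = 0)
    (hψs : ContinuousLinearMap.adjoint (K - mulOp _ h.memLp) ψ = (s : ℂ) • ψ)
    {z : ℂ} (hz : z.re = s) {f : Lp ℂ 2 μ} (hf : (K - mulOp _ h.memLp) f = z • f) :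
    (K - mulOp _ h.memLp) (absL2 f) = (s : ℂ) • absL2 f := by
  rw [← sub_eq_zero]
  exact eq_zero_of_inner_eq_zero hψ (h.dominated_sub hz hf) (inner_sub_smul_eq_zero hψs _)

/-- With |f| an eigenvector for s, |G + z| |f| ≤ K|f| = (G + s)|f|. At a point where f ≠ 0 this
reads |G + z| ≤ Re(G + z), which forces Im z = 0. -/
theorem eq_of_re_eq (h : PerronData K G γ s) {ψ : Lp ℂ 2 μ}
    (hψ : ∀ᵐ x ∂μ, 0 < (ψ x).re ∧ (ψ x).im = 0)
    (hψs : ContinuousLinearMap.adjoint (K - mulOp _ h.memLp) ψ = (s : ℂ) • ψ)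
    {z : ℂ} (hz : z ∈ spectrum ℂ (K - mulOp _ h.memLp)) (hzs : z.re = s) : z = s := by
  obtain ⟨f, hf0, hf⟩ := h.exists_eigenvector hz (hzs.symm ▸ h.lt)
  rw [← h.eigen_iff] at hf
  have h1 := h.eigen_ae (h.abs_eigen hψ hψs hzs hf)
  by_contra hne
  apply hf0
  refine Lp.ext ?_
  filter_upwards [h1, h.abs_ae hf, absL2_ae f, Lp.coeFn_zero ℂ 2 μ] with x a b c e
  rw [e]
  by_contra hfx
  have hn : 0 < ‖f x‖ := norm_pos_iff.2 hfx
  rw [a, c] at b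
  have b1 : ‖(G x : ℂ) + z‖ * ‖f x‖ ≤ (G x + s) * ‖f x‖ := by simpa using b.1
  have b2 := le_of_mul_le_mul_right b1 hn
  have b3 := Complex.re_le_norm ((G x : ℂ) + z)
  have b4 : ‖(G x : ℂ) + z‖ ^ 2 ≤ (G x + s) ^ 2 := pow_le_pow_left₀ (norm_nonneg _) b2 2
  rw [Complex.sq_norm, Complex.normSq_apply] at b4
  simp only [Complex.add_re, Complex.ofReal_re, Complex.add_im, Complex.ofReal_im, hzs,
    zero_add] at b4
  have b5 : z.im = 0 := by
    have : z.im * z.im ≤ 0 := by nlinarith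
    exact mul_self_eq_zero.1 (le_antisymm this (mul_self_nonneg _))
  exact hne (Complex.ext (by simpa using hzs) (by simpa using b5))

theorem map_reL2 (h : PerronData K G γ s) {w : Lp ℂ 2 μ}
    (hw : (K - mulOp _ h.memLp) w = (s : ℂ) • w) :
    (K - mulOp _ h.memLp) (reL2 w) = (s : ℂ) • reL2 w := by
  have h1 := h.eigen_ae hw
  rw [h.eigen_iff, h.pos.map_reL2]
  refine Lp.ext ?_
  filter_upwards [reL2_ae (K w), reL2_ae w, mulOp_ae _ (memLp_top_add_const h.memLp s) (reL2 w),
    h1] with x a b c e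
  rw [a, c, b, e]
  apply Complex.ext <;> simp

/-- The real part r is again an eigenvector with ⟨ψ, r⟩ = 0, and so is |r|, without the
orthogonality. The nonnegative eigenvector |r| - r is either zero or positive almost everywhere, so
r has constant sign, and a function of constant sign orthogonal to ψ > 0 vanishes. -/
theorem reL2_eq_zero [NeZero μ] (h : PerronData K G γ s) {ψ : Lp ℂ 2 μ}
    (hψ : ∀ᵐ x ∂μ, 0 < (ψ x).re ∧ (ψ x).im = 0)
    (hψs : ContinuousLinearMap.adjoint (K - mulOp _ h.memLp) ψ = (s : ℂ) • ψ)
    {w : Lp ℂ 2 μ} (hw : (K - mulOp _ h.memLp) w = (s : ℂ) • w) (h0 : inner ℂ ψ w = 0) :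
    reL2 w = 0 := by
  set r := reL2 w with hr
  have hre : (inner ℂ ψ r : ℂ).re = 0 := by
    have e1 : (inner ℂ ψ w : ℂ).re = ∫ x, ((starRingEnd ℂ) (ψ x) * w x).re ∂μ := by
      rw [inner_L2_eq]
      exact (integral_re (𝕜 := ℂ) (integrable_conj_mul ψ w)).symm
    have e2 : (inner ℂ ψ r : ℂ).re = ∫ x, ((starRingEnd ℂ) (ψ x) * r x).re ∂μ := by
      rw [inner_L2_eq]
      exact (integral_re (𝕜 := ℂ) (integrable_conj_mul ψ r)).symm
    rw [h0] at e1
    rw [e2]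
    refine Eq.trans (integral_congr_ae ?_) e1.symm
    filter_upwards [hψ, reL2_ae w] with x a b
    rw [hr, b]
    simp [a.2]
  have hrs := h.map_reL2 hw
  have hs0 : (s : ℂ).re = s := Complex.ofReal_re s
  have habs := h.abs_eigen hψ hψs hs0 hrs
  have hdiff : (K - mulOp _ h.memLp) (absL2 r - r) = (s : ℂ) • (absL2 r - r) := by
    rw [map_sub, habs, hrs, smul_sub]
  have hdiffae : ∀ᵐ x ∂μ, (absL2 r - r) x = ((|(w x).re| - (w x).re : ℝ) : ℂ) := by
    filter_upwards [absL2_ae r, reL2_ae w, Lp.coeFn_sub (absL2 r) r] with x a b c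
    rw [c, Pi.sub_apply, a, hr, b]
    simp
  have hnn : Dominated (absL2 r - r) (absL2 r - r) :=
    dominated_self_of_eq _ (Filter.Eventually.of_forall fun x => sub_nonneg.2 (le_abs_self _))
      hdiffae
  have him : ∀ u : Lp ℂ 2 μ, Dominated u u → (inner ℂ ψ u : ℂ).re = 0 → u = 0 := by
    intro u hu hu0
    refine eq_zero_of_inner_eq_zero hψ hu ?_
    have hψd : Dominated ψ ψ := by
      refine dominated_self_of_eq (fun x => (ψ x).re) (hψ.mono fun x hx => hx.1.le) ?_
      filter_upwards [hψ] with x hx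
      apply Complex.ext <;> simp [hx.2]
    have := hu.inner_le hψd
    exact Complex.ext hu0 this.2
  by_cases hc : absL2 r - r = 0
  · have e : absL2 r = r := sub_eq_zero.1 hc
    refine him r ?_ hre
    have := dominated_absL2 r
    rwa [e] at this
  · have hp := h.pos_of_nonneg hc hnn hdiff
    have hneg : Dominated (-r) (-r) := by
      refine dominated_self_of_eq (fun x => |(w x).re|)
        (Filter.Eventually.of_forall fun x => abs_nonneg _) ?_
      filter_upwards [hp, hdiffae, reL2_ae w, Lp.coeFn_neg r] with x a b c e
      rw [b, Complex.ofReal_re] at a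
      rw [e, Pi.neg_apply, hr, c, ← Complex.ofReal_neg]
      have : (w x).re < 0 := by
        by_contra! hge
        rw [abs_of_nonneg hge] at a
        linarith [a.1]
      rw [abs_of_neg this]
    have := him (-r) hneg (by rw [inner_neg_right, Complex.neg_re, hre, neg_zero])
    exact neg_eq_zero.1 this

theorem exists_perronPair [NeZero μ] [Nontrivial (Lp ℂ 2 μ)] (h : PerronData K G γ s) :
    ∃ v ψ, PerronPair (K - mulOp _ h.memLp) s v ψ := by
  obtain ⟨v, hv, hvs⟩ := h.exists_pos_eigenvector
  obtain ⟨ψ, hψ, hψs⟩ := h.adjoint.exists_pos_eigenvector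
  rw [h.adjoint_sub] at hψs
  obtain ⟨r, hr, hrv⟩ := inner_pos_of_pos hψ hv
  refine ⟨((r⁻¹ : ℝ) : ℂ) • v, ψ, ?_, hψ, ?_, hψs, ?_, ?_⟩
  · filter_upwards [hv, Lp.coeFn_smul ((r⁻¹ : ℝ) : ℂ) v] with x a b
    rw [b, Pi.smul_apply, smul_eq_mul, Complex.re_ofReal_mul, Complex.im_ofReal_mul, a.2, mul_zero]
    exact ⟨mul_pos (inv_pos.2 hr) a.1, rfl⟩
  · rw [map_smul, hvs, smul_comm]
  · rw [inner_smul_right, hrv, ← Complex.ofReal_mul, inv_mul_cancel₀ hr.ne', Complex.ofReal_one]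
  -- The real part of -iw is the imaginary part of w, so the real case applied to w and to -iw gives
  -- w = 0.
  · intro w hw h0
    rw [reL2_add_I_smul w, h.reL2_eq_zero hψ hψs hw h0,
      h.reL2_eq_zero (w := -(Complex.I • w)) hψ hψs, smul_zero, add_zero]
    · rw [map_neg, map_smul, hw, smul_neg, smul_comm]
    · rw [inner_neg_right, inner_smul_right, h0, mul_zero, neg_zero]

end PerronData

end PerronPair

/-! ### Translations of the torus -/

section Torus

open Filter Topology
open scoped ENNReal NNReal Pointwise

variable {d : ℕ}

theorem toTorus_zero : toTorus (0 : Rd d) = 0 := by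
  funext i
  simp [toTorus]

theorem toTorus_add (x y : Rd d) : toTorus (x + y) = toTorus x + toTorus y := by
  funext i
  simp [toTorus]

theorem toTorus_single (i : Fin d) : toTorus (EuclideanSpace.single i (1 : ℝ)) = 0 := by
  funext j
  by_cases h : j = i
  · subst h
    simp [toTorus]
  · simp [toTorus, h]

theorem quasiMeasurePreserving_sub_right (η : Td d) :
    Measure.QuasiMeasurePreserving (fun ξ : Td d => ξ - η) volume volume :=
  (measurePreserving_sub_right volume η).quasiMeasurePreserving

/-- The points of `ℝ^d` along which `f` is translated into itself up to the additive constant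
`c`. -/
def translationGroup (f : Td d → ℝ) (c : Rd d →+ ℝ) : AddSubgroup (Rd d) where
  carrier := {z | ∀ᵐ ξ : Td d, f (ξ - toTorus z) = f ξ + c z}
  zero_mem' := by simp [toTorus_zero]
  add_mem' := by
    intro x y hx hy
    filter_upwards [hx, (quasiMeasurePreserving_sub_right (toTorus x)).ae hy] with ξ h1 h2
    rw [toTorus_add, ← sub_sub, h2, h1, map_add, add_assoc]
  neg_mem' := by
    intro x hx
    have e : toTorus (-x) = -toTorus x := by
      rw [← zero_sub, toTorus_sub, toTorus_zero, zero_sub]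
    filter_upwards [(quasiMeasurePreserving_sub_right (-toTorus x)).ae hx] with ξ h1
    rw [sub_neg_eq_add, add_sub_cancel_right] at h1
    rw [e, sub_neg_eq_add, map_neg]
    linarith

/-- Steinhaus: the admissible translations form a subgroup containing almost all of S, so its
difference set, and with it the subgroup, is a neighbourhood of 0. An open subgroup is closed, hence
everything by connectedness of ℝ^d. -/
theorem translationGroup_eq_top {f : Td d → ℝ} {c : Rd d →+ ℝ} {S : Set (Rd d)}
    (hS : MeasurableSet S) (hS0 : volume S ≠ 0)
    (h : ∀ᵐ z : Rd d, z ∈ S → ∀ᵐ ξ : Td d, f (ξ - toTorus z) = f ξ + c z) (z : Rd d) :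
    ∀ᵐ ξ : Td d, f (ξ - toTorus z) = f ξ + c z := by
  set H := translationGroup f c with hH
  -- The exceptional set is null but perhaps not measurable; removing a measurable null superset
  -- leaves a measurable subset of the group with positive measure.
  set N : Set (Rd d) := {z | ¬ (z ∈ S → z ∈ H)} with hN
  have hN0 : volume (toMeasurable volume N) = 0 := by
    rw [measure_toMeasurable]
    exact h
  set E := S \ toMeasurable volume N
  have hEH : E ⊆ H := by
    intro x hx
    by_contra hxH
    exact hx.2 (subset_toMeasurable _ _ fun hh => hxH (hh hx.1))
  have hE0 : 0 < volume E := by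
    rw [measure_sdiff_null hN0]
    exact pos_iff_ne_zero.2 hS0
  have hnhds := Measure.sub_mem_nhds_zero_of_addHaar_pos volume E
    (hS.diff (measurableSet_toMeasurable _ _)) hE0
  have hsub : E - E ⊆ H := by
    rintro _ ⟨x, hx, y, hy, rfl⟩
    exact H.sub_mem (hEH hx) (hEH hy)
  have hopen : IsOpen (H : Set (Rd d)) := H.isOpen_of_mem_nhds (mem_of_superset hnhds hsub)
  have huniv : (H : Set (Rd d)) = Set.univ :=
    IsClopen.eq_univ ⟨H.isClosed_of_isOpen hopen, hopen⟩ ⟨0, H.zero_mem⟩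
  exact (Set.eq_univ_iff_forall.1 huniv z : z ∈ (H : Set (Rd d)))

/-- Once the identity holds for every z, take z = e_i: this is the zero translation of the torus, so
f = f + α_i. -/
theorem coeff_eq_zero_of_translation {f : Td d → ℝ} {α : Rd d} {S : Set (Rd d)}
    (hS : MeasurableSet S) (hS0 : volume S ≠ 0)
    (h : ∀ᵐ z : Rd d, z ∈ S → ∀ᵐ ξ : Td d, f (ξ - toTorus z) = f ξ + inner ℝ α z) : α = 0 := by
  have hall := translationGroup_eq_top (c := (innerSL ℝ α).toLinearMap.toAddMonoidHom) hS hS0 h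
  ext i
  obtain ⟨ξ, hξ⟩ := (hall (EuclideanSpace.single i 1)).exists
  rw [toTorus_single, sub_zero] at hξ
  have : inner ℝ α (EuclideanSpace.single i (1 : ℝ)) = (0 : ℝ) := by
    simpa using hξ
  simpa [EuclideanSpace.inner_single_right] using this

/-- The half-open unit cell of `ℝ^d` with corner `b`. -/
def unitCell (b : Fin d → ℝ) : Set (Rd d) := {z | ∀ i, z i ∈ Set.Ioc (b i) (b i + 1)}

theorem measurePreserving_toTorus (b : Fin d → ℝ) :
    MeasurePreserving (toTorus (d := d)) (volume.restrict (unitCell b)) volume := by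
  have h1 := measurePreserving_pi (fun i => volume.restrict (Set.Ioc (b i) (b i + 1)))
    (fun _ : Fin d => (volume : Measure UnitAddCircle))
    (fun i => UnitAddCircle.measurePreserving_mk (b i))
  rw [← Measure.restrict_pi_pi] at h1
  have h2 := (PiLp.volume_preserving_ofLp (Fin d)).restrict_preimage
    (s := Set.univ.pi fun i => Set.Ioc (b i) (b i + 1))
    (MeasurableSet.univ_pi fun i => measurableSet_Ioc)
  have h3 : (WithLp.ofLp : Rd d → Fin d → ℝ) ⁻¹' (Set.univ.pi fun i => Set.Ioc (b i) (b i + 1)) =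
      unitCell b := by
    ext z
    simp [unitCell]
  rw [h3] at h2
  exact h1.comp h2

theorem lintegral_torus_eq {f : Td d → ℝ≥0∞} (hf : Measurable f) (b : Fin d → ℝ) :
    ∫⁻ ξ, f ξ = ∫⁻ z in unitCell b, f (toTorus z) :=
  ((measurePreserving_toTorus b).lintegral_comp hf).symm

theorem ae_of_ae_toTorus {P : Td d → Prop} (hP : MeasurableSet {ξ | P ξ})
    (h : ∀ᵐ z : Rd d, P (toTorus z)) : ∀ᵐ ξ : Td d, P ξ := by
  rw [← (measurePreserving_toTorus (0 : Fin d → ℝ)).map_eq,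
    ae_map_iff measurable_toTorus.aemeasurable hP]
  exact ae_restrict_of_ae h

instance isNegInvariant_volume : (volume : Measure (Td d)).IsNegInvariant :=
  Measure.IsAddHaarMeasure.isNegInvariant_of_regular _

/-- The ball is covered by finitely many unit cells, over each of which z ↦ f(ξ - z) integrates to
the full torus integral of f; N is the number of cells. -/
theorem exists_lintegral_ball_le (d : ℕ) (R : ℝ) : ∃ N : ℝ≥0, ∀ f : Td d → ℝ≥0∞,
    Measurable f → ∀ ξ : Td d,
    ∫⁻ z in Metric.ball (0 : Rd d) R, f (ξ - toTorus z) ≤ N * ∫⁻ η, f η := by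
  obtain ⟨n, hn⟩ := exists_nat_gt R
  -- Cells are open on the left and closed on the right, so z lies in the cell with corner ⌈z_i⌉ -
  -- 1; |z_i| < n keeps these corners in the range.
  set J : Finset (Fin d → ℤ) := Fintype.piFinset fun _ => Finset.Icc (-(n : ℤ) - 1) n
  refine ⟨J.card, fun f hf ξ => ?_⟩
  have hcover : Metric.ball (0 : Rd d) R ⊆ ⋃ j : J, unitCell fun i => ((j : Fin d → ℤ) i : ℝ) := by
    intro z hz
    rw [mem_ball_zero_iff] at hz
    have hzi : ∀ i, |z i| < n := fun i =>
      ((PiLp.norm_apply_le z i).trans_lt hz).trans hn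
    refine Set.mem_iUnion.2 ⟨⟨fun i => ⌈z i⌉ - 1, ?_⟩, fun i => ?_⟩
    · refine Fintype.mem_piFinset.2 fun i => Finset.mem_Icc.2 ?_
      have h1 := abs_lt.1 (hzi i)
      have h2 : ⌈z i⌉ ≤ n := Int.ceil_le.2 (by exact_mod_cast h1.2.le)
      have h3 : -(n : ℤ) < ⌈z i⌉ := Int.lt_ceil.2 (by push_cast; exact h1.1)
      omega
    · have h1 := Int.ceil_lt_add_one (z i)
      have h2 := Int.le_ceil (z i)
      simp only [Int.cast_sub, Int.cast_one, Set.mem_Ioc, sub_add_cancel]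
      exact ⟨by linarith, h2⟩
  calc ∫⁻ z in Metric.ball (0 : Rd d) R, f (ξ - toTorus z)
      ≤ ∫⁻ z in ⋃ j : J, unitCell fun i => ((j : Fin d → ℤ) i : ℝ), f (ξ - toTorus z) :=
        lintegral_mono_set hcover
    _ ≤ ∑' j : J, ∫⁻ z in unitCell fun i => ((j : Fin d → ℤ) i : ℝ), f (ξ - toTorus z) :=
        lintegral_iUnion_le _ _
    _ = ∑' _ : J, ∫⁻ η, f η := by
        refine tsum_congr fun j => ?_
        rw [← lintegral_torus_eq (f := fun η => f (ξ - η)) (hf.comp (measurable_const.sub measurable_id))]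
        exact lintegral_sub_left_eq_self f ξ
    _ = _ := by
        rw [tsum_fintype, Finset.sum_const, Finset.card_univ, Fintype.card_coe, nsmul_eq_mul]
        simp

/-- By Fubini some single ξ₀ satisfies f(ξ₀ - z) = f(ξ₀) for almost every z, and ξ₀ - z then sweeps
out almost all of the torus. -/
theorem exists_const_of_translation {f : Td d → ℝ} (hf : Measurable f)
    (h : ∀ z : Rd d, ∀ᵐ ξ : Td d, f (ξ - toTorus z) = f ξ) : ∃ k, ∀ᵐ ξ : Td d, f ξ = k := by
  have hmeas : MeasurableSet {q : Td d × Rd d | f (q.1 - toTorus q.2) = f q.1} :=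
    measurableSet_eq_fun (hf.comp (measurable_fst.sub (measurable_toTorus.comp measurable_snd)))
      (hf.comp measurable_fst)
  have h1 : ∀ᵐ ξ : Td d, ∀ᵐ z : Rd d, f (ξ - toTorus z) = f ξ :=
    (Measure.ae_ae_comm hmeas).2 (Eventually.of_forall h)
  obtain ⟨ξ₀, hξ₀⟩ := h1.exists
  refine ⟨f ξ₀, ?_⟩
  have h2 : ∀ᵐ η : Td d, f (ξ₀ - η) = f ξ₀ :=
    ae_of_ae_toTorus (measurableSet_eq_fun (hf.comp (measurable_const.sub measurable_id))
      measurable_const) hξ₀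
  have := (Measure.measurePreserving_sub_left (volume : Measure (Td d)) ξ₀).quasiMeasurePreserving.ae h2
  simpa using this

theorem nontrivial_L2Td : Nontrivial (L2Td d) := by
  refine ⟨⟨indicatorConstLp 2 MeasurableSet.univ (measure_ne_top _ _) (1 : ℂ), 0, fun h => ?_⟩⟩
  have h1 : ∀ᵐ ξ : Td d, (indicatorConstLp 2 (μ := (volume : Measure (Td d)))
    MeasurableSet.univ (measure_ne_top _ _) (1 : ℂ)) ξ = _ := indicatorConstLp_coeFn
  rw [h] at h1
  obtain ⟨ξ, hξ1, hξ2⟩ := (h1.and (Lp.coeFn_zero ℂ 2 (volume : Measure (Td d)))).exists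
  rw [hξ2] at hξ1
  simp at hξ1

end Torus

/-! ### Operators mapping `L²` boundedly into `L^∞` are compact -/

section HilbertSchmidt

open Filter Topology
open scoped ENNReal NNReal

theorem Orthonormal.norm_sum_smul_sq {ι E : Type*} [NormedAddCommGroup E] [InnerProductSpace ℂ E]
    {b : ι → E} (hb : Orthonormal ℂ b) (c : ι → ℂ) (F : Finset ι) :
    ‖∑ i ∈ F, c i • b i‖ ^ 2 = ∑ i ∈ F, ‖c i‖ ^ 2 := by
  have h1 : ((‖∑ i ∈ F, c i • b i‖ ^ 2 : ℝ) : ℂ) = ((∑ i ∈ F, ‖c i‖ ^ 2 : ℝ) : ℂ) := by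
    push_cast
    refine (inner_self_eq_norm_sq_to_K (𝕜 := ℂ) (∑ i ∈ F, c i • b i)).symm.trans ?_
    rw [hb.inner_sum]
    exact Finset.sum_congr rfl fun i _ => Complex.conj_mul' _
  exact_mod_cast h1

/-- T is the norm limit of its finite-rank restrictions to finitely many basis vectors: by
Cauchy–Schwarz and Bessel, the error at v is at most ‖v‖ times the square root of the tail of Σ‖T
b_i‖². -/
theorem isCompactOperator_of_hilbertSchmidt {ι E : Type*} [NormedAddCommGroup E]
    [InnerProductSpace ℂ E] [CompleteSpace E] (b : HilbertBasis ι ℂ E) (T : E →L[ℂ] E) {B : ℝ}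
    (hB : ∀ F : Finset ι, ∑ i ∈ F, ‖T (b i)‖ ^ 2 ≤ B) : IsCompactOperator T := by
  classical
  have hsum : Summable fun i => ‖T (b i)‖ ^ 2 :=
    summable_of_sum_le (fun i => by positivity) hB
  set P : Finset ι → E →L[ℂ] E := fun F => ∑ i ∈ F, (innerSL ℂ (b i)).smulRight (T (b i)) with hP
  have hPv : ∀ F v, P F v = ∑ i ∈ F, (inner ℂ (b i) v : ℂ) • T (b i) := by
    intro F v
    simp [hP]
  have hlim : Tendsto P atTop (𝓝 T) := by
    rw [Metric.tendsto_atTop]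
    intro ε hε
    obtain ⟨F₀, hF₀⟩ := summable_iff_vanishing_norm.1 hsum ((ε / 2) ^ 2) (by positivity)
    refine ⟨F₀, fun F hF => ?_⟩
    rw [dist_comm, dist_eq_norm]
    refine (ContinuousLinearMap.opNorm_le_bound _ (half_pos hε).le fun v => ?_).trans_lt
      (half_lt_self hε)
    have hT : Tendsto (fun F' => P F' v) atTop (𝓝 (T v)) := by
      have h1 := (b.hasSum_repr v).mapL T
      refine h1.congr fun F' => ?_
      rw [hPv]
      refine Finset.sum_congr rfl fun i _ => ?_
      rw [← b.repr_apply_apply]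
      exact map_smul T _ _
    refine le_of_tendsto ((hT.sub_const (P F v)).norm) ?_
    filter_upwards [eventually_ge_atTop F] with F' hF'
    have e1 : P F' v - P F v = ∑ i ∈ F' \ F, (inner ℂ (b i) v : ℂ) • T (b i) := by
      rw [hPv, hPv, Finset.sum_sdiff_eq_sub hF']
    have e2 : ∑ i ∈ F' \ F, ‖T (b i)‖ ^ 2 ≤ (ε / 2) ^ 2 := by
      have := hF₀ (F' \ F) (Finset.disjoint_of_subset_right hF Finset.sdiff_disjoint)
      exact (le_abs_self _).trans this.le
    have e3 : ∑ i ∈ F' \ F, ‖(inner ℂ (b i) v : ℂ)‖ ^ 2 ≤ ‖v‖ ^ 2 :=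
      b.orthonormal.sum_inner_products_le v
    rw [e1]
    refine abs_le_of_sq_le_sq' ?_ (by positivity) |>.2
    calc ‖∑ i ∈ F' \ F, (inner ℂ (b i) v : ℂ) • T (b i)‖ ^ 2
        ≤ (∑ i ∈ F' \ F, ‖(inner ℂ (b i) v : ℂ)‖ * ‖T (b i)‖) ^ 2 := by
          gcongr
          exact (norm_sum_le _ _).trans (Finset.sum_le_sum fun i _ => (norm_smul _ _).le)
      _ ≤ (∑ i ∈ F' \ F, ‖(inner ℂ (b i) v : ℂ)‖ ^ 2) * ∑ i ∈ F' \ F, ‖T (b i)‖ ^ 2 :=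
          Finset.sum_mul_sq_le_sq_mul_sq _ _ _
      _ ≤ ‖v‖ ^ 2 * (ε / 2) ^ 2 := by gcongr
      _ = (ε / 2 * ‖v‖) ^ 2 := by ring
  refine isCompactOperator_of_tendsto hlim (Eventually.of_forall fun F => ?_)
  have h1 : P F ∈ compactOperator (RingHom.id ℂ) E E := by
    refine Submodule.sum_mem _ fun i _ => ?_
    exact (isCompactOperator_of_locallyCompactSpace_dom (innerSL ℂ (b i))).clm_comp
      ((1 : ℂ →L[ℂ] ℂ).smulRight (T (b i)))
  exact h1

/-- For a.e. x the functional v ↦ Tv(x) has norm at most C on the span of finitely many basis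
vectors, so Σ|T b_i(x)|² ≤ C². Integrating over the finite measure space bounds the Hilbert–Schmidt
sums. -/
theorem isCompactOperator_of_ae_bound {α : Type*} [MeasurableSpace α] {μ : Measure α}
    [IsFiniteMeasure μ] (T : Lp ℂ 2 μ →L[ℂ] Lp ℂ 2 μ) {C : ℝ}
    (h : ∀ v, ∀ᵐ x ∂μ, ‖T v x‖ ≤ C * ‖v‖) : IsCompactOperator T := by
  classical
  obtain ⟨w, b, -⟩ := exists_hilbertBasis ℂ (Lp ℂ 2 μ)
  refine isCompactOperator_of_hilbertSchmidt b T (B := C ^ 2 * μ.real Set.univ) fun F => ?_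
  have hpt : ∀ᵐ x ∂μ, ∀ c : F → ℂ,
      ‖∑ i : F, c i * T (b i) x‖ ≤ C * √(∑ i : F, ‖c i‖ ^ 2) := by
    -- The exceptional null set depends on the coefficients, while the choice made below, c_i =
    -- conj(T b_i(x)), depends on x. A countable dense set of coefficients and continuity give one
    -- null set for all c.
    have h1 : ∀ᵐ x ∂μ, ∀ n : ℕ, ‖∑ i : F, TopologicalSpace.denseSeq (F → ℂ) n i * T (b i) x‖ ≤
        C * √(∑ i : F, ‖TopologicalSpace.denseSeq (F → ℂ) n i‖ ^ 2) := by
      rw [ae_all_iff]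
      intro n
      set c := TopologicalSpace.denseSeq (F → ℂ) n
      have hnorm : ‖∑ i : F, c i • b i‖ = √(∑ i : F, ‖c i‖ ^ 2) := by
        have := (b.orthonormal.comp (fun i : F => (i : w)) Subtype.val_injective).norm_sum_smul_sq
          c Finset.univ
        rw [← this, Real.sqrt_sq (norm_nonneg _)]
        rfl
      have hsum : ∀ s : Finset F, ∀ᵐ x ∂μ, (∑ i ∈ s, c i • T (b i) : Lp ℂ 2 μ) x =
          ∑ i ∈ s, c i * T (b i) x := by
        intro s
        induction s using Finset.induction_on with
        | empty =>
          filter_upwards [Lp.coeFn_zero ℂ 2 μ] with x hx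
          rw [Finset.sum_empty, Finset.sum_empty, hx]
          rfl
        | insert i s hi ih =>
          rw [Finset.sum_insert hi]
          filter_upwards [ih, Lp.coeFn_add (c i • T (b i)) (∑ i ∈ s, c i • T (b i)),
            Lp.coeFn_smul (c i) (T (b i))] with x h1 h2 h3
          rw [h2, Pi.add_apply, h1, h3, Finset.sum_insert hi]
          rfl
      filter_upwards [h (∑ i : F, c i • b i), hsum Finset.univ] with x h1 h2
      rw [hnorm, map_sum] at h1
      simp only [map_smul] at h1
      rwa [h2] at h1
    filter_upwards [h1] with x hx c
    refine (TopologicalSpace.denseRange_denseSeq (F → ℂ)).induction_on c ?_ hx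
    exact isClosed_le (by fun_prop) (by fun_prop)
  have hpt2 : ∀ᵐ x ∂μ, ∑ i ∈ F, ‖T (b i) x‖ ^ 2 ≤ C ^ 2 := by
    filter_upwards [hpt] with x hx
    have h1 := hx fun i => (starRingEnd ℂ) (T (b i) x)
    have h2 : ∑ i : F, (starRingEnd ℂ) (T (b i) x) * T (b i) x =
        ((∑ i : F, ‖T (b i) x‖ ^ 2 : ℝ) : ℂ) := by
      push_cast
      exact Finset.sum_congr rfl fun i _ => Complex.conj_mul' _
    rw [h2] at h1
    simp only [RCLike.norm_conj] at h1
    rw [Finset.sum_coe_sort F fun i => ‖T (b i) x‖ ^ 2] at h1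
    set S := ∑ i ∈ F, ‖T (b i) x‖ ^ 2
    have hS : 0 ≤ S := Finset.sum_nonneg fun i _ => by positivity
    rw [Complex.norm_real, Real.norm_eq_abs, abs_of_nonneg hS] at h1
    have h3 := Real.sq_sqrt hS
    have h4 := Real.sqrt_nonneg S
    rcases h4.eq_or_lt with h5 | h5
    · rw [← h3, ← h5, zero_pow two_ne_zero]; exact sq_nonneg C
    · have h6 : √S ≤ C := by
        refine le_of_mul_le_mul_right ?_ h5
        nlinarith
      rw [← h3]
      exact pow_le_pow_left₀ h4 h6 2
  have hint : ∀ u : Lp ℂ 2 μ, Integrable (fun x => ‖u x‖ ^ 2) μ := fun u =>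
    (memLp_two_iff_integrable_sq_norm (Lp.aestronglyMeasurable u)).1 (Lp.memLp u)
  have hnorm : ∀ u : Lp ℂ 2 μ, ‖u‖ ^ 2 = ∫ x, ‖u x‖ ^ 2 ∂μ := by
    intro u
    have h1 := inner_L2_eq u u
    rw [inner_self_eq_norm_sq_to_K] at h1
    have h2 : ∫ x, (starRingEnd ℂ) (u x) * u x ∂μ = ((∫ x, ‖u x‖ ^ 2 ∂μ : ℝ) : ℂ) := by
      rw [← integral_complex_ofReal]
      refine integral_congr_ae (Eventually.of_forall fun x => ?_)
      simpa using Complex.conj_mul' (u x)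
    rw [h2] at h1
    exact Complex.ofReal_injective (by simpa using h1)
  calc ∑ i ∈ F, ‖T (b i)‖ ^ 2 = ∫ x, ∑ i ∈ F, ‖T (b i) x‖ ^ 2 ∂μ := by
        rw [integral_finsetSum _ fun i _ => hint _]
        exact Finset.sum_congr rfl fun i _ => hnorm _
    _ ≤ ∫ _, C ^ 2 ∂μ := integral_mono_ae (integrable_finsetSum _ fun i _ => hint _)
        (integrable_const _) hpt2
    _ = _ := by rw [integral_const, smul_eq_mul, mul_comm]

end HilbertSchmidt

/-! ### Integral operators `v ↦ ∫ b z * q ξ z * v (ξ - z) dz` with `b ∈ L¹` -/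

section ShiftOperator

open Filter Topology
open scoped ENNReal NNReal

variable {d : ℕ}

/-- Young's inequality by Schur's argument: Cauchy–Schwarz on w = w^(1/2) w^(1/2), then Tonelli and
translation invariance on the torus. -/
theorem lintegral_shift_sq_le {w : Rd d → ℝ≥0∞} (hw : AEMeasurable w) (hfin : ∫⁻ z, w z ≠ ⊤)
    {f : Td d → ℝ≥0∞} (hf : Measurable f) :
    ∫⁻ ξ, (∫⁻ z, w z * f (ξ - toTorus z)) ^ (2 : ℝ) ≤
      (∫⁻ z, w z) ^ (2 : ℝ) * ∫⁻ ξ, f ξ ^ (2 : ℝ) := by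
  set W := ∫⁻ z, w z with hW
  have hmeas : Measurable (fun q : Td d × Rd d => f (q.1 - toTorus q.2)) :=
    hf.comp (measurable_fst.sub (measurable_toTorus.comp measurable_snd))
  have step : ∀ ξ : Td d, (∫⁻ z, w z * f (ξ - toTorus z)) ^ (2 : ℝ) ≤
      W * ∫⁻ z, w z * f (ξ - toTorus z) ^ (2 : ℝ) := by
    intro ξ
    have hmξ : Measurable (fun z : Rd d => f (ξ - toTorus z)) := hmeas.comp measurable_prodMk_left
    have hsplit : ∀ x : ℝ≥0∞, x = x ^ (1 / 2 : ℝ) * x ^ (1 / 2 : ℝ) := by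
      intro x
      rw [← ENNReal.rpow_add_of_nonneg _ _ (by norm_num) (by norm_num)]
      norm_num
    have e1 : ∫⁻ z, w z * f (ξ - toTorus z) =
        ∫⁻ z, ((fun z => w z ^ (1 / 2 : ℝ)) *
          (fun z => w z ^ (1 / 2 : ℝ) * f (ξ - toTorus z))) z := by
      refine lintegral_congr fun z => ?_
      rw [Pi.mul_apply, ← mul_assoc, ← hsplit]
    have e2 := ENNReal.lintegral_mul_le_Lp_mul_Lq (volume : Measure (Rd d))
      (p := 2) (q := 2) Real.HolderConjugate.two_two
      (f := fun z => w z ^ (1 / 2 : ℝ))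
      (g := fun z => w z ^ (1 / 2 : ℝ) * f (ξ - toTorus z))
      (hw.pow_const _) ((hw.pow_const _).mul hmξ.aemeasurable)
    rw [e1]
    refine (ENNReal.rpow_le_rpow e2 (by norm_num)).trans (le_of_eq ?_)
    rw [ENNReal.mul_rpow_of_nonneg _ _ (by norm_num), ← ENNReal.rpow_mul, ← ENNReal.rpow_mul]
    have hsq : ∀ x : ℝ≥0∞, (x ^ (1 / 2 : ℝ)) ^ (2 : ℝ) = x := by
      intro x
      rw [← ENNReal.rpow_mul]
      norm_num
    have e3 : (1 / 2 * 2 : ℝ) = 1 := by norm_num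
    rw [e3, ENNReal.rpow_one, ENNReal.rpow_one]
    congr 1
    · exact lintegral_congr fun z => hsq _
    · refine lintegral_congr fun z => ?_
      rw [ENNReal.mul_rpow_of_nonneg _ _ (by norm_num), hsq]
  have hprod : AEMeasurable (Function.uncurry fun (ξ : Td d) (z : Rd d) =>
      w z * f (ξ - toTorus z) ^ (2 : ℝ)) ((volume : Measure (Td d)).prod volume) :=
    (hw.comp_quasiMeasurePreserving Measure.quasiMeasurePreserving_snd).mul
      (hmeas.pow_const _).aemeasurable
  calc _ ≤ ∫⁻ ξ : Td d, W * ∫⁻ z, w z * f (ξ - toTorus z) ^ (2 : ℝ) := lintegral_mono step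
    _ = W * ∫⁻ z, ∫⁻ ξ : Td d, w z * f (ξ - toTorus z) ^ (2 : ℝ) := by
        rw [lintegral_const_mul' _ _ hfin, lintegral_lintegral_swap hprod]
    _ = W * ∫⁻ z, w z * ∫⁻ ξ : Td d, f ξ ^ (2 : ℝ) := by
        congr 1
        refine lintegral_congr fun z => ?_
        have hm : Measurable fun ξ : Td d => f (ξ - toTorus z) ^ (2 : ℝ) :=
          (hf.comp (measurable_id.sub measurable_const)).pow_const _
        rw [lintegral_const_mul _ hm,
          lintegral_sub_right_eq_self (fun ξ => f ξ ^ (2 : ℝ)) (toTorus z)]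
    _ = W * (W * ∫⁻ ξ : Td d, f ξ ^ (2 : ℝ)) := by rw [lintegral_mul_const'' _ hw]
    _ = _ := by
        rw [← mul_assoc, ENNReal.rpow_ofNat, pow_two]

/-- A bounded measurable weight on `𝕋^d × ℝ^d`. -/
structure IsBoundedWeight (q : Td d → Rd d → ℝ) (M : ℝ) : Prop where
  measurable : Measurable (Function.uncurry q)
  bound : ∀ ξ z, |q ξ z| ≤ M

/-- `∫ b z * q ξ z * v (ξ - z) dz`. -/
noncomputable def shiftIntegral (q : Td d → Rd d → ℝ) (b : Rd d → ℝ) (v : Td d → ℂ) (ξ : Td d) :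
    ℂ :=
  ∫ z, ((b z * q ξ z : ℝ) : ℂ) * v (ξ - toTorus z)

namespace IsBoundedWeight

variable {q : Td d → Rd d → ℝ} {M : ℝ}

theorem nonneg (hq : IsBoundedWeight q M) : 0 ≤ M := (abs_nonneg _).trans (hq.bound 0 0)

theorem aestronglyMeasurable (hq : IsBoundedWeight q M) {b : Rd d → ℝ} (hb : Integrable b)
    {v : Td d → ℂ} (hv : Measurable v) :
    AEStronglyMeasurable
      (fun p : Td d × Rd d => ((b p.2 * q p.1 p.2 : ℝ) : ℂ) * v (p.1 - toTorus p.2))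
      ((volume : Measure (Td d)).prod volume) := by
  have h1 : AEStronglyMeasurable (fun p : Td d × Rd d => b p.2)
      ((volume : Measure (Td d)).prod volume) := hb.aestronglyMeasurable.comp_snd
  have h2 : Measurable (fun p : Td d × Rd d => q p.1 p.2) := hq.measurable
  refine (Complex.continuous_ofReal.comp_aestronglyMeasurable
    (h1.mul h2.aestronglyMeasurable)).mul ?_
  exact (hv.comp (measurable_fst.sub (measurable_toTorus.comp measurable_snd))).aestronglyMeasurable

theorem lintegral_le (hq : IsBoundedWeight q M) {b : Rd d → ℝ} (hb : Integrable b)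
    {v : Td d → ℂ} (hv : Measurable v) :
    ∫⁻ ξ, (∫⁻ z, ‖((b z * q ξ z : ℝ) : ℂ) * v (ξ - toTorus z)‖ₑ) ^ (2 : ℝ) ≤
      (ENNReal.ofReal (M * ∫ z, ‖b z‖) * eLpNorm v 2 volume) ^ (2 : ℝ) := by
  have hW : ∫⁻ z, ENNReal.ofReal M * ‖b z‖ₑ = ENNReal.ofReal (M * ∫ z, ‖b z‖) := by
    rw [lintegral_const_mul'' _ hb.aestronglyMeasurable.enorm, ENNReal.ofReal_mul hq.nonneg,
      ofReal_integral_norm_eq_lintegral_enorm hb]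
  have key := lintegral_shift_sq_le (w := fun z => ENNReal.ofReal M * ‖b z‖ₑ)
    (hb.aestronglyMeasurable.enorm.const_mul _) (by rw [hW]; exact ENNReal.ofReal_ne_top) hv.enorm
  rw [hW] at key
  rw [ENNReal.mul_rpow_of_nonneg _ _ (by norm_num),
    eLpNorm_eq_lintegral_rpow_enorm_toReal (by norm_num) (by norm_num), ← ENNReal.rpow_mul]
  refine le_trans (lintegral_mono fun ξ => ?_) (key.trans (le_of_eq ?_))
  · refine ENNReal.rpow_le_rpow (lintegral_mono fun z => ?_) (by norm_num)
    rw [enorm_mul]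
    gcongr
    rw [← ofReal_norm, Complex.norm_real, norm_mul, mul_comm,
      ENNReal.ofReal_mul (norm_nonneg _), ofReal_norm (b z)]
    gcongr
    exact hq.bound ξ z
  · norm_num

theorem ae_integrable (hq : IsBoundedWeight q M) {b : Rd d → ℝ} (hb : Integrable b)
    (v : L2Td d) : ∀ᵐ ξ : Td d, Integrable
      (fun z : Rd d => ((b z * q ξ z : ℝ) : ℂ) * v (ξ - toTorus z)) := by
  have hv : Measurable v := (Lp.stronglyMeasurable v).measurable
  have hm := hq.aestronglyMeasurable hb hv
  have hfin : ∫⁻ ξ : Td d,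
      (∫⁻ z, ‖((b z * q ξ z : ℝ) : ℂ) * v (ξ - toTorus z)‖ₑ) ^ (2 : ℝ) ≠ ⊤ := by
    refine ne_top_of_le_ne_top ?_ (hq.lintegral_le hb hv)
    exact ENNReal.rpow_ne_top_of_nonneg (by norm_num)
      (ENNReal.mul_ne_top ENNReal.ofReal_ne_top (Lp.memLp v).eLpNorm_ne_top)
  have hae := ae_lt_top' (hm.enorm.lintegral_prod_right'.pow_const _) hfin
  filter_upwards [hae, hm.prodMk_left] with ξ h1 h2
  refine ⟨h2, ?_⟩
  by_contra hcon
  rw [HasFiniteIntegral, not_lt, top_le_iff] at hcon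
  simp only [hcon] at h1
  norm_num at h1

theorem eLpNorm_shiftIntegral_le (hq : IsBoundedWeight q M) {b : Rd d → ℝ} (hb : Integrable b)
    (v : L2Td d) : eLpNorm (shiftIntegral q b v) 2 volume ≤
      ENNReal.ofReal (M * ∫ z, ‖b z‖) * eLpNorm v 2 volume := by
  have hv : Measurable v := (Lp.stronglyMeasurable v).measurable
  rw [← ENNReal.rpow_le_rpow_iff (z := 2) (by norm_num)]
  refine le_trans ?_ (hq.lintegral_le hb hv)
  rw [eLpNorm_eq_lintegral_rpow_enorm_toReal (by norm_num) (by norm_num), ← ENNReal.rpow_mul]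
  have e3 : (1 / (2 : ℝ≥0∞).toReal * 2 : ℝ) = 1 := by norm_num
  rw [e3, ENNReal.rpow_one]
  refine lintegral_mono fun ξ => ?_
  rw [ENNReal.toReal_ofNat]
  exact ENNReal.rpow_le_rpow (enorm_integral_le_lintegral_enorm _) (by norm_num)

theorem memLp_shiftIntegral (hq : IsBoundedWeight q M) {b : Rd d → ℝ} (hb : Integrable b)
    (v : L2Td d) : MemLp (shiftIntegral q b v) 2 volume :=
  ⟨(hq.aestronglyMeasurable hb (Lp.stronglyMeasurable v).measurable).integral_prod_right',
    (hq.eLpNorm_shiftIntegral_le hb v).trans_lt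
      (ENNReal.mul_lt_top ENNReal.ofReal_lt_top (Lp.memLp v).eLpNorm_lt_top)⟩

/-- Carries almost everywhere identities between L² functions to the shifted argument under the
integral. Enclosing the bad set in a measurable null set removes any measurability requirement on P.
-/
theorem ae_shift_of_ae {P : Td d → Prop} (h : ∀ᵐ ξ : Td d, P ξ) :
    ∀ᵐ ξ : Td d, ∀ᵐ z : Rd d, P (ξ - toTorus z) := by
  obtain ⟨t, ht1, ht2, ht3⟩ := exists_measurable_superset_of_null h
  have h2 := IsPeriodicJumpKernel.ae_ae_shift (P := fun ξ => ξ ∉ t) ht2.compl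
    (measure_eq_zero_iff_ae_notMem.1 ht3)
  filter_upwards [h2] with ξ hξ
  filter_upwards [hξ] with z hz
  by_contra hP
  exact hz (ht1 hP)

theorem shiftIntegral_add_ae (hq : IsBoundedWeight q M) {b : Rd d → ℝ} (hb : Integrable b)
    (v w : L2Td d) : shiftIntegral q b (v + w : L2Td d) =ᵐ[volume]
      shiftIntegral q b v + shiftIntegral q b w := by
  filter_upwards [ae_shift_of_ae (Lp.coeFn_add v w), hq.ae_integrable hb v,
    hq.ae_integrable hb w] with ξ h2 h3 h4
  rw [Pi.add_apply, shiftIntegral, shiftIntegral, shiftIntegral, ← integral_add h3 h4]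
  refine integral_congr_ae ?_
  filter_upwards [h2] with z hz
  rw [hz, Pi.add_apply, mul_add]

theorem shiftIntegral_smul_ae (b : Rd d → ℝ) (c : ℂ) (v : L2Td d) :
    shiftIntegral q b (c • v : L2Td d) =ᵐ[volume] c • shiftIntegral q b v := by
  filter_upwards [ae_shift_of_ae (Lp.coeFn_smul c v)] with ξ h2
  rw [Pi.smul_apply, shiftIntegral, shiftIntegral, smul_eq_mul, ← integral_const_mul]
  refine integral_congr_ae ?_
  filter_upwards [h2] with z hz
  rw [hz, Pi.smul_apply, smul_eq_mul]
  ring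

/-- The integral operator with kernel `b z * q ξ z`. -/
noncomputable def shiftOpAux (hq : IsBoundedWeight q M) {b : Rd d → ℝ} (hb : Integrable b) :
    L2Td d →L[ℂ] L2Td d :=
  LinearMap.mkContinuous
    { toFun := fun v => (hq.memLp_shiftIntegral hb v).toLp (shiftIntegral q b v)
      map_add' := fun v w => by
        rw [← MemLp.toLp_add]
        exact MemLp.toLp_congr _ _ (hq.shiftIntegral_add_ae hb v w)
      map_smul' := fun c v => by
        rw [RingHom.id_apply, ← MemLp.toLp_const_smul]
        exact MemLp.toLp_congr _ _ (shiftIntegral_smul_ae b c v) }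
    (M * ∫ z, ‖b z‖) (fun v => by
      have h2 := ENNReal.toReal_mono
        (ENNReal.mul_ne_top ENNReal.ofReal_ne_top (Lp.memLp v).eLpNorm_ne_top)
        (hq.eLpNorm_shiftIntegral_le hb v)
      rw [ENNReal.toReal_mul, ENNReal.toReal_ofReal (mul_nonneg hq.nonneg
        (integral_nonneg fun _ => norm_nonneg _)), ← Lp.norm_def] at h2
      exact (Lp.norm_toLp _ (hq.memLp_shiftIntegral hb v)).trans_le h2)

theorem shiftOpAux_ae (hq : IsBoundedWeight q M) {b : Rd d → ℝ} (hb : Integrable b)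
    (v : L2Td d) : shiftOpAux hq hb v =ᵐ[volume] shiftIntegral q b v :=
  (hq.memLp_shiftIntegral hb v).coeFn_toLp

theorem norm_shiftOpAux_le (hq : IsBoundedWeight q M) {b : Rd d → ℝ} (hb : Integrable b) :
    ‖shiftOpAux hq hb‖ ≤ M * ∫ z, ‖b z‖ :=
  LinearMap.mkContinuous_norm_le _
    (mul_nonneg hq.nonneg (integral_nonneg fun _ => norm_nonneg _)) _

theorem shiftIntegral_congr {b b' : Rd d → ℝ} (h : b =ᵐ[volume] b') (v : Td d → ℂ) (ξ : Td d) :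
    shiftIntegral q b v ξ = shiftIntegral q b' v ξ := by
  refine integral_congr_ae ?_
  filter_upwards [h] with z hz
  rw [hz]

/-- The integral operators with kernels `b z * q ξ z`, as a bounded linear function of
`b ∈ L¹(ℝ^d)`. -/
noncomputable def shiftOp (hq : IsBoundedWeight q M) :
    Lp ℝ 1 (volume : Measure (Rd d)) →L[ℝ] L2Td d →L[ℂ] L2Td d :=
  LinearMap.mkContinuous
    { toFun := fun b => shiftOpAux hq (L1.integrable_coeFn b)
      map_add' := fun b c => by
        ext1 v
        refine Lp.ext ?_
        rw [add_apply]
        filter_upwards [hq.shiftOpAux_ae (L1.integrable_coeFn (b + c)) v,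
          hq.shiftOpAux_ae (L1.integrable_coeFn b) v, hq.shiftOpAux_ae (L1.integrable_coeFn c) v,
          Lp.coeFn_add (hq.shiftOpAux (L1.integrable_coeFn b) v)
            (hq.shiftOpAux (L1.integrable_coeFn c) v),
          hq.ae_integrable (L1.integrable_coeFn b) v, hq.ae_integrable (L1.integrable_coeFn c) v]
          with ξ h1 h2 h3 h4 h5 h6
        rw [h1, h4, Pi.add_apply, h2, h3, shiftIntegral_congr (Lp.coeFn_add b c), shiftIntegral,
          shiftIntegral, shiftIntegral, ← integral_add h5 h6]
        refine integral_congr_ae (Eventually.of_forall fun z => ?_)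
        simp only [Pi.add_apply]
        push_cast
        ring
      map_smul' := fun r b => by
        ext1 v
        refine Lp.ext ?_
        rw [smul_apply, RingHom.id_apply]
        filter_upwards [hq.shiftOpAux_ae (L1.integrable_coeFn (r • b)) v,
          hq.shiftOpAux_ae (L1.integrable_coeFn b) v,
          Lp.coeFn_smul r (hq.shiftOpAux (L1.integrable_coeFn b) v)] with ξ h1 h2 h3
        rw [h1, h3, Pi.smul_apply, h2, shiftIntegral_congr (Lp.coeFn_smul r b), shiftIntegral,
          shiftIntegral, Complex.real_smul, ← integral_const_mul]
        refine integral_congr_ae (Eventually.of_forall fun z => ?_)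
        simp only [Pi.smul_apply, smul_eq_mul]
        push_cast
        ring }
    M (fun b => by
      rw [L1.norm_eq_integral_norm]
      exact norm_shiftOpAux_le hq (L1.integrable_coeFn b))

theorem shiftOp_ae (hq : IsBoundedWeight q M) (b : Lp ℝ 1 (volume : Measure (Rd d)))
    (v : L2Td d) : shiftOp hq b v =ᵐ[volume] shiftIntegral q b v :=
  hq.shiftOpAux_ae (L1.integrable_coeFn b) v

theorem shiftOp_toL1_ae (hq : IsBoundedWeight q M) {b : Rd d → ℝ} (hb : Integrable b)
    (v : L2Td d) : shiftOp hq hb.toL1 v =ᵐ[volume] shiftIntegral q b v := by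
  filter_upwards [hq.shiftOp_ae hb.toL1 v] with ξ h
  rw [h, shiftIntegral_congr hb.coeFn_toL1]

end IsBoundedWeight

end ShiftOperator

/-! ### Compactness, positivity and irreducibility of the integral operators -/

section ShiftOperatorProperties

open Filter Topology
open scoped ENNReal NNReal

variable {d : ℕ}

namespace IsBoundedWeight

variable {q : Td d → Rd d → ℝ} {M : ℝ}

/-- A bounded kernel supported in a ball is controlled by the L¹ norm of v on the torus, counted
finitely often, and L² embeds in L¹ there; the factor c below is the constant of that embedding. -/
theorem exists_ae_bound_of_bounded_support (hq : IsBoundedWeight q M) {b : Rd d → ℝ} (hb : Integrable b)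
    {B R : ℝ} (hB : ∀ z, ‖b z‖ ≤ B) (hR : ∀ z, b z ≠ 0 → z ∈ Metric.ball (0 : Rd d) R) :
    ∃ C : ℝ, ∀ v : L2Td d, ∀ᵐ ξ, ‖shiftOp hq hb.toL1 v ξ‖ ≤ C * ‖v‖ := by
  obtain ⟨N, hN⟩ := exists_lintegral_ball_le d R
  have hB0 : 0 ≤ B := (norm_nonneg _).trans (hB 0)
  set c := (volume (Set.univ : Set (Td d))) ^ (1 / (1 : ℝ≥0∞).toReal - 1 / (2 : ℝ≥0∞).toReal) with hc
  have hcfin : c ≠ ⊤ := ENNReal.rpow_ne_top_of_nonneg (by norm_num) (measure_ne_top _ _)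
  refine ⟨(ENNReal.ofReal (B * M) * N * c).toReal, fun v => ?_⟩
  filter_upwards [hq.shiftOp_toL1_ae hb v] with ξ hξ
  rw [hξ]
  have hv : Measurable v := (Lp.stronglyMeasurable v).measurable
  have h1 : ‖shiftIntegral q b v ξ‖ₑ ≤ ENNReal.ofReal (B * M) * N * c * ‖v‖ₑ := by
    calc ‖shiftIntegral q b v ξ‖ₑ
        ≤ ∫⁻ z, ‖((b z * q ξ z : ℝ) : ℂ) * v (ξ - toTorus z)‖ₑ :=
          enorm_integral_le_lintegral_enorm _
      _ ≤ ∫⁻ z, (Metric.ball (0 : Rd d) R).indicator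
            (fun z => ENNReal.ofReal (B * M) * ‖v (ξ - toTorus z)‖ₑ) z := by
          refine lintegral_mono fun z => ?_
          by_cases hz : z ∈ Metric.ball (0 : Rd d) R
          · rw [Set.indicator_of_mem hz, enorm_mul]
            gcongr
            rw [← ofReal_norm, Complex.norm_real, norm_mul]
            exact ENNReal.ofReal_le_ofReal
              (mul_le_mul (hB z) (hq.bound ξ z) (norm_nonneg _) hB0)
          · have : b z = 0 := by
              by_contra h0
              exact hz (hR z h0)
            simp [this]
      _ = ENNReal.ofReal (B * M) * ∫⁻ z in Metric.ball (0 : Rd d) R, ‖v (ξ - toTorus z)‖ₑ := by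
          rw [lintegral_indicator Metric.isOpen_ball.measurableSet,
            lintegral_const_mul' _ _ ENNReal.ofReal_ne_top]
      _ ≤ ENNReal.ofReal (B * M) * (N * ∫⁻ η, ‖v η‖ₑ) := by
          gcongr
          exact hN (fun η => ‖v η‖ₑ) hv.enorm ξ
      _ ≤ ENNReal.ofReal (B * M) * (N * (‖v‖ₑ * c)) := by
          gcongr
          rw [← eLpNorm_one_eq_lintegral_enorm, Lp.enorm_def]
          exact eLpNorm_le_eLpNorm_mul_rpow_measure_univ (by norm_num) hv.aestronglyMeasurable
      _ = _ := by ring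
  have h2 := ENNReal.toReal_mono (by finiteness) h1
  rw [ENNReal.toReal_mul] at h2
  simpa using h2

/-- The operator depends continuously on b ∈ L¹, compact operators are norm closed, and the dense
set of continuous compactly supported b falls under the L² to L^∞ criterion. -/
theorem isCompactOperator_shiftOp (hq : IsBoundedWeight q M)
    (b : Lp ℝ 1 (volume : Measure (Rd d))) : IsCompactOperator (shiftOp hq b) := by
  have hclosed : IsClosed {T : L2Td d →L[ℂ] L2Td d | IsCompactOperator T} :=
    isClosed_setOfPred_isCompactOperator
  have hmem : b ∈ closure {b | IsCompactOperator (shiftOp hq b)} := by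
    rw [Metric.mem_closure_iff]
    intro ε hε
    obtain ⟨g, hg1, hg2, hg3, hg4⟩ :=
      (L1.integrable_coeFn b).exists_hasCompactSupport_integral_sub_le (half_pos hε)
    refine ⟨hg4.toL1, ?_, ?_⟩
    · obtain ⟨B, hB⟩ := hg3.bounded_above_of_compact_support hg1
      obtain ⟨R, hR⟩ := hg1.isCompact.isBounded.subset_ball (0 : Rd d)
      obtain ⟨C, hC⟩ := hq.exists_ae_bound_of_bounded_support hg4 hB
        (fun z hz => hR (subset_tsupport g hz))
      exact isCompactOperator_of_ae_bound _ hC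
    · rw [dist_eq_norm, L1.norm_eq_integral_norm]
      refine lt_of_le_of_lt ((integral_congr_ae ?_).trans_le hg2) (half_lt_self hε)
      filter_upwards [Lp.coeFn_sub b hg4.toL1, hg4.coeFn_toL1] with z h1 h2
      rw [h1, Pi.sub_apply, h2]
  have := hclosed.preimage (shiftOp hq).continuous
  exact this.closure_subset hmem

theorem shiftOp_apply_of_dominated (hq : IsBoundedWeight q M)
    (b : Lp ℝ 1 (volume : Measure (Rd d))) {f g : L2Td d} (hfg : Dominated f g) :
    ∀ᵐ ξ, Integrable (fun z => b z * q ξ z * (g (ξ - toTorus z)).re) ∧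
      shiftOp hq b g ξ = ((∫ z, b z * q ξ z * (g (ξ - toTorus z)).re : ℝ) : ℂ) := by
  filter_upwards [hq.shiftOp_ae b g, hq.ae_integrable (L1.integrable_coeFn b) g,
    ae_shift_of_ae hfg] with ξ h1 h2 h3
  refine ⟨h2.re.congr ?_, ?_⟩
  · refine Eventually.of_forall fun z => ?_
    simp
  · rw [h1, shiftIntegral, ← integral_complex_ofReal]
    refine integral_congr_ae ?_
    filter_upwards [h3] with z hz
    apply Complex.ext <;> simp [hz.2]

theorem isPositiveOp_shiftOp (hq : IsBoundedWeight q M) (hq0 : ∀ ξ z, 0 ≤ q ξ z)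
    {b : Lp ℝ 1 (volume : Measure (Rd d))} (hb : ∀ᵐ z, 0 ≤ b z) :
    IsPositiveOp (shiftOp hq b) := by
  intro f g hfg
  filter_upwards [hq.shiftOp_ae b f, hq.shiftOp_apply_of_dominated b hfg,
    ae_shift_of_ae hfg] with ξ h1 h2 h3
  rw [h1, h2.2, Complex.ofReal_re, Complex.ofReal_im]
  refine ⟨norm_integral_le_of_norm_le h2.1 ?_, rfl⟩
  filter_upwards [h3, hb] with z hz hbz
  rw [norm_mul, Complex.norm_real, Real.norm_eq_abs, abs_of_nonneg (mul_nonneg hbz (hq0 ξ z))]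
  exact mul_le_mul_of_nonneg_left hz.1 (mul_nonneg hbz (hq0 ξ z))

/-- Let Z = {g = 0}, which is also {f ≠ 0} up to a null set. Orthogonality forces Kg = 0 on Z, that
is, ξ ∈ Z implies ξ - z ∈ Z for a.e. z with b(z) > 0. So the indicator of Z is invariant under a set
of translations of positive measure, hence under all, hence constant: Z is null or conull. -/
theorem isIrreducibleOp_shiftOp (hq : IsBoundedWeight q M) (hq0 : ∀ ξ z, 0 < q ξ z)
    {b : Lp ℝ 1 (volume : Measure (Rd d))} (hb : ∀ᵐ z, 0 ≤ b z) (hb0 : volume {z | 0 < b z} ≠ 0) :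
    IsIrreducibleOp (shiftOp hq b) := by
  intro f g hf hg h0 hfg
  have hS : MeasurableSet {z | 0 < b z} :=
    measurableSet_lt measurable_const (Lp.stronglyMeasurable b).measurable
  have hZ : MeasurableSet {ξ | g ξ = 0} :=
    (Lp.stronglyMeasurable g).measurable (measurableSet_singleton 0)
  have hKg := hq.isPositiveOp_shiftOp (fun ξ z => (hq0 ξ z).le) hb _ _ hg
  have hprod : ∀ᵐ ξ, f ξ ≠ 0 → shiftOp hq b g ξ = 0 := by
    have e : inner ℂ f (shiftOp hq b g) =
        ((∫ ξ, (f ξ).re * (shiftOp hq b g ξ).re : ℝ) : ℂ) := by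
      rw [inner_L2_eq, ← integral_complex_ofReal]
      refine integral_congr_ae ?_
      filter_upwards [hf, hKg] with x h1 h2
      apply Complex.ext <;> simp [h1.2, h2.2]
    have hint : Integrable (fun ξ => (f ξ).re * (shiftOp hq b g ξ).re) := by
      refine (integrable_conj_mul f (shiftOp hq b g)).re.congr ?_
      filter_upwards [hf, hKg] with x h1 h2
      simp [h1.2, h2.2]
    rw [e, Complex.ofReal_eq_zero, integral_eq_zero_iff_of_nonneg_ae ?_ hint] at h0
    · filter_upwards [h0, hf, hKg] with ξ h1 h2 h3 hfξ
      have h4 : 0 < (f ξ).re := (norm_pos_iff.2 hfξ).trans_le h2.1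
      have h5 := h3.1
      rw [(mul_eq_zero.1 h1).resolve_left h4.ne'] at h5
      exact norm_le_zero_iff.1 h5
    · filter_upwards [hf, hKg] with x h1 h2
      exact mul_nonneg ((norm_nonneg _).trans h1.1) ((norm_nonneg _).trans h2.1)
  have hshift : ∀ᵐ ξ : Td d, ∀ᵐ z : Rd d, 0 < b z → g ξ = 0 → g (ξ - toTorus z) = 0 := by
    filter_upwards [hprod, hfg, hq.shiftOp_apply_of_dominated b hg, ae_shift_of_ae hg]
      with ξ h1 h2 h3 h4
    by_cases hgξ : g ξ = 0
    · have hfξ : f ξ ≠ 0 := by tauto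
      have h5 := h1 hfξ
      rw [h3.2, Complex.ofReal_eq_zero, integral_eq_zero_iff_of_nonneg_ae ?_ h3.1] at h5
      · filter_upwards [h5, h4] with z h6 h7 hbz _
        have h8 := (mul_eq_zero.1 h6).resolve_left (mul_pos hbz (hq0 ξ z)).ne'
        have h9 := h7.1
        rw [h8] at h9
        exact norm_le_zero_iff.1 h9
      · filter_upwards [h4, hb] with z h6 h7
        exact mul_nonneg (mul_nonneg h7 (hq0 ξ z).le) ((norm_nonneg _).trans h6.1)
    · exact Eventually.of_forall fun z _ h => absurd h hgξ
  set u : Td d → ℝ := {ξ | g ξ = 0}.indicator fun _ => 1 with hu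
  have hum : Measurable u := measurable_const.indicator hZ
  have hui : Integrable u := (integrable_const 1).indicator hZ
  have hle : ∀ᵐ z : Rd d, ∀ᵐ ξ : Td d, 0 < b z → g ξ = 0 → g (ξ - toTorus z) = 0 := by
    refine (Measure.ae_ae_comm ?_).1 hshift
    have m1 : MeasurableSet {p : Td d × Rd d | 0 < b p.2} := measurable_snd hS
    have m2 : MeasurableSet {p : Td d × Rd d | g p.1 = 0} := measurable_fst hZ
    have m3 : MeasurableSet {p : Td d × Rd d | g (p.1 - toTorus p.2) = 0} :=
      (measurable_fst.sub (measurable_toTorus.comp measurable_snd)) hZ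
    have : {p : Td d × Rd d | 0 < b p.2 → g p.1 = 0 → g (p.1 - toTorus p.2) = 0} =
        {p : Td d × Rd d | 0 < b p.2}ᶜ ∪ ({p : Td d × Rd d | g p.1 = 0}ᶜ ∪
          {p : Td d × Rd d | g (p.1 - toTorus p.2) = 0}) := by
      ext p
      simp only [Set.mem_ofPred_eq, Set.mem_union, Set.mem_compl_iff]
      tauto
    exact this ▸ m1.compl.union (m2.compl.union m3)
  -- The inclusion gives u(ξ - z) ≥ u(ξ) only; both sides have the same integral, so equality holds
  -- almost everywhere.
  have htrans : ∀ᵐ z : Rd d, z ∈ {z | 0 < b z} → ∀ᵐ ξ : Td d,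
      u (ξ - toTorus z) = u ξ + (0 : Rd d →+ ℝ) z := by
    filter_upwards [hle] with z hz hbz
    have hmp := measurePreserving_sub_right (volume : Measure (Td d)) (toTorus z)
    have hui' : Integrable fun ξ => u (ξ - toTorus z) := hmp.integrable_comp_of_integrable hui
    have h1 : ∀ᵐ ξ : Td d, 0 ≤ u (ξ - toTorus z) - u ξ := by
      filter_upwards [hz] with ξ hξ
      by_cases hg0 : g ξ = 0
      · have := hξ hbz hg0
        simp [hu, hg0, this]
      · have : 0 ≤ u (ξ - toTorus z) := Set.indicator_nonneg (fun _ _ => zero_le_one) _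
        simpa [hu, hg0] using this
    have h2 : ∫ ξ, (u (ξ - toTorus z) - u ξ) = 0 := by
      rw [integral_sub hui' hui, integral_sub_right_eq_self u (toTorus z), sub_self]
    rw [integral_eq_zero_iff_of_nonneg_ae h1 (hui'.sub hui)] at h2
    filter_upwards [h2] with ξ hξ
    have h3 : u (ξ - toTorus z) - u ξ = 0 := hξ
    simpa using sub_eq_zero.1 h3
  obtain ⟨k, hk⟩ := exists_const_of_translation hum fun z => by
    simpa using translationGroup_eq_top hS hb0 htrans z
  by_cases hk1 : k = 1
  · right
    refine Lp.ext ?_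
    filter_upwards [hk, Lp.coeFn_zero ℂ 2 (volume : Measure (Td d))] with ξ h1 h2
    rw [h2]
    by_contra hne
    have : u ξ = 0 := Set.indicator_of_notMem (s := {ξ | g ξ = 0}) hne _
    rw [this, hk1] at h1
    exact zero_ne_one h1
  · left
    refine Lp.ext ?_
    filter_upwards [hk, hfg, Lp.coeFn_zero ℂ 2 (volume : Measure (Td d))] with ξ h1 h2 h3
    rw [h3]
    refine h2.2 fun hne => hk1 ?_
    rw [← h1]
    exact Set.indicator_of_mem (s := {ξ | g ξ = 0}) hne _

end IsBoundedWeight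

end ShiftOperatorProperties

/-! ### The skewed operator as `K - G` -/

section Skewed

open Filter Topology
open scoped ENNReal NNReal

variable {d : ℕ}

/-- `Λ` along the jump `ξ ↦ ξ - z`. -/
noncomputable def jumpWeight (Λ : Rd d → Rd d → ℝ) (ξ : Td d) (z : Rd d) : ℝ :=
  Λ (cellRep ξ) (cellRep ξ - z)

/-- The exponentially tilted density `b z * e^{-l·z}`. -/
noncomputable def tilt (b : Rd d → ℝ) (l : Rd d) (z : Rd d) : ℝ := b z * Real.exp (-inner ℝ l z)

instance neZero_volume_Td : NeZero (volume : Measure (Td d)) :=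
  ⟨fun h0 => isOpen_univ.measure_ne_zero (volume : Measure (Td d)) ⟨0, Set.mem_univ _⟩
    (by rw [h0]; rfl)⟩

namespace IsPeriodicJumpKernel

variable {a : Rd d → ℝ} {Λ : Rd d → Rd d → ℝ}

/-- The parameter l enters only through the L¹ factor, so smoothness in l reduces to that of a curve
of densities in L¹. -/
theorem shiftKernel_eq (a : Rd d → ℝ) (Λ : Rd d → Rd d → ℝ) (l : Rd d) (ξ : Td d) (z : Rd d) :
    shiftKernel a Λ l ξ z = tilt a l z * jumpWeight Λ ξ z := by
  rw [shiftKernel, tilt, jumpWeight, inner_neg_right]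
  ring

theorem exists_isBoundedWeight (h : IsPeriodicJumpKernel a Λ) :
    ∃ M, IsBoundedWeight (jumpWeight Λ) M := by
  obtain ⟨m, hm, hlow⟩ := h.lower
  obtain ⟨M, hup⟩ := h.upper
  refine ⟨M, ⟨?_, fun ξ z => ?_⟩⟩
  · exact h.measurable.comp ((measurable_cellRep.comp measurable_fst).prodMk
      ((measurable_cellRep.comp measurable_fst).sub measurable_snd))
  · rw [jumpWeight, abs_of_nonneg (hm.le.trans (hlow _ _))]
    exact hup _ _

/-- An upper bound for `Λ`. -/
noncomputable def weightBound (h : IsPeriodicJumpKernel a Λ) : ℝ :=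
  h.exists_isBoundedWeight.choose

theorem isBoundedWeight (h : IsPeriodicJumpKernel a Λ) :
    IsBoundedWeight (jumpWeight Λ) h.weightBound :=
  h.exists_isBoundedWeight.choose_spec

theorem jumpWeight_pos (h : IsPeriodicJumpKernel a Λ) (ξ : Td d) (z : Rd d) :
    0 < jumpWeight Λ ξ z := by
  obtain ⟨m, hm, hlow⟩ := h.lower
  exact hm.trans_le (hlow _ _)

theorem integrable_mul_exp (h : IsPeriodicJumpKernel a Λ) (c : ℝ) :
    Integrable fun z : Rd d => a z * Real.exp (c * ‖z‖) := by
  obtain ⟨p, k, C, hp, hk, hC, hdec⟩ := h.decay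
  refine ((integrable_exp_decay hp hk c).const_mul C).mono'
    (h.integrable.aestronglyMeasurable.mul (by fun_prop)) ?_
  filter_upwards with z
  rw [Real.norm_eq_abs, abs_of_nonneg (mul_nonneg (h.nonneg z) (Real.exp_pos _).le)]
  calc a z * Real.exp (c * ‖z‖)
      ≤ (C * Real.exp (-(k * ‖z‖ ^ p))) * Real.exp (c * ‖z‖) := by gcongr; exact hdec z
    _ = C * Real.exp (c * ‖z‖ - k * ‖z‖ ^ p) := by
      rw [sub_eq_add_neg, Real.exp_add]; ring

end IsPeriodicJumpKernel

/-- All exponential moments of `b` are finite. -/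
def HasExpMoments (b : Rd d → ℝ) : Prop :=
  AEStronglyMeasurable b volume ∧ ∀ c : ℝ, Integrable fun z : Rd d => |b z| * Real.exp (c * ‖z‖)

theorem exp_neg_inner_le (l z : Rd d) : Real.exp (-inner ℝ l z) ≤ Real.exp (‖l‖ * ‖z‖) := by
  refine Real.exp_le_exp.2 ?_
  have := neg_abs_le (inner ℝ l z)
  have := abs_real_inner_le_norm l z
  linarith

namespace HasExpMoments

variable {b : Rd d → ℝ}

theorem aestronglyMeasurable_tilt (hb : HasExpMoments b) (l : Rd d) :
    AEStronglyMeasurable (tilt b l) volume := hb.1.mul (by fun_prop)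

theorem integrable_tilt (hb : HasExpMoments b) (l : Rd d) : Integrable (tilt b l) := by
  refine (hb.2 ‖l‖).mono' (hb.aestronglyMeasurable_tilt l) (Eventually.of_forall fun z => ?_)
  rw [tilt, norm_mul, Real.norm_eq_abs, Real.norm_eq_abs, Real.abs_exp]
  exact mul_le_mul_of_nonneg_left (exp_neg_inner_le l z) (abs_nonneg _)

/-- |z_i| ≤ e^‖z‖ is absorbed by the exponential weight. These products are the densities occurring
in the derivative of the tilt. -/
theorem coord_mul (hb : HasExpMoments b) (i : Fin d) : HasExpMoments fun z => z i * b z := by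
  have hm : AEStronglyMeasurable (fun z : Rd d => z i) volume :=
    (by fun_prop : Measurable fun z : Rd d => z i).aestronglyMeasurable
  refine ⟨hm.mul hb.1, fun c => ?_⟩
  refine (hb.2 (c + 1)).mono' ?_ (Eventually.of_forall fun z => ?_)
  · exact (hm.mul hb.1).norm.mul (by fun_prop)
  · rw [norm_mul, Real.norm_eq_abs, Real.norm_eq_abs, Real.abs_exp, abs_abs, abs_mul, add_mul,
      Real.exp_add, one_mul]
    have h1 : |z i| ≤ Real.exp ‖z‖ :=
      (PiLp.norm_apply_le z i).trans ((by linarith [norm_nonneg z] : ‖z‖ ≤ ‖z‖ + 1).trans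
        (Real.add_one_le_exp _))
    calc |z i| * |b z| * Real.exp (c * ‖z‖)
        ≤ Real.exp ‖z‖ * |b z| * Real.exp (c * ‖z‖) := by gcongr
      _ = _ := by ring

/-- The tilted density as an element of `L¹`. -/
noncomputable def tiltL1 (hb : HasExpMoments b) (l : Rd d) : Lp ℝ 1 (volume : Measure (Rd d)) :=
  (hb.integrable_tilt l).toL1

/-- The candidate for the derivative of `l ↦ b e^{-l·z} ∈ L¹`. -/
noncomputable def tiltDeriv (hb : HasExpMoments b) (l : Rd d) :
    Rd d →L[ℝ] Lp ℝ 1 (volume : Measure (Rd d)) :=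
  -∑ i, (EuclideanSpace.proj i : Rd d →L[ℝ] ℝ).smulRight ((hb.coord_mul i).tiltL1 l)

theorem tiltDeriv_ae (hb : HasExpMoments b) (l u : Rd d) :
    ∀ᵐ z, hb.tiltDeriv l u z = -(inner ℝ u z * tilt b l z) := by
  have e : hb.tiltDeriv l u = -∑ i, u i • (hb.coord_mul i).tiltL1 l := by
    simp [tiltDeriv]
  have hsum : ∀ s : Finset (Fin d), ∀ᵐ z,
      (∑ i ∈ s, u i • (hb.coord_mul i).tiltL1 l : Lp ℝ 1 (volume : Measure (Rd d))) z =
        ∑ i ∈ s, u i * (z i * tilt b l z) := by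
    intro s
    induction s using Finset.induction_on with
    | empty =>
      filter_upwards [Lp.coeFn_zero ℝ 1 (volume : Measure (Rd d))] with x hx
      rw [Finset.sum_empty, Finset.sum_empty, hx]
      rfl
    | insert i s hi ih =>
      rw [Finset.sum_insert hi]
      filter_upwards [ih, Lp.coeFn_add (u i • (hb.coord_mul i).tiltL1 l)
        (∑ i ∈ s, u i • (hb.coord_mul i).tiltL1 l), Lp.coeFn_smul (u i) ((hb.coord_mul i).tiltL1 l),
        ((hb.coord_mul i).integrable_tilt l).coeFn_toL1] with z h1 h2 h3 h4
      rw [h2, Pi.add_apply, h1, h3, Finset.sum_insert hi, Pi.smul_apply]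
      have h5 : (hb.coord_mul i).tiltL1 l z = z i * tilt b l z := by
        rw [tiltL1, h4, tilt, tilt, mul_assoc]
      rw [h5, smul_eq_mul]
  rw [e]
  filter_upwards [Lp.coeFn_neg (∑ i, u i • (hb.coord_mul i).tiltL1 l), hsum Finset.univ]
    with z h1 h2
  rw [h1, Pi.neg_apply, h2, PiLp.inner_apply, Finset.sum_mul]
  congr 1
  refine Finset.sum_congr rfl fun i _ => ?_
  simp
  ring

theorem exp_neg_sub_one_add_le (x : ℝ) : |Real.exp (-x) - 1 + x| ≤ x ^ 2 * Real.exp |x| := by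
  have := Complex.norm_exp_sub_sum_le_norm_mul_exp ((-x : ℝ) : ℂ) 2
  rw [Finset.sum_range_succ, Finset.sum_range_one] at this
  simp only [pow_zero, Nat.factorial_zero, Nat.cast_one, div_one, pow_one, Nat.factorial_one] at this
  rw [← Complex.ofReal_exp, ← Complex.ofReal_one, ← Complex.ofReal_add, ← Complex.ofReal_sub,
    Complex.norm_real, Complex.norm_real, Real.norm_eq_abs, Real.norm_eq_abs, abs_neg, sq_abs] at this
  convert this using 2
  ring

/-- Taylor's formula for the exponential, integrated against b: the remainder is O(‖u‖²) in L¹. -/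
theorem hasFDerivAt_tiltL1 (hb : HasExpMoments b) (l : Rd d) :
    HasFDerivAt hb.tiltL1 (hb.tiltDeriv l) l := by
  rw [hasFDerivAt_iff_isLittleO_nhds_zero]
  -- The 3 counts one factor e^‖z‖ from the Taylor remainder with ‖u‖ ≤ 1 and two from ‖z‖² ≤
  -- e^(2‖z‖).
  set C := ∫ z, |b z| * Real.exp ((‖l‖ + 3) * ‖z‖) with hC
  have hint := hb.2 (‖l‖ + 3)
  have hbound : ∀ u : Rd d, ‖u‖ ≤ 1 →
      ‖hb.tiltL1 (l + u) - hb.tiltL1 l - hb.tiltDeriv l u‖ ≤ C * ‖u‖ ^ 2 := by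
    intro u hu
    rw [L1.norm_eq_integral_norm, hC, ← integral_mul_const]
    refine integral_mono_ae (L1.integrable_coeFn _).norm (hint.mul_const _) ?_
    filter_upwards [Lp.coeFn_sub (hb.tiltL1 (l + u) - hb.tiltL1 l) (hb.tiltDeriv l u),
      Lp.coeFn_sub (hb.tiltL1 (l + u)) (hb.tiltL1 l), (hb.integrable_tilt (l + u)).coeFn_toL1,
      (hb.integrable_tilt l).coeFn_toL1, hb.tiltDeriv_ae l u] with z h1 h2 h3 h4 h5
    have e : (hb.tiltL1 (l + u) - hb.tiltL1 l - hb.tiltDeriv l u) z =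
        b z * Real.exp (-inner ℝ l z) * (Real.exp (-inner ℝ u z) - 1 + inner ℝ u z) := by
      rw [h1, Pi.sub_apply, h2, Pi.sub_apply, h5, tiltL1, h3, tiltL1, h4, tilt, tilt,
        inner_add_left, neg_add, Real.exp_add]
      ring
    rw [e, norm_mul, norm_mul, Real.norm_eq_abs, Real.norm_eq_abs, Real.abs_exp, Real.norm_eq_abs]
    have hz := norm_nonneg z
    have i1 : |inner ℝ u z| ≤ ‖u‖ * ‖z‖ := abs_real_inner_le_norm u z
    have i2 : |inner ℝ u z| ≤ ‖z‖ := i1.trans (by nlinarith)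
    have i3 : (inner ℝ u z) ^ 2 ≤ (‖u‖ * ‖z‖) ^ 2 := by
      rw [← sq_abs]; exact pow_le_pow_left₀ (abs_nonneg _) i1 2
    have i4 : ‖z‖ ≤ Real.exp ‖z‖ := by linarith [Real.add_one_le_exp ‖z‖]
    calc |b z| * Real.exp (-inner ℝ l z) * |Real.exp (-inner ℝ u z) - 1 + inner ℝ u z|
        ≤ |b z| * Real.exp (‖l‖ * ‖z‖) * ((inner ℝ u z) ^ 2 * Real.exp |inner ℝ u z|) := by
          gcongr
          · exact Real.exp_le_exp.1 (exp_neg_inner_le l z)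
          · exact exp_neg_sub_one_add_le _
      _ ≤ |b z| * Real.exp (‖l‖ * ‖z‖) * ((‖u‖ * ‖z‖) ^ 2 * Real.exp ‖z‖) := by gcongr
      _ ≤ |b z| * Real.exp (‖l‖ * ‖z‖) * ((‖u‖ * Real.exp ‖z‖) ^ 2 * Real.exp ‖z‖) := by gcongr
      _ = |b z| * Real.exp ((‖l‖ + 3) * ‖z‖) * ‖u‖ ^ 2 := by
          rw [show (‖l‖ + 3) * ‖z‖ = ‖l‖ * ‖z‖ + ‖z‖ + ‖z‖ + ‖z‖ by ring, Real.exp_add,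
            Real.exp_add, Real.exp_add]
          ring
  have hO : (fun u : Rd d => hb.tiltL1 (l + u) - hb.tiltL1 l - hb.tiltDeriv l u) =O[𝓝 0]
      fun u => ‖u‖ ^ 2 := by
    refine Asymptotics.IsBigO.of_bound C ?_
    filter_upwards [Metric.closedBall_mem_nhds (0 : Rd d) one_pos] with u hu
    rw [norm_pow, norm_norm]
    exact hbound u (by simpa using hu)
  exact hO.trans_isLittleO (Asymptotics.isLittleO_norm_pow_id one_lt_two)

/-- The induction runs over all b at once, because the derivative of the tilt of b is assembled from
tilts of the densities z_i b. -/
theorem contDiff_tiltL1 (n : ℕ) : ∀ {b : Rd d → ℝ} (hb : HasExpMoments b),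
    ContDiff ℝ n hb.tiltL1 := by
  induction n with
  | zero =>
    intro b hb
    exact contDiff_zero.2 (continuous_iff_continuousAt.2 fun l =>
      (hb.hasFDerivAt_tiltL1 l).continuousAt)
  | succ n ih =>
    intro b hb
    rw [Nat.cast_succ, contDiff_succ_iff_hasFDerivAt]
    refine ⟨hb.tiltDeriv, ?_, hb.hasFDerivAt_tiltL1⟩
    refine (ContDiff.sum fun i _ => ?_).neg
    exact (ContinuousLinearMap.smulRightL ℝ (Rd d) (Lp ℝ 1 (volume : Measure (Rd d)))
      (EuclideanSpace.proj i)).contDiff.comp (ih (hb.coord_mul i))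

end HasExpMoments

end Skewed

/-! ### Perron–Frobenius theory applied to the skewed operator -/

section Perron

open Filter Topology
open scoped ENNReal NNReal

variable {d : ℕ} {a : Rd d → ℝ} {Λ : Rd d → Rd d → ℝ}

/-- The jump rate as a function on the torus. -/
noncomputable def torusRate (a : Rd d → ℝ) (Λ : Rd d → Rd d → ℝ) (ξ : Td d) : ℝ :=
  jumpRate a Λ (cellRep ξ)

namespace IsPeriodicJumpKernel

theorem hasExpMoments (h : IsPeriodicJumpKernel a Λ) : HasExpMoments a := by
  refine ⟨h.integrable.aestronglyMeasurable, fun c => ?_⟩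
  simpa only [abs_of_nonneg (h.nonneg _)] using h.integrable_mul_exp c

theorem memLp_torusRate (h : IsPeriodicJumpKernel a Λ) :
    MemLp (fun ξ => (torusRate a Λ ξ : ℂ)) ∞ (volume : Measure (Td d)) := by
  obtain ⟨B, -, hB⟩ := h.exists_jumpRate_bound
  refine memLp_top_of_bound
    (Complex.continuous_ofReal.comp_aestronglyMeasurable h.aestronglyMeasurable_jumpRate) B ?_
  refine Eventually.of_forall fun ξ => ?_
  rw [Complex.norm_real]
  exact hB ξ

theorem ae_gMin_le (h : IsPeriodicJumpKernel a Λ) : ∀ᵐ ξ, gMin a Λ ≤ torusRate a Λ ξ := by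
  obtain ⟨B, -, hB⟩ := h.exists_jumpRate_bound
  refine ae_essInf_le ⟨-B, ?_⟩
  rw [eventually_map]
  exact Eventually.of_forall fun ξ => (abs_le.1 (hB ξ)).1

/-- The integral part of the skewed operator. -/
noncomputable def jumpOp (h : IsPeriodicJumpKernel a Λ) (l : Rd d) : L2Td d →L[ℂ] L2Td d :=
  h.isBoundedWeight.shiftOp (h.hasExpMoments.tiltL1 l)

theorem jumpOp_ae (h : IsPeriodicJumpKernel a Λ) (l : Rd d) (v : L2Td d) :
    ∀ᵐ ξ, h.jumpOp l v ξ = ∫ z, (shiftKernel a Λ l ξ z : ℂ) * v (ξ - toTorus z) := by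
  filter_upwards [h.isBoundedWeight.shiftOp_toL1_ae (h.hasExpMoments.integrable_tilt l) v] with ξ hξ
  simp only [shiftKernel_eq]
  exact hξ

theorem skewedOperator_eq (h : IsPeriodicJumpKernel a Λ) (l : Rd d) :
    skewedOperator h l = h.jumpOp l - mulOp _ h.memLp_torusRate := by
  ext1 v
  refine Lp.ext ?_
  rw [sub_apply]
  filter_upwards [skewedOperator_ae_eq h l v, h.jumpOp_ae l v, mulOp_ae _ h.memLp_torusRate v,
    Lp.coeFn_sub (h.jumpOp l v) (mulOp _ h.memLp_torusRate v)] with ξ h1 h2 h3 h4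
  rw [h1, h4, Pi.sub_apply, h2, h3, skewedFormula_cellRep, torusRate]

theorem tiltL1_nonneg (h : IsPeriodicJumpKernel a Λ) (l : Rd d) :
    ∀ᵐ z, 0 ≤ h.hasExpMoments.tiltL1 l z := by
  filter_upwards [(h.hasExpMoments.integrable_tilt l).coeFn_toL1] with z hz
  rw [HasExpMoments.tiltL1, hz]
  exact mul_nonneg (h.nonneg z) (Real.exp_pos _).le

theorem volume_tiltL1_pos (h : IsPeriodicJumpKernel a Λ) (l : Rd d) :
    volume {z | 0 < h.hasExpMoments.tiltL1 l z} ≠ 0 := by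
  intro h0
  have h1 : ∀ᵐ z, ¬ 0 < h.hasExpMoments.tiltL1 l z := measure_eq_zero_iff_ae_notMem.1 h0
  have h2 : ∀ᵐ z, a z = 0 := by
    filter_upwards [h1, (h.hasExpMoments.integrable_tilt l).coeFn_toL1] with z hz1 hz2
    rw [HasExpMoments.tiltL1, hz2, tilt, not_lt] at hz1
    exact le_antisymm (nonpos_of_mul_nonpos_left hz1 (Real.exp_pos _)) (h.nonneg z)
  have h3 := h.integral_eq_one
  rw [integral_congr_ae h2, integral_zero] at h3
  exact zero_ne_one h3

instance nontrivial_L2Td' : Nontrivial (L2Td d) := nontrivial_L2Td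

theorem perronData (h : IsPeriodicJumpKernel a Λ) {l : Rd d} (hl : l ∈ GammaSet h) :
    PerronData (h.jumpOp l) (torusRate a Λ) (gMin a Λ) (theta h l) where
  compact := h.isBoundedWeight.isCompactOperator_shiftOp _
  pos := h.isBoundedWeight.isPositiveOp_shiftOp (fun ξ z => (h.jumpWeight_pos ξ z).le)
    (h.tiltL1_nonneg l)
  irred := h.isBoundedWeight.isIrreducibleOp_shiftOp h.jumpWeight_pos (h.tiltL1_nonneg l)
    (h.volume_tiltL1_pos l)
  memLp := h.memLp_torusRate
  le := h.ae_gMin_le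
  isGreatest := by
    rw [theta, spectralBound, ← h.skewedOperator_eq]
    exact isGreatest_sSup_re_spectrum _
  lt := hl

theorem exists_perronPair (h : IsPeriodicJumpKernel a Λ) {l : Rd d} (hl : l ∈ GammaSet h) :
    ∃ v ψ, PerronPair (skewedOperator h l) (theta h l) v ψ := by
  rw [h.skewedOperator_eq]
  exact (h.perronData hl).exists_perronPair

theorem isPrincipalEigenvalue (h : IsPeriodicJumpKernel a Λ) {l : Rd d} (hl : l ∈ GammaSet h) :
    IsPrincipalEigenvalue (skewedOperator h l) (theta h l) := by
  obtain ⟨v, ψ, hp⟩ := h.exists_perronPair hl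
  have hgr : IsGreatest (Complex.re '' spectrum ℂ (skewedOperator h l)) (theta h l) :=
    isGreatest_sSup_re_spectrum _
  refine ⟨?_, fun z hz hne => lt_of_le_of_ne (hgr.2 ⟨z, hz, rfl⟩) fun he => hne ?_⟩
  · refine Module.End.hasEigenvalue_of_hasEigenvector (x := v)
      ⟨Module.End.mem_eigenspace_iff.2 hp.eigen, fun h0 => ?_⟩
    have := hp.inner_eq_one
    rw [h0, inner_zero_right] at this
    exact zero_ne_one this
  · have hp' := hp.eigen'
    rw [h.skewedOperator_eq] at hp' hz
    exact (h.perronData hl).eq_of_re_eq hp.pos' hp' hz he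

/-- The integral part depends smoothly on the tilt. -/
theorem contDiff_jumpOp (h : IsPeriodicJumpKernel a Λ) (n : ℕ) : ContDiff ℝ n h.jumpOp :=
  h.isBoundedWeight.shiftOp.contDiff.comp (h.hasExpMoments.contDiff_tiltL1 n)

theorem contDiff_skewedOperator (h : IsPeriodicJumpKernel a Λ) (n : ℕ) :
    ContDiff ℝ n (skewedOperator h) := by
  have : skewedOperator h = fun l => h.jumpOp l - mulOp _ h.memLp_torusRate :=
    funext h.skewedOperator_eq
  rw [this]
  exact (h.contDiff_jumpOp n).sub contDiff_const

end IsPeriodicJumpKernel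

end Perron

/-! ### Smooth perturbation of a simple eigenvalue -/

section Perturbation

open Filter Topology

variable {X : Type*} [NormedAddCommGroup X] [NormedSpace ℝ X] [CompleteSpace X]
  {H : Type*} [NormedAddCommGroup H] [NormedSpace ℂ H] [CompleteSpace H]

/-- Smooth perturbation of a simple isolated eigenvalue, normalized by a functional `φ`. -/
theorem exists_smooth_eigenpair {A : X → H →L[ℂ] H} {x₀ : X} {n : ℕ} (hn : n ≠ 0)
    (hA : ContDiffAt ℝ n A x₀) {φ : H →L[ℂ] ℂ} {v₀ : H} {s : ℂ} (hv : A x₀ v₀ = s • v₀)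
    (hφ : φ v₀ = 1) (hunit : IsUnit (A x₀ - s • (1 : H →L[ℂ] H) - φ.smulRight v₀)) :
    ∃ (m : X → ℂ) (u : X → H), ContDiffAt ℝ n m x₀ ∧ ContDiffAt ℝ n u x₀ ∧ m x₀ = s ∧ u x₀ = v₀ ∧
      (∀ᶠ x in 𝓝 x₀, A x (u x) = m x • u x ∧ φ (u x) = 1) ∧
      ∀ᶠ p in 𝓝 (x₀, s), ∀ v, A p.1 v = p.2 • v → φ v = 1 → p.2 = m p.1 ∧ v = u p.1 := by
  -- Where S is invertible, w = -S⁻¹v₀ is the unique solution of (A - μ)w = (φ(w) - 1)v₀. So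
  -- eigenvectors normalized by φ = 1 correspond exactly to zeros of the scalar function E = φ(w) -
  -- 1.
  set S : X × ℂ → H →L[ℂ] H := fun p => A p.1 - p.2 • (1 : H →L[ℂ] H) - φ.smulRight v₀ with hS
  have hScd : ContDiffAt ℝ n S (x₀, s) := by
    refine ((ContDiffAt.comp (x₀, s) (g := A) hA contDiffAt_fst).sub ?_).sub contDiffAt_const
    exact contDiffAt_snd.smul contDiffAt_const
  have hSu : ∀ᶠ p in 𝓝 (x₀, s), IsUnit (S p) :=
    hScd.continuousAt.eventually (Units.isOpen.mem_nhds hunit)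
  set w : X × ℂ → H := fun p => -(Ring.inverse (S p) v₀) with hw
  have hwcd : ContDiffAt ℝ n w (x₀, s) := by
    obtain ⟨U, hU⟩ := hunit
    have h1 : ContDiffAt ℝ n (fun p => Ring.inverse (S p)) (x₀, s) := by
      refine ContDiffAt.comp (x₀, s) (g := Ring.inverse) ?_ hScd
      have := contDiffAt_ringInverse ℝ (n := n) U
      rwa [hU] at this
    have h2 : ContDiff ℝ n fun T : H →L[ℂ] H => T v₀ :=
      ((ContinuousLinearMap.apply ℂ H v₀).restrictScalars ℝ).contDiff
    exact (h2.contDiffAt.comp (x₀, s) h1).neg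
  set E : X × ℂ → ℂ := fun p => φ (w p) - 1 with hE
  have hEcd : ContDiffAt ℝ n E (x₀, s) :=
    ((φ.restrictScalars ℝ).contDiff.contDiffAt.comp (x₀, s) hwcd).sub contDiffAt_const
  have hSw : ∀ p, IsUnit (S p) → S p (w p) = -v₀ := by
    intro p hp
    have h1 : S p (Ring.inverse (S p) v₀) = (S p * Ring.inverse (S p) : H →L[ℂ] H) v₀ := rfl
    rw [hw, map_neg, h1, Ring.mul_inverse_cancel _ hp, one_apply_eq_self]
  have huniq : ∀ p, IsUnit (S p) → ∀ v, S p v = -v₀ → v = w p := by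
    intro p hp v hv'
    have h1 : Ring.inverse (S p) (S p v) = (Ring.inverse (S p) * S p : H →L[ℂ] H) v := rfl
    rw [hv', Ring.inverse_mul_cancel _ hp, one_apply_eq_self, map_neg] at h1
    exact h1.symm
  have hSapp : ∀ p v, S p v = A p.1 v - p.2 • v - φ v • v₀ := by
    intro p v
    simp [hS]
  -- Over x₀ the solution is explicit, hence ∂E/∂μ = -1 at the base point, and the implicit function
  -- theorem can solve E = 0 for μ.
  have hbase : ∀ᶠ μ in 𝓝 s, w (x₀, μ) = (1 + (μ - s))⁻¹ • v₀ := by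
    have h1 : ∀ᶠ μ in 𝓝 s, IsUnit (S (x₀, μ)) :=
      (Continuous.prodMk_right x₀).continuousAt.eventually hSu
    have h2 : ∀ᶠ μ in 𝓝 s, 1 + (μ - s) ≠ 0 := by
      have : ContinuousAt (fun μ : ℂ => 1 + (μ - s)) s := by fun_prop
      refine this.eventually_ne ?_
      simp
    filter_upwards [h1, h2] with μ hμ hμ0
    refine (huniq _ hμ _ ?_).symm
    rw [hSapp, map_smul, map_smul, hv, hφ, smul_eq_mul, mul_one, smul_comm, smul_smul, smul_smul,
      ← sub_smul, ← sub_smul, ← neg_one_smul ℂ v₀]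
    congr 1
    field_simp
    ring
  have hws : w (x₀, s) = v₀ := by simpa using hbase.self_of_nhds
  have hE0 : E (x₀, s) = 0 := by simp [hE, hws, hφ]
  have hn' : ((n : ℕ) : WithTop ℕ∞) ≠ 0 := by exact_mod_cast hn
  have hder : fderiv ℝ E (x₀, s) ∘L .inr ℝ X ℂ = -ContinuousLinearMap.id ℝ ℂ := by
    have h1 : HasFDerivAt (fun μ : ℂ => E (x₀, μ)) (fderiv ℝ E (x₀, s) ∘L .inr ℝ X ℂ) s :=
      HasFDerivAt.comp s (hEcd.differentiableAt hn').hasFDerivAt (hasFDerivAt_prodMk_right x₀ s)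
    have h2 : HasDerivAt (fun μ : ℂ => (1 + (μ - s))⁻¹ - 1) (-1) s := by
      have := ((((hasDerivAt_id s).sub_const s).const_add 1).inv (by simp)).sub_const 1
      simpa using this
    have h3 : HasFDerivAt (fun μ : ℂ => E (x₀, μ)) (-ContinuousLinearMap.id ℝ ℂ) s := by
      refine ((h2.hasFDerivAt.restrictScalars ℝ).congr_of_eventuallyEq ?_).congr_fderiv ?_
      · filter_upwards [hbase] with μ hμ
        simp [hE, hμ, hφ]
      · ext
        simp
    exact h1.unique h3
  have hinv : (fderiv ℝ E (x₀, s) ∘L .inr ℝ X ℂ).IsInvertible := by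
    rw [hder]
    exact ⟨ContinuousLinearEquiv.neg ℝ, by ext; simp⟩
  set m := hEcd.implicitFunction hn' hinv with hm
  have hm0 : m x₀ = s := hEcd.implicitFunction_apply_self hn' hinv
  have hmcd : ContDiffAt ℝ n m x₀ := hEcd.contDiffAt_implicitFunction hn' hinv
  have hpair : ContDiffAt ℝ n (fun x => (x, m x)) x₀ := contDiffAt_id.prodMk hmcd
  have hpair0 : Tendsto (fun x => (x, m x)) (𝓝 x₀) (𝓝 (x₀, s)) := by
    have := hpair.continuousAt
    rw [ContinuousAt, hm0] at this
    exact this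
  refine ⟨m, fun x => w (x, m x), hmcd, ?_, hm0, by simp only [hm0, hws], ?_, ?_⟩
  · refine ContDiffAt.comp x₀ (g := w) ?_ hpair
    rwa [hm0]
  · filter_upwards [hEcd.eventually_apply_implicitFunction hn' hinv, hpair0.eventually hSu]
      with x h1 h2
    rw [hE0, ← hm] at h1
    have h3 : φ (w (x, m x)) = 1 := sub_eq_zero.1 h1
    have h4 := hSw _ h2
    rw [hSapp, h3, one_smul] at h4
    exact ⟨sub_eq_zero.1 (by simpa using congrArg (· + v₀) h4), h3⟩
  · filter_upwards [hSu, hEcd.eventually_apply_eq_iff_implicitFunction hn' hinv]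
      with p h1 h2 v hv1 hv2
    have h3 : v = w p := huniq p h1 v (by rw [hSapp, hv1, hv2, sub_self, one_smul, zero_sub])
    have h4 : m p.1 = p.2 := h2.1 (by rw [hE0, hE]; simp only; rw [← h3, hv2, sub_self])
    refine ⟨h4.symm, ?_⟩
    rw [h4]
    exact h3

end Perturbation

/-! ### Openness of Γ and smoothness of θ -/

section ThetaRegularity

open Filter Topology

variable {d : ℕ} {a : Rd d → ℝ} {Λ : Rd d → Rd d → ℝ}

namespace IsPeriodicJumpKernel

/-- The rank-one term keeps the integral part compact, so injectivity suffices. If (A - θ)f = ⟨ψ,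
f⟩v, pairing with ψ gives ⟨ψ, f⟩ = 0, and simplicity gives f = 0. -/
theorem isUnit_sub_rankOne (h : IsPeriodicJumpKernel a Λ) {l : Rd d} (hl : l ∈ GammaSet h)
    {v ψ : L2Td d} (hp : PerronPair (skewedOperator h l) (theta h l) v ψ) :
    IsUnit (skewedOperator h l - (theta h l : ℂ) • (1 : L2Td d →L[ℂ] L2Td d) -
      (innerSL ℂ ψ).smulRight v) := by
  have hd := h.perronData hl
  have e : skewedOperator h l - (theta h l : ℂ) • (1 : L2Td d →L[ℂ] L2Td d) -
      (innerSL ℂ ψ).smulRight v = (h.jumpOp l - (innerSL ℂ ψ).smulRight v) -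
        mulOp _ (memLp_top_add_const hd.memLp (theta h l : ℂ)) := by
    rw [mulOp_add_const hd.memLp, h.skewedOperator_eq]
    abel
  have hC : IsCompactOperator (h.jumpOp l - (innerSL ℂ ψ).smulRight v) := by
    refine hd.compact.sub ?_
    have : (innerSL ℂ ψ).smulRight v = ((1 : ℂ →L[ℂ] ℂ).smulRight v) ∘L (innerSL ℂ ψ) := by
      ext1 w
      simp
    rw [this]
    exact (isCompactOperator_of_locallyCompactSpace_rng
      ((1 : ℂ →L[ℂ] ℂ).smulRight v)).comp_clm _
  rw [e]
  refine hd.isUnit_of_injective hC (by simpa using hd.lt) fun f hf => ?_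
  have h1 : skewedOperator h l f - (theta h l : ℂ) • f = (inner ℂ ψ f : ℂ) • v := by
    rw [← sub_eq_zero]
    have h2 := DFunLike.congr_fun e f
    rw [← sub_eq_zero, ← sub_apply] at hf
    rw [hf, sub_apply, sub_apply, smul_apply, one_apply_eq_self] at h2
    exact h2
  have h2 : (inner ℂ ψ f : ℂ) = 0 := by
    have := inner_sub_smul_eq_zero hp.eigen' f
    rwa [h1, inner_smul_right, hp.inner_eq_one, mul_one] at this
  rw [h2, zero_smul, sub_eq_zero] at h1
  exact hp.simple f h1 h2

theorem re_le_theta (h : IsPeriodicJumpKernel a Λ) {l : Rd d} {z : ℂ}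
    (hz : z ∈ spectrum ℂ (skewedOperator h l)) : z.re ≤ theta h l :=
  (isGreatest_sSup_re_spectrum (skewedOperator h l)).2 ⟨z, hz, rfl⟩

theorem re_le_theta_of_eigen (h : IsPeriodicJumpKernel a Λ) {l : Rd d} {z : ℂ} {v : L2Td d}
    (hv : v ≠ 0) (hz : skewedOperator h l v = z • v) : z.re ≤ theta h l := by
  refine h.re_le_theta ?_
  rw [spectrum.mem_iff]
  intro hu
  obtain ⟨U, hU⟩ := hu
  apply hv
  have h1 : (algebraMap ℂ (L2Td d →L[ℂ] L2Td d) z - skewedOperator h l) v = 0 := by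
    rw [sub_apply, hz, Algebra.algebraMap_eq_smul_one, smul_apply, one_apply_eq_self, sub_self]
  rw [← hU] at h1
  have h2 := congrArg (↑U⁻¹ : L2Td d →L[ℂ] L2Td d) h1
  rwa [← mul_apply_eq_comp, Units.inv_mul, one_apply_eq_self, map_zero] at h2

/-- Upper semicontinuity of the spectrum under norm perturbations: it stays inside the open
half-plane Re z < c. -/
theorem eventually_theta_lt (h : IsPeriodicJumpKernel a Λ) (l₀ : Rd d) {c : ℝ}
    (hc : theta h l₀ < c) : ∀ᶠ l in 𝓝 l₀, theta h l < c := by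
  have hcont : Continuous (skewedOperator h) := (h.contDiff_skewedOperator 0).continuous
  have h1 := (upperHemicontinuous_spectrum ℂ (L2Td d →L[ℂ] L2Td d)).comp hcont
  have h2 := (h1.upperHemicontinuousAt l₀).forall_isOpen {z : ℂ | z.re < c}
    (isOpen_lt Complex.continuous_re continuous_const)
    fun z hz => (h.re_le_theta hz).trans_lt hc
  filter_upwards [h2] with l hl
  obtain ⟨z, hz, hze⟩ := (isGreatest_sSup_re_spectrum (skewedOperator h l)).1
  have : z.re = theta h l := hze
  rw [← this]
  exact hl hz

/-- Near a point of `Γ` the principal eigenvalue and its eigenfunction depend smoothly on the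
parameter. -/
theorem exists_smooth_eigenfunction (h : IsPeriodicJumpKernel a Λ) {l₀ : Rd d}
    (hl₀ : l₀ ∈ GammaSet h) {v ψ : L2Td d}
    (hp : PerronPair (skewedOperator h l₀) (theta h l₀) v ψ) {n : ℕ} (hn : n ≠ 0) :
    ∃ u : Rd d → L2Td d, ContDiffAt ℝ n u l₀ ∧ u l₀ = v ∧ ContDiffAt ℝ n (theta h) l₀ ∧
      ∀ᶠ l in 𝓝 l₀, l ∈ GammaSet h ∧ skewedOperator h l (u l) = (theta h l : ℂ) • u l ∧
        inner ℂ ψ (u l) = 1 ∧ ∀ᵐ ξ, 0 < (u l ξ).re ∧ (u l ξ).im = 0 := by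
  obtain ⟨m, u, hm, hu, hm0, hu0, hev, huniq⟩ := exists_smooth_eigenpair hn
    (h.contDiff_skewedOperator n).contDiffAt (φ := innerSL ℂ ψ) hp.eigen
    (by simpa using hp.inner_eq_one) (h.isUnit_sub_rankOne hl₀ hp)
  have hre : ContDiffAt ℝ n (fun l => (m l).re) l₀ :=
    Complex.reCLM.contDiff.contDiffAt.comp l₀ hm
  have hlow : ∀ᶠ l in 𝓝 l₀, (m l).re ≤ theta h l := by
    filter_upwards [hev] with l hl
    refine h.re_le_theta_of_eigen (fun h0 => ?_) hl.1
    have := hl.2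
    rw [h0, map_zero] at this
    exact zero_ne_one this
  have hre0 : (m l₀).re = theta h l₀ := by rw [hm0, Complex.ofReal_re]
  -- The perturbed eigenvalue m bounds θ from below; semicontinuity of the spectrum bounds it from
  -- above.
  have hcont : Tendsto (theta h) (𝓝 l₀) (𝓝 (theta h l₀)) := by
    refine tendsto_order.2 ⟨fun c hc => ?_, fun c hc => h.eventually_theta_lt l₀ hc⟩
    filter_upwards [hlow, hre.continuousAt.eventually (lt_mem_nhds (by rwa [hre0] : c < (m l₀).re))]
      with l h1 h2
    exact h2.trans_le h1
  have hΓ : ∀ᶠ l in 𝓝 l₀, l ∈ GammaSet h := hcont.eventually (lt_mem_nhds hl₀)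
  have hpair : Tendsto (fun l => (l, (theta h l : ℂ))) (𝓝 l₀) (𝓝 (l₀, (theta h l₀ : ℂ))) :=
    tendsto_id.prodMk_nhds ((Complex.continuous_ofReal.tendsto _).comp hcont)
  -- Nearby l lie in Γ and have their own positive eigenvector w. It can be normalized against ψ
  -- since ⟨ψ, w⟩ > 0, and local uniqueness of normalized eigenpairs then gives θ = m and u > 0.
  have hmain : ∀ᶠ l in 𝓝 l₀, l ∈ GammaSet h ∧ (theta h l : ℂ) = m l ∧
      inner ℂ ψ (u l) = 1 ∧ ∀ᵐ ξ, 0 < (u l ξ).re ∧ (u l ξ).im = 0 := by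
    filter_upwards [hΓ, hpair.eventually huniq, hev] with l h1 h2 h3
    obtain ⟨w, χ, hw⟩ := h.exists_perronPair h1
    obtain ⟨r, hr, hrw⟩ := inner_pos_of_pos hp.pos' hw.pos
    have h4 := h2 (((r⁻¹ : ℝ) : ℂ) • w) (by rw [map_smul, hw.eigen, smul_comm]) (by
      rw [innerSL_apply_apply, inner_smul_right, hrw, ← Complex.ofReal_mul, inv_mul_cancel₀ hr.ne',
        Complex.ofReal_one])
    refine ⟨h1, h4.1, by simpa using h3.2, ?_⟩
    rw [← h4.2]
    filter_upwards [hw.pos, Lp.coeFn_smul ((r⁻¹ : ℝ) : ℂ) w] with x a b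
    rw [b, Pi.smul_apply, smul_eq_mul, Complex.re_ofReal_mul, Complex.im_ofReal_mul, a.2, mul_zero]
    exact ⟨mul_pos (inv_pos.2 hr) a.1, rfl⟩
  refine ⟨u, hu, hu0, hre.congr_of_eventuallyEq ?_, ?_⟩
  · filter_upwards [hmain] with l hl
    rw [← hl.2.1, Complex.ofReal_re]
  · filter_upwards [hmain, hev] with l h1 h2
    refine ⟨h1.1, ?_, h1.2.2⟩
    rw [h1.2.1]
    exact h2.1

theorem isOpen_GammaSet (h : IsPeriodicJumpKernel a Λ) : IsOpen (GammaSet h) := by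
  refine isOpen_iff_mem_nhds.2 fun l hl => ?_
  obtain ⟨v, ψ, hp⟩ := h.exists_perronPair hl
  obtain ⟨u, -, -, -, hu⟩ := h.exists_smooth_eigenfunction hl hp one_ne_zero
  filter_upwards [hu] with l' hl'
  exact hl'.1

theorem contDiffAt_theta (h : IsPeriodicJumpKernel a Λ) {l : Rd d} (hl : l ∈ GammaSet h) {n : ℕ}
    (hn : n ≠ 0) : ContDiffAt ℝ n (theta h) l := by
  obtain ⟨v, ψ, hp⟩ := h.exists_perronPair hl
  obtain ⟨u, -, -, hu, -⟩ := h.exists_smooth_eigenfunction hl hp hn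
  exact hu

end IsPeriodicJumpKernel

end ThetaRegularity

/-! ### The Jensen gap, geometric means and real forms of the eigenvalue equation -/

section Convexity

open Filter Topology
open scoped ENNReal NNReal

/-- The gap in the convexity inequality of the exponential. -/
noncomputable def expGap (t x y : ℝ) : ℝ :=
  t * Real.exp x + (1 - t) * Real.exp y - Real.exp (t * x + (1 - t) * y)

theorem expGap_nonneg {t : ℝ} (ht0 : 0 ≤ t) (ht1 : t ≤ 1) (x y : ℝ) : 0 ≤ expGap t x y := by
  have := convexOn_exp.2 (Set.mem_univ x) (Set.mem_univ y) ht0 (sub_nonneg.2 ht1) (by ring)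
  simp only [smul_eq_mul] at this
  exact sub_nonneg.2 this

theorem eq_of_expGap_eq_zero {t : ℝ} (ht0 : 0 < t) (ht1 : t < 1) {x y : ℝ}
    (h : expGap t x y = 0) : x = y := by
  by_contra hne
  have := strictConvexOn_exp.2 (Set.mem_univ x) (Set.mem_univ y) hne ht0 (sub_pos.2 ht1) (by ring)
  simp only [smul_eq_mul] at this
  exact (sub_pos.2 this).ne' h

/-- The perfect square reduces second-order asymptotics of the gap to a first-order difference
quotient. -/
theorem expGap_half (x y : ℝ) :
    expGap (1 / 2) x y = (Real.exp (x / 2) - Real.exp (y / 2)) ^ 2 / 2 := by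
  have h1 : Real.exp x = Real.exp (x / 2) * Real.exp (x / 2) := by
    rw [← Real.exp_add]; congr 1; ring
  have h2 : Real.exp y = Real.exp (y / 2) * Real.exp (y / 2) := by
    rw [← Real.exp_add]; congr 1; ring
  have h3 : Real.exp (1 / 2 * x + (1 - 1 / 2) * y) = Real.exp (x / 2) * Real.exp (y / 2) := by
    rw [← Real.exp_add]; congr 1; ring
  rw [expGap, h1, h2, h3]
  ring

variable {d : ℕ} {a : Rd d → ℝ} {Λ : Rd d → Rd d → ℝ}

theorem ae_prod_fst {P : Td d → Prop} (hP : ∀ᵐ ξ, P ξ) :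
    ∀ᵐ p : Td d × Rd d ∂(volume : Measure (Td d)).prod volume, P p.1 :=
  Measure.quasiMeasurePreserving_fst.ae hP

theorem ae_prod_shift {P : Td d → Prop} (hP : ∀ᵐ ξ, P ξ) :
    ∀ᵐ p : Td d × Rd d ∂(volume : Measure (Td d)).prod volume, P (p.1 - toTorus p.2) := by
  have hm : Measurable fun p : Td d × Rd d => p.1 - toTorus p.2 :=
    measurable_fst.sub (measurable_toTorus.comp measurable_snd)
  refine Measure.QuasiMeasurePreserving.ae ⟨hm, ?_⟩ hP
  refine Measure.AbsolutelyContinuous.mk fun s hs hs0 => ?_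
  rw [Measure.map_apply hm hs, Measure.measure_prod_null (hm hs)]
  filter_upwards [IsBoundedWeight.ae_shift_of_ae (measure_eq_zero_iff_ae_notMem.1 hs0)] with ξ hξ
  exact measure_eq_zero_iff_ae_notMem.2 hξ

/-- `-c·z + log u (ξ - z) - log u ξ`. -/
noncomputable def logIncrement (c : Rd d) (u : Td d → ℂ) (ξ : Td d) (z : Rd d) : ℝ :=
  -inner ℝ c z + Real.log (u (ξ - toTorus z)).re - Real.log (u ξ).re

theorem measurable_logIncrement (c : Rd d) {u : Td d → ℂ} (hu : Measurable u) :
    Measurable fun p : Td d × Rd d => logIncrement c u p.1 p.2 := by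
  have h1 : Measurable fun p : Td d × Rd d => inner ℝ c p.2 := by fun_prop
  have h2 : Measurable fun p : Td d × Rd d => Real.log (u (p.1 - toTorus p.2)).re :=
    Real.measurable_log.comp (Complex.measurable_re.comp
      (hu.comp (measurable_fst.sub (measurable_toTorus.comp measurable_snd))))
  have h3 : Measurable fun p : Td d × Rd d => Real.log (u p.1).re :=
    Real.measurable_log.comp (Complex.measurable_re.comp (hu.comp measurable_fst))
  exact (h1.neg.add h2).sub h3

/-- The geometric mean of two positive functions. -/
noncomputable def geomMean (t : ℝ) (u₁ u₂ : Td d → ℂ) (ξ : Td d) : ℝ :=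
  Real.exp (t * Real.log (u₁ ξ).re + (1 - t) * Real.log (u₂ ξ).re)

theorem geomMean_le {t : ℝ} (ht0 : 0 ≤ t) (ht1 : t ≤ 1) {u₁ u₂ : Td d → ℂ} {ξ : Td d}
    (h₁ : 0 < (u₁ ξ).re) (h₂ : 0 < (u₂ ξ).re) :
    geomMean t u₁ u₂ ξ ≤ t * (u₁ ξ).re + (1 - t) * (u₂ ξ).re := by
  have := expGap_nonneg ht0 ht1 (Real.log (u₁ ξ).re) (Real.log (u₂ ξ).re)
  rw [expGap, Real.exp_log h₁, Real.exp_log h₂] at this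
  exact sub_nonneg.1 this

theorem measurable_geomMean (t : ℝ) {u₁ u₂ : Td d → ℂ} (h₁ : Measurable u₁) (h₂ : Measurable u₂) :
    Measurable (geomMean t u₁ u₂) := by
  unfold geomMean
  fun_prop

theorem exists_geomMean {t : ℝ} (ht0 : 0 ≤ t) (ht1 : t ≤ 1) {u₁ u₂ : L2Td d}
    (h₁ : ∀ᵐ ξ, 0 < (u₁ ξ).re ∧ (u₁ ξ).im = 0) (h₂ : ∀ᵐ ξ, 0 < (u₂ ξ).re ∧ (u₂ ξ).im = 0) :
    ∃ u : L2Td d, ∀ᵐ ξ, u ξ = (geomMean t u₁ u₂ ξ : ℂ) := by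
  have hmem : MemLp (fun ξ => (geomMean t u₁ u₂ ξ : ℂ)) 2 (volume : Measure (Td d)) := by
    refine ((((Lp.memLp u₁).norm.const_mul t)).add ((Lp.memLp u₂).norm.const_mul (1 - t))).mono'
      ?_ ?_
    · exact (Complex.measurable_ofReal.comp (measurable_geomMean t
        (Lp.stronglyMeasurable u₁).measurable
        (Lp.stronglyMeasurable u₂).measurable)).aestronglyMeasurable
    · filter_upwards [h₁, h₂] with ξ a b
      rw [Complex.norm_real, Real.norm_eq_abs, geomMean, abs_of_pos (Real.exp_pos _)]
      refine (geomMean_le ht0 ht1 a.1 b.1).trans ?_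
      simp only [Pi.add_apply]
      have := sub_nonneg.2 ht1
      gcongr
      · exact Complex.re_le_norm _
      · exact Complex.re_le_norm _
  exact ⟨hmem.toLp, hmem.coeFn_toLp⟩

/-- The inner product of real elements of `L²`. -/
theorem inner_eq_integral_re {α : Type*} [MeasurableSpace α] {μ : Measure α} {f g : Lp ℂ 2 μ}
    (hf : ∀ᵐ x ∂μ, (f x).im = 0) (hg : ∀ᵐ x ∂μ, (g x).im = 0) :
    Integrable (fun x => (f x).re * (g x).re) μ ∧
      inner ℂ f g = ((∫ x, (f x).re * (g x).re ∂μ : ℝ) : ℂ) := by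
  constructor
  · refine (integrable_conj_mul f g).re.congr ?_
    filter_upwards [hf, hg] with x h1 h2
    simp [h1, h2]
  · rw [inner_L2_eq, ← integral_complex_ofReal]
    refine integral_congr_ae ?_
    filter_upwards [hf, hg] with x h1 h2
    apply Complex.ext <;> simp [h1, h2]

namespace IsPeriodicJumpKernel

theorem shiftKernel_nonneg (h : IsPeriodicJumpKernel a Λ) (l : Rd d) (ξ : Td d) (z : Rd d) :
    0 ≤ shiftKernel a Λ l ξ z := by
  rw [shiftKernel_eq]
  exact mul_nonneg (mul_nonneg (h.nonneg z) (Real.exp_pos _).le) (h.jumpWeight_pos ξ z).le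

theorem shiftKernel_pos (h : IsPeriodicJumpKernel a Λ) (l : Rd d) (ξ : Td d) {z : Rd d}
    (hz : 0 < a z) : 0 < shiftKernel a Λ l ξ z := by
  rw [shiftKernel_eq]
  exact mul_pos (mul_pos hz (Real.exp_pos _)) (h.jumpWeight_pos ξ z)

theorem shiftKernel_add (a : Rd d → ℝ) (Λ : Rd d → Rd d → ℝ) (l c : Rd d) (ξ : Td d) (z : Rd d) :
    shiftKernel a Λ (l + c) ξ z = shiftKernel a Λ l ξ z * Real.exp (-inner ℝ c z) := by
  rw [shiftKernel, shiftKernel, inner_add_left, Real.exp_add, inner_neg_right c]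
  ring

/-- `a > 0` on a set of positive measure, so a function whose increments along the jumps are
linear has no linear part. -/
theorem eq_zero_of_ae_prod (h : IsPeriodicJumpKernel a Λ) {f : Td d → ℝ} {α : Rd d}
    (hf : ∀ᵐ p : Td d × Rd d ∂(volume : Measure (Td d)).prod volume,
      0 < a p.2 → f (p.1 - toTorus p.2) = f p.1 + inner ℝ α p.2) : α = 0 := by
  -- The density a is only almost everywhere measurable; the L¹ representative of its trivial tilt
  -- gives a measurable version of {a > 0}.
  have hS : MeasurableSet {z | 0 < h.hasExpMoments.tiltL1 0 z} :=
    measurableSet_lt measurable_const (Lp.stronglyMeasurable _).measurable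
  refine coeff_eq_zero_of_translation (f := f) hS (h.volume_tiltL1_pos 0) ?_
  have h1 : ∀ᵐ p : Rd d × Td d ∂(volume : Measure (Rd d)).prod volume,
      0 < a p.1 → f (p.2 - toTorus p.1) = f p.2 + inner ℝ α p.1 :=
    (Measure.measurePreserving_swap (μ := (volume : Measure (Rd d)))
      (ν := (volume : Measure (Td d)))).quasiMeasurePreserving.ae hf
  filter_upwards [Measure.ae_ae_of_ae_prod h1, (h.hasExpMoments.integrable_tilt 0).coeFn_toL1]
    with z hz1 hz2 hzS
  rw [HasExpMoments.tiltL1, hz2, tilt] at hzS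
  have ha : 0 < a z := pos_of_mul_pos_left hzS (Real.exp_pos _).le
  filter_upwards [hz1] with ξ hξ
  exact hξ ha

theorem jumpOp_apply_of_real (h : IsPeriodicJumpKernel a Λ) (l : Rd d) {u : L2Td d}
    (hu : ∀ᵐ ξ, (u ξ).im = 0) :
    ∀ᵐ ξ, Integrable (fun z => shiftKernel a Λ l ξ z * (u (ξ - toTorus z)).re) ∧
      h.jumpOp l u ξ = ((∫ z, shiftKernel a Λ l ξ z * (u (ξ - toTorus z)).re : ℝ) : ℂ) := by
  filter_upwards [h.jumpOp_ae l u, h.ae_integrable l u, IsBoundedWeight.ae_shift_of_ae hu]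
    with ξ h1 h2 h3
  refine ⟨h2.re.congr ?_, ?_⟩
  · filter_upwards [h3] with z hz
    simp
  · rw [h1, ← integral_complex_ofReal]
    refine integral_congr_ae ?_
    filter_upwards [h3] with z hz
    apply Complex.ext <;> simp [hz]

theorem eigen_apply_of_real (h : IsPeriodicJumpKernel a Λ) {l : Rd d} {θ : ℝ} {u : L2Td d}
    (hu : ∀ᵐ ξ, (u ξ).im = 0) (hs : skewedOperator h l u = (θ : ℂ) • u) :
    ∀ᵐ ξ, Integrable (fun z => shiftKernel a Λ l ξ z * (u (ξ - toTorus z)).re) ∧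
      ∫ z, shiftKernel a Λ l ξ z * (u (ξ - toTorus z)).re = (torusRate a Λ ξ + θ) * (u ξ).re := by
  rw [h.skewedOperator_eq, sub_apply, sub_eq_iff_eq_add] at hs
  filter_upwards [h.jumpOp_apply_of_real l hu, mulOp_ae _ h.memLp_torusRate u,
    Lp.coeFn_smul (θ : ℂ) u, Lp.coeFn_add ((θ : ℂ) • u) (mulOp _ h.memLp_torusRate u)]
    with ξ h1 h2 h3 h4
  refine ⟨h1.1, ?_⟩
  have h5 := h1.2
  rw [hs, h4, Pi.add_apply, h2, h3, Pi.smul_apply, smul_eq_mul] at h5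
  have h6 := congrArg Complex.re h5
  rw [Complex.ofReal_re, Complex.add_re, Complex.re_ofReal_mul, Complex.re_ofReal_mul] at h6
  rw [← h6]
  ring

end IsPeriodicJumpKernel

end Convexity

/-! ### The convexity gap identity and strict convexity of θ -/

section StrictConvexity

open Filter Topology
open scoped ENNReal NNReal

variable {d : ℕ} {a : Rd d → ℝ} {Λ : Rd d → Rd d → ℝ}

/-- The density whose integral is the convexity gap of the principal eigenvalue. -/
noncomputable def gapDensity (a : Rd d → ℝ) (Λ : Rd d → Rd d → ℝ) (t : ℝ) (l c₁ c₂ : Rd d)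
    (ψ u₁ u₂ : Td d → ℂ) (p : Td d × Rd d) : ℝ :=
  (ψ p.1).re * (geomMean t u₁ u₂ p.1 * (shiftKernel a Λ l p.1 p.2 *
    expGap t (logIncrement c₁ u₁ p.1 p.2) (logIncrement c₂ u₂ p.1 p.2)))

theorem exp_logIncrement {c : Rd d} {u : Td d → ℂ} {ξ : Td d} {z : Rd d} (h₁ : 0 < (u ξ).re)
    (h₂ : 0 < (u (ξ - toTorus z)).re) : Real.exp (logIncrement c u ξ z) =
      Real.exp (-inner ℝ c z) * (u (ξ - toTorus z)).re / (u ξ).re := by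
  rw [logIncrement, Real.exp_sub, Real.exp_add, Real.exp_log h₁, Real.exp_log h₂]

/-- The linear parts of the increments cancel in the weighted sum, leaving the increment of log U
for the geometric mean U. -/
theorem geomMean_mul_exp {t : ℝ} {c₁ c₂ : Rd d} (hc : t • c₁ + (1 - t) • c₂ = 0)
    (u₁ u₂ : Td d → ℂ) (ξ : Td d) (z : Rd d) :
    geomMean t u₁ u₂ ξ *
      Real.exp (t * logIncrement c₁ u₁ ξ z + (1 - t) * logIncrement c₂ u₂ ξ z) =
      geomMean t u₁ u₂ (ξ - toTorus z) := by
  have h1 : t * inner ℝ c₁ z + (1 - t) * inner ℝ c₂ z = 0 := by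
    rw [← real_inner_smul_left, ← real_inner_smul_left, ← inner_add_left, hc, inner_zero_left]
  rw [geomMean, geomMean, ← Real.exp_add, logIncrement, logIncrement]
  congr 1
  linear_combination -h1

namespace IsPeriodicJumpKernel

theorem measurable_gapDensity (h : IsPeriodicJumpKernel a Λ) (t : ℝ) (l c₁ c₂ : Rd d)
    {ψ u₁ u₂ : Td d → ℂ} (hψ : Measurable ψ) (h₁ : Measurable u₁) (h₂ : Measurable u₂) :
    AEMeasurable (gapDensity a Λ t l c₁ c₂ ψ u₁ u₂) ((volume : Measure (Td d)).prod volume) := by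
  have e1 := measurable_logIncrement c₁ h₁
  have e2 := measurable_logIncrement c₂ h₂
  have e3 : Measurable fun p : Td d × Rd d =>
      expGap t (logIncrement c₁ u₁ p.1 p.2) (logIncrement c₂ u₂ p.1 p.2) := by
    unfold expGap
    fun_prop
  have e4 : Measurable fun p : Td d × Rd d => geomMean t u₁ u₂ p.1 :=
    (measurable_geomMean t h₁ h₂).comp measurable_fst
  have e5 : Measurable fun p : Td d × Rd d => (ψ p.1).re :=
    Complex.measurable_re.comp (hψ.comp measurable_fst)
  exact e5.aemeasurable.mul (e4.aemeasurable.mul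
    ((h.aestronglyMeasurable_shiftKernel l).aemeasurable.mul e3.aemeasurable))

/-- Dividing the eigenvalue equation of u_i by u_i(ξ) gives ∫ κ_l e^{X_i} dz = G + θ_i, where κ_l is
the kernel at l and X_i the logarithmic increment. The weighted sum, multiplied by U(ξ), minus the
integral part of A_l U is the gap integral; the terms in G cancel. -/
theorem integral_expGap (h : IsPeriodicJumpKernel a Λ) {t : ℝ} {l c₁ c₂ : Rd d}
    (hc : t • c₁ + (1 - t) • c₂ = 0) {θ₁ θ₂ : ℝ} {u₁ u₂ u : L2Td d}
    (h₁ : ∀ᵐ ξ, 0 < (u₁ ξ).re ∧ (u₁ ξ).im = 0) (h₂ : ∀ᵐ ξ, 0 < (u₂ ξ).re ∧ (u₂ ξ).im = 0)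
    (e₁ : skewedOperator h (l + c₁) u₁ = (θ₁ : ℂ) • u₁)
    (e₂ : skewedOperator h (l + c₂) u₂ = (θ₂ : ℂ) • u₂)
    (hu : ∀ᵐ ξ, u ξ = (geomMean t u₁ u₂ ξ : ℂ)) :
    ∀ᵐ ξ, Integrable (fun z => geomMean t u₁ u₂ ξ * (shiftKernel a Λ l ξ z *
        expGap t (logIncrement c₁ u₁ ξ z) (logIncrement c₂ u₂ ξ z))) ∧
      (((t * θ₁ + (1 - t) * θ₂ : ℝ) : ℂ) • u - skewedOperator h l u) ξ =
        ((∫ z, geomMean t u₁ u₂ ξ * (shiftKernel a Λ l ξ z *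
          expGap t (logIncrement c₁ u₁ ξ z) (logIncrement c₂ u₂ ξ z)) : ℝ) : ℂ) := by
  have huim : ∀ᵐ ξ, (u ξ).im = 0 := hu.mono fun ξ hξ => by rw [hξ, Complex.ofReal_im]
  set Θ : ℝ := t * θ₁ + (1 - t) * θ₂ with hΘ
  filter_upwards [h.eigen_apply_of_real (h₁.mono fun _ => And.right) e₁,
    h.eigen_apply_of_real (h₂.mono fun _ => And.right) e₂, h.jumpOp_apply_of_real l huim,
    h₁, h₂, hu, IsBoundedWeight.ae_shift_of_ae h₁, IsBoundedWeight.ae_shift_of_ae h₂,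
    IsBoundedWeight.ae_shift_of_ae hu, mulOp_ae _ h.memLp_torusRate u,
    Lp.coeFn_smul (Θ : ℂ) u, Lp.coeFn_sub ((Θ : ℂ) • u) (skewedOperator h l u),
    Lp.coeFn_sub (h.jumpOp l u) (mulOp _ h.memLp_torusRate u)]
    with ξ a1 a2 a3 a4 a5 a6 a7 a8 a9 a10 a11 a12 a13
  have hx1 := a4.1
  have hx2 := a5.1
  set U := geomMean t u₁ u₂ ξ with hU
  have key : ∀ᵐ z, U * t / (u₁ ξ).re * (shiftKernel a Λ (l + c₁) ξ z * (u₁ (ξ - toTorus z)).re) +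
      U * (1 - t) / (u₂ ξ).re * (shiftKernel a Λ (l + c₂) ξ z * (u₂ (ξ - toTorus z)).re) -
      shiftKernel a Λ l ξ z * (u (ξ - toTorus z)).re =
      U * (shiftKernel a Λ l ξ z *
        expGap t (logIncrement c₁ u₁ ξ z) (logIncrement c₂ u₂ ξ z)) := by
    filter_upwards [a7, a8, a9] with z b1 b2 b3
    rw [b3, Complex.ofReal_re, ← geomMean_mul_exp hc, ← hU, expGap, exp_logIncrement hx1 b1.1,
      exp_logIncrement hx2 b2.1, shiftKernel_add, shiftKernel_add]
    ring
  have hadd : Integrable fun z =>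
      U * t / (u₁ ξ).re * (shiftKernel a Λ (l + c₁) ξ z * (u₁ (ξ - toTorus z)).re) +
      U * (1 - t) / (u₂ ξ).re * (shiftKernel a Λ (l + c₂) ξ z * (u₂ (ξ - toTorus z)).re) :=
    (a1.1.const_mul _).add (a2.1.const_mul _)
  refine ⟨(hadd.sub a3.1).congr key, ?_⟩
  have hval : ∫ z, U * (shiftKernel a Λ l ξ z *
        expGap t (logIncrement c₁ u₁ ξ z) (logIncrement c₂ u₂ ξ z)) =
      (torusRate a Λ ξ + Θ) * U - ∫ z, shiftKernel a Λ l ξ z * (u (ξ - toTorus z)).re := by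
    rw [← integral_congr_ae key, integral_sub hadd a3.1,
      integral_add (a1.1.const_mul _) (a2.1.const_mul _), integral_const_mul, integral_const_mul,
      a1.2, a2.2, hΘ]
    have e1 := hx1.ne'
    have e2 := hx2.ne'
    field_simp
    ring
  rw [hval, a12, Pi.sub_apply, a11, Pi.smul_apply, h.skewedOperator_eq, sub_apply, a13,
    Pi.sub_apply, a3.2, a10, a6, smul_eq_mul]
  push_cast
  ring

/-- The convexity gap of the principal eigenvalue, expressed through the eigenfunctions. -/
theorem lintegral_gapDensity (h : IsPeriodicJumpKernel a Λ) {t : ℝ} (ht0 : 0 < t) (ht1 : t < 1)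
    {l c₁ c₂ : Rd d} (hc : t • c₁ + (1 - t) • c₂ = 0) {θ θ₁ θ₂ : ℝ} {u₁ u₂ ψ : L2Td d}
    (h₁ : ∀ᵐ ξ, 0 < (u₁ ξ).re ∧ (u₁ ξ).im = 0) (h₂ : ∀ᵐ ξ, 0 < (u₂ ξ).re ∧ (u₂ ξ).im = 0)
    (hψ : ∀ᵐ ξ, 0 < (ψ ξ).re ∧ (ψ ξ).im = 0)
    (e₁ : skewedOperator h (l + c₁) u₁ = (θ₁ : ℂ) • u₁)
    (e₂ : skewedOperator h (l + c₂) u₂ = (θ₂ : ℂ) • u₂)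
    (eψ : ContinuousLinearMap.adjoint (skewedOperator h l) ψ = (θ : ℂ) • ψ) :
    ∃ c : ℝ, 0 < c ∧ c ≤ t * (inner ℂ ψ u₁ : ℂ).re + (1 - t) * (inner ℂ ψ u₂ : ℂ).re ∧
      ∫⁻ p, ENNReal.ofReal (gapDensity a Λ t l c₁ c₂ ψ u₁ u₂ p)
          ∂(volume : Measure (Td d)).prod volume =
        ENNReal.ofReal ((t * θ₁ + (1 - t) * θ₂ - θ) * c) := by
  obtain ⟨u, hu⟩ := exists_geomMean ht0.le ht1.le h₁ h₂
  have hupos : ∀ᵐ ξ, 0 < (u ξ).re ∧ (u ξ).im = 0 := by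
    filter_upwards [hu] with ξ hξ
    rw [hξ, Complex.ofReal_re, Complex.ofReal_im]
    exact ⟨Real.exp_pos _, rfl⟩
  have hψim := hψ.mono fun _ => And.right
  obtain ⟨c, hc0, hcu⟩ := inner_pos_of_pos hψ hupos
  have i0 := inner_eq_integral_re hψim (hupos.mono fun _ => And.right)
  have i1 := inner_eq_integral_re hψim (h₁.mono fun _ => And.right)
  have i2 := inner_eq_integral_re hψim (h₂.mono fun _ => And.right)
  refine ⟨c, hc0, ?_, ?_⟩
  -- Weighted arithmetic–geometric mean inequality integrated against ψ; it makes c ≤ 1 when both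
  -- eigenfunctions are normalized by ψ.
  · have hcI : c = ∫ ξ, (ψ ξ).re * (u ξ).re := Complex.ofReal_injective (hcu.symm.trans i0.2)
    rw [i1.2, i2.2, Complex.ofReal_re, Complex.ofReal_re, hcI, ← integral_const_mul,
      ← integral_const_mul, ← integral_add (i1.1.const_mul _) (i2.1.const_mul _)]
    refine integral_mono_ae i0.1 ((i1.1.const_mul _).add (i2.1.const_mul _)) ?_
    filter_upwards [hψ, h₁, h₂, hu] with ξ a1 a2 a3 a4
    rw [a4, Complex.ofReal_re]
    have := mul_le_mul_of_nonneg_left (geomMean_le ht0.le ht1.le a2.1 a3.1) a1.1.le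
    linarith
  · set Θ : ℝ := t * θ₁ + (1 - t) * θ₂ with hΘ
    set r : L2Td d := (Θ : ℂ) • u - skewedOperator h l u with hr
    have hR := h.integral_expGap hc h₁ h₂ e₁ e₂ hu
    rw [← hΘ, ← hr] at hR
    have hrim : ∀ᵐ ξ, (r ξ).im = 0 := hR.mono fun ξ hξ => by rw [hξ.2, Complex.ofReal_im]
    have hgap0 : ∀ ξ z, 0 ≤ geomMean t u₁ u₂ ξ * (shiftKernel a Λ l ξ z *
        expGap t (logIncrement c₁ u₁ ξ z) (logIncrement c₂ u₂ ξ z)) := fun ξ z =>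
      mul_nonneg (Real.exp_pos _).le
        (mul_nonneg (h.shiftKernel_nonneg l ξ z) (expGap_nonneg ht0.le ht1.le _ _))
    have ir := inner_eq_integral_re hψim hrim
    -- Moving the operator onto ψ gives ⟨ψ, (Θ - A_l)u⟩ = (Θ - θ)⟨ψ, u⟩.
    have hinner : (Θ - θ) * c = ∫ ξ, (ψ ξ).re * (r ξ).re := by
      apply Complex.ofReal_injective
      rw [← ir.2, hr, inner_sub_right, inner_smul_right, ← ContinuousLinearMap.adjoint_inner_left,
        eψ, inner_smul_left, hcu, Complex.conj_ofReal]
      push_cast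
      ring
    have hm := (h.measurable_gapDensity t l c₁ c₂ (Lp.stronglyMeasurable ψ).measurable
      (Lp.stronglyMeasurable u₁).measurable (Lp.stronglyMeasurable u₂).measurable).ennreal_ofReal
    rw [lintegral_prod _ hm, hinner, ofReal_integral_eq_lintegral_ofReal ir.1]
    · refine lintegral_congr_ae ?_
      filter_upwards [hψ, hR] with ξ a1 a2
      rw [a2.2, Complex.ofReal_re, ENNReal.ofReal_mul a1.1.le,
        ofReal_integral_eq_lintegral_ofReal a2.1 (Eventually.of_forall (hgap0 ξ)),
        ← lintegral_const_mul' _ _ ENNReal.ofReal_ne_top]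
      refine lintegral_congr fun z => ?_
      rw [← ENNReal.ofReal_mul a1.1.le]
      rfl
    · filter_upwards [hψ, hR] with ξ a1 a2
      rw [a2.2, Complex.ofReal_re]
      exact mul_nonneg a1.1.le (integral_nonneg (hgap0 ξ))

/-- If the inequality failed, the nonnegative gap density would have zero integral. Strict convexity
of exp then equates the two logarithmic increments wherever a > 0, so log(u₁/u₂) has increments (l₁
- l₂)·z, which is impossible on the torus unless l₁ = l₂. -/
theorem theta_lt (h : IsPeriodicJumpKernel a Λ) {l₁ l₂ : Rd d} (hl₁ : l₁ ∈ GammaSet h)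
    (hl₂ : l₂ ∈ GammaSet h) (hne : l₁ ≠ l₂) {t : ℝ} (ht0 : 0 < t) (ht1 : t < 1)
    (hl : t • l₁ + (1 - t) • l₂ ∈ GammaSet h) :
    theta h (t • l₁ + (1 - t) • l₂) < t * theta h l₁ + (1 - t) * theta h l₂ := by
  by_contra hcon
  rw [not_lt] at hcon
  set l := t • l₁ + (1 - t) • l₂ with hldef
  obtain ⟨u₁, χ₁, hp₁⟩ := h.exists_perronPair hl₁
  obtain ⟨u₂, χ₂, hp₂⟩ := h.exists_perronPair hl₂
  obtain ⟨u, ψ, hp⟩ := h.exists_perronPair hl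
  have hc : t • (l₁ - l) + (1 - t) • (l₂ - l) = 0 := by
    rw [hldef]
    module
  obtain ⟨c, hc0, -, hint⟩ := h.lintegral_gapDensity ht0 ht1 hc hp₁.pos hp₂.pos hp.pos'
    (by rw [add_sub_cancel]; exact hp₁.eigen) (by rw [add_sub_cancel]; exact hp₂.eigen) hp.eigen'
  rw [ENNReal.ofReal_of_nonpos (mul_nonpos_of_nonpos_of_nonneg (by linarith) hc0.le),
    lintegral_eq_zero_iff' (h.measurable_gapDensity t l _ _ (Lp.stronglyMeasurable ψ).measurable
      (Lp.stronglyMeasurable u₁).measurable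
      (Lp.stronglyMeasurable u₂).measurable).ennreal_ofReal] at hint
  have h0 : l₁ - l₂ = 0 := by
    refine h.eq_zero_of_ae_prod
      (f := fun ξ => Real.log (u₁ ξ).re - Real.log (u₂ ξ).re) ?_
    filter_upwards [hint, ae_prod_fst hp.pos'] with p h1 h2 h3
    have h4 : gapDensity a Λ t l (l₁ - l) (l₂ - l) ψ u₁ u₂ p ≤ 0 := ENNReal.ofReal_eq_zero.1 h1
    have h5 := h.shiftKernel_pos l p.1 h3
    have h6 : expGap t (logIncrement (l₁ - l) u₁ p.1 p.2) (logIncrement (l₂ - l) u₂ p.1 p.2) ≤ 0 :=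
      nonpos_of_mul_nonpos_right (nonpos_of_mul_nonpos_right (nonpos_of_mul_nonpos_right h4 h2.1)
        (Real.exp_pos _)) h5
    have h7 := eq_of_expGap_eq_zero ht0 ht1 (le_antisymm h6 (expGap_nonneg ht0.le ht1.le _ _))
    rw [logIncrement, logIncrement, inner_sub_left, inner_sub_left] at h7
    rw [inner_sub_left]
    linarith
  exact hne (sub_eq_zero.1 h0)

end IsPeriodicJumpKernel

end StrictConvexity

/-! ### Second-order limits of difference quotients and of the gap density -/

section Hessian

open Filter Topology
open scoped ENNReal NNReal

/-- Difference quotients of a strictly differentiable function along moving points. -/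
theorem HasStrictDerivAt.tendsto_div {ι : Type*} {F : Filter ι} {f : ℝ → ℝ} {f' c k : ℝ}
    {x y s : ι → ℝ} (hf : HasStrictDerivAt f f' c) (hx : Tendsto x F (𝓝 c))
    (hy : Tendsto y F (𝓝 c)) (hxy : Tendsto (fun n => (x n - y n) / s n) F (𝓝 k)) :
    Tendsto (fun n => (f (x n) - f (y n)) / s n) F (𝓝 (f' * k)) := by
  have h1 := (HasStrictFDerivAt.isLittleO hf).comp_tendsto (hx.prodMk_nhds hy)
  have h2 := (h1.mul_isBigO (Asymptotics.isBigO_refl (fun n => (s n)⁻¹) F)).trans_isBigO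
    (hxy.isBigO_one ℝ)
  rw [Asymptotics.isLittleO_one_iff] at h2
  have h3 := h2.add (hxy.const_mul f')
  rw [zero_add] at h3
  refine h3.congr fun n => ?_
  simp only [Function.comp_apply, ContinuousLinearMap.toSpanSingleton_apply, smul_eq_mul]
  ring

/-- The symmetric second difference quotient. -/
theorem ContDiffAt.tendsto_symmetric_difference {E : Type*} [NormedAddCommGroup E]
    [NormedSpace ℝ E] {f : E → ℝ} {x : E} (hf : ContDiffAt ℝ 2 f x) (α : E) :
    Tendsto (fun s : ℝ => (f (x + s • α) + f (x + (-s) • α) - 2 * f x) / s ^ 2) (𝓝[>] 0)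
      (𝓝 (fderiv ℝ (fderiv ℝ f) x α α)) := by
  have hlin : ∀ s : ℝ, HasDerivAt (fun s : ℝ => x + s • α) α s := fun s => by
    simpa using ((hasDerivAt_id s).smul_const α).const_add x
  have hlin' : ∀ s : ℝ, HasDerivAt (fun s : ℝ => x + (-s) • α) (-α) s := fun s => by
    simpa using ((hasDerivAt_id s).neg.smul_const α).const_add x
  have htend : Tendsto (fun s : ℝ => x + s • α) (𝓝 0) (𝓝 x) := by
    simpa using (hlin 0).continuousAt.tendsto
  have htend' : Tendsto (fun s : ℝ => x + (-s) • α) (𝓝 0) (𝓝 x) := by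
    simpa using (hlin' 0).continuousAt.tendsto
  have hdiff : ∀ᶠ y in 𝓝 x, DifferentiableAt ℝ f y := by
    filter_upwards [hf.eventually (by simp)] with y hy
    exact hy.differentiableAt (by simp)
  have hd2 : HasFDerivAt (fderiv ℝ f) (fderiv ℝ (fderiv ℝ f) x) x :=
    ((hf.fderiv_right (m := 1) (by norm_num)).differentiableAt (by simp)).hasFDerivAt
  set g : ℝ → ℝ := fun s => fderiv ℝ f (x + s • α) α - fderiv ℝ f (x + (-s) • α) α with hg
  have hder : ∀ᶠ s in 𝓝[>] (0 : ℝ),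
      HasDerivAt (fun s : ℝ => f (x + s • α) + f (x + (-s) • α) - 2 * f x) (g s) s := by
    filter_upwards [nhdsWithin_le_nhds (htend.eventually hdiff),
      nhdsWithin_le_nhds (htend'.eventually hdiff)] with s h1 h2
    have e := ((h1.hasFDerivAt.comp_hasDerivAt s (hlin s)).add
      (h2.hasFDerivAt.comp_hasDerivAt s (hlin' s))).sub_const (2 * f x)
    rw [map_neg, ← sub_eq_add_neg] at e
    exact e
  have hg0 : HasDerivAt g (2 * fderiv ℝ (fderiv ℝ f) x α α) 0 := by
    have e1 : HasDerivAt (fun s : ℝ => fderiv ℝ f (x + s • α)) (fderiv ℝ (fderiv ℝ f) x α) 0 := by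
      refine HasFDerivAt.comp_hasDerivAt (0 : ℝ) ?_ (hlin 0)
      simpa using hd2
    have e2 : HasDerivAt (fun s : ℝ => fderiv ℝ f (x + (-s) • α))
        (fderiv ℝ (fderiv ℝ f) x (-α)) 0 := by
      refine HasFDerivAt.comp_hasDerivAt (0 : ℝ) ?_ (hlin' 0)
      simpa using hd2
    have e3 := (e1.clm_apply (hasDerivAt_const (0 : ℝ) α)).sub
      (e2.clm_apply (hasDerivAt_const (0 : ℝ) α))
    refine e3.congr_deriv ?_
    simp
    ring
  refine HasDerivAt.lhopital_zero_nhdsGT (g' := fun s => 2 * s) hder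
    (Eventually.of_forall fun s => by simpa using hasDerivAt_pow 2 s) ?_ ?_ ?_ ?_
  · filter_upwards [self_mem_nhdsWithin] with s hs
    have : (0 : ℝ) < s := hs
    positivity
  · refine tendsto_nhdsWithin_of_tendsto_nhds ?_
    have := ((hf.continuousAt.tendsto.comp htend).add
      (hf.continuousAt.tendsto.comp htend')).sub_const (2 * f x)
    rwa [← two_mul, sub_self] at this
  · refine tendsto_nhdsWithin_of_tendsto_nhds ?_
    simpa using (continuous_pow 2).tendsto (0 : ℝ)
  · have := hg0.tendsto_slope_zero_right.const_mul (1 / 2 : ℝ)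
    refine (this.congr fun s => ?_).trans (by rw [← mul_assoc]; norm_num)
    simp [hg]
    ring

variable {d : ℕ} {a : Rd d → ℝ} {Λ : Rd d → Rd d → ℝ}

theorem exists_seq_tendsto_ae_of_tendsto {ι α : Type*} [MeasurableSpace α] {μ : Measure α}
    {F : Filter ι} [NeBot F] [IsCountablyGenerated F] {f : ι → Lp ℂ 2 μ} {g : Lp ℂ 2 μ}
    (hf : Tendsto f F (𝓝 g)) : ∃ ns : ℕ → ι, Tendsto ns atTop F ∧
      ∀ᵐ x ∂μ, Tendsto (fun n => f (ns n) x) atTop (𝓝 (g x)) :=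
  (tendstoInMeasure_of_tendsto_Lp hf).exists_seq_tendsto_ae'

/-- The quotient is half the square of a difference quotient of r ↦ e^(r/2). Both endpoints move, so
strict differentiability at c is what is needed. -/
theorem tendsto_expGap_half {ι : Type*} {F : Filter ι} {x y s : ι → ℝ} {c k : ℝ}
    (hx : Tendsto x F (𝓝 c)) (hy : Tendsto y F (𝓝 c))
    (hxy : Tendsto (fun n => (x n - y n) / s n) F (𝓝 k)) :
    Tendsto (fun n => expGap (1 / 2) (x n) (y n) / s n ^ 2) F
      (𝓝 ((Real.exp (c / 2) * (1 / 2) * k) ^ 2 / 2)) := by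
  have h1 : HasStrictDerivAt (fun r : ℝ => Real.exp (r / 2)) (Real.exp (c / 2) * (1 / 2)) c :=
    (Real.hasStrictDerivAt_exp _).comp c ((hasStrictDerivAt_id c).div_const 2)
  refine (((h1.tendsto_div hx hy hxy).pow 2).div_const 2).congr fun n => ?_
  rw [expGap_half, div_pow]
  ring

/-- Convergence of the rescaled convexity gap density along `u ± s α`. -/
theorem tendsto_gapDensity {ι : Type*} {F : Filter ι} (a : Rd d → ℝ) (Λ : Rd d → Rd d → ℝ)
    (l α : Rd d) (ψ : Td d → ℂ) {u₁ u₂ : ι → Td d → ℂ} {v w : Td d → ℂ} {s : ι → ℝ}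
    {p : Td d × Rd d} (hs : Tendsto s F (𝓝 0)) (hs0 : ∀ᶠ n in F, s n ≠ 0)
    (h : ∀ ξ, ξ = p.1 ∨ ξ = p.1 - toTorus p.2 → 0 < (v ξ).re ∧
      Tendsto (fun n => (u₁ n ξ).re) F (𝓝 (v ξ).re) ∧
      Tendsto (fun n => (u₂ n ξ).re) F (𝓝 (v ξ).re) ∧
      Tendsto (fun n => ((u₁ n ξ).re - (u₂ n ξ).re) / s n) F (𝓝 (w ξ).re)) :
    Tendsto (fun n => gapDensity a Λ (1 / 2) l (s n • α) ((-s n) • α) ψ (u₁ n) (u₂ n) p / s n ^ 2) F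
      (𝓝 ((ψ p.1).re * ((v p.1).re * (shiftKernel a Λ l p.1 p.2 *
        ((Real.exp ((Real.log (v (p.1 - toTorus p.2)).re - Real.log (v p.1).re) / 2) * (1 / 2) *
          (-2 * inner ℝ α p.2 +
            (w (p.1 - toTorus p.2)).re / (v (p.1 - toTorus p.2)).re -
              (w p.1).re / (v p.1).re)) ^ 2 / 2))))) := by
  obtain ⟨ξ, z⟩ := p
  obtain ⟨v0, x1, y1, r1⟩ := h ξ (Or.inl rfl)
  obtain ⟨v0', x2, y2, r2⟩ := h (ξ - toTorus z) (Or.inr rfl)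
  have lx1 := (Real.continuousAt_log v0.ne').tendsto.comp x1
  have ly1 := (Real.continuousAt_log v0.ne').tendsto.comp y1
  have lx2 := (Real.continuousAt_log v0'.ne').tendsto.comp x2
  have ly2 := (Real.continuousAt_log v0'.ne').tendsto.comp y2
  have lr1 := (Real.hasStrictDerivAt_log v0.ne').tendsto_div x1 y1 r1
  have lr2 := (Real.hasStrictDerivAt_log v0'.ne').tendsto_div x2 y2 r2
  have hz : Tendsto (fun n => -inner ℝ (s n • α) z) F (𝓝 0) := by
    simp only [real_inner_smul_left]
    simpa using (hs.mul_const (inner ℝ α z)).neg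
  have hz' : Tendsto (fun n => -inner ℝ ((-s n) • α) z) F (𝓝 0) := by
    simp only [real_inner_smul_left]
    simpa using (hs.mul_const (inner ℝ α z))
  have hP : Tendsto (fun n => logIncrement (s n • α) (u₁ n) ξ z) F
      (𝓝 (Real.log (v (ξ - toTorus z)).re - Real.log (v ξ).re)) := by
    have e := (hz.add lx2).sub lx1
    rw [zero_add] at e
    exact e
  have hQ : Tendsto (fun n => logIncrement ((-s n) • α) (u₂ n) ξ z) F
      (𝓝 (Real.log (v (ξ - toTorus z)).re - Real.log (v ξ).re)) := by
    have e := (hz'.add ly2).sub ly1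
    rw [zero_add] at e
    exact e
  -- The tilts are sα and -sα, so their difference divided by s contributes -2α·z.
  have hPQ : Tendsto (fun n => (logIncrement (s n • α) (u₁ n) ξ z -
      logIncrement ((-s n) • α) (u₂ n) ξ z) / s n) F (𝓝 (-2 * inner ℝ α z +
        (w (ξ - toTorus z)).re / (v (ξ - toTorus z)).re - (w ξ).re / (v ξ).re)) := by
    have e := (lr2.const_add (-2 * inner ℝ α z)).sub lr1
    rw [inv_mul_eq_div, inv_mul_eq_div] at e
    refine e.congr' ?_
    filter_upwards [hs0] with n hn
    simp only [logIncrement, real_inner_smul_left]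
    field_simp
    ring
  have hU : Tendsto (fun n => geomMean (1 / 2) (u₁ n) (u₂ n) ξ) F (𝓝 (v ξ).re) := by
    have e := (Real.continuous_exp.tendsto _).comp
      ((lx1.const_mul (1 / 2 : ℝ)).add (ly1.const_mul (1 - 1 / 2 : ℝ)))
    rw [← add_mul, add_sub_cancel, one_mul, Real.exp_log v0] at e
    exact e
  refine ((hU.mul ((tendsto_expGap_half hP hQ hPQ).const_mul (shiftKernel a Λ l ξ z))).const_mul
    (ψ ξ).re).congr fun n => ?_
  rw [gapDensity]
  ring

end Hessian

/-! ### Positive definiteness of the Hessian -/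

section HessianPositive

open Filter Topology
open scoped ENNReal NNReal

variable {d : ℕ} {a : Rd d → ℝ} {Λ : Rd d → Rd d → ℝ}

/-- Simultaneous almost everywhere convergence of `u (l ± s α)` and of the difference quotient
along a sequence `s → 0+`. -/
theorem exists_seq_ae_tendsto_difference {u : Rd d → L2Td d} {l : Rd d}
    (hu : DifferentiableAt ℝ u l) (α : Rd d) :
    ∃ (s : ℕ → ℝ) (w : L2Td d), Tendsto s atTop (𝓝[>] 0) ∧
      ∀ᵐ ξ, Tendsto (fun n => (u (l + s n • α) ξ).re) atTop (𝓝 (u l ξ).re) ∧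
        Tendsto (fun n => (u (l + (-s n) • α) ξ).re) atTop (𝓝 (u l ξ).re) ∧
        Tendsto (fun n => ((u (l + s n • α) ξ).re - (u (l + (-s n) • α) ξ).re) / s n) atTop
          (𝓝 (w ξ).re) := by
  have hlin : HasDerivAt (fun s : ℝ => l + s • α) α 0 := by
    simpa using ((hasDerivAt_id (0 : ℝ)).smul_const α).const_add l
  have hlin' : HasDerivAt (fun s : ℝ => l + (-s) • α) (-α) 0 := by
    simpa using ((hasDerivAt_id (0 : ℝ)).neg.smul_const α).const_add l
  have e1 : HasDerivAt (fun s : ℝ => u (l + s • α)) (fderiv ℝ u l α) 0 := by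
    refine HasFDerivAt.comp_hasDerivAt (0 : ℝ) ?_ hlin
    simpa using hu.hasFDerivAt
  have e2 : HasDerivAt (fun s : ℝ => u (l + (-s) • α)) (fderiv ℝ u l (-α)) 0 := by
    refine HasFDerivAt.comp_hasDerivAt (0 : ℝ) ?_ hlin'
    simpa using hu.hasFDerivAt
  have t1 : Tendsto (fun s : ℝ => u (l + s • α)) (𝓝[>] 0) (𝓝 (u l)) := by
    have := e1.continuousAt.tendsto
    rw [zero_smul, add_zero] at this
    exact this.mono_left nhdsWithin_le_nhds
  have t2 : Tendsto (fun s : ℝ => u (l + (-s) • α)) (𝓝[>] 0) (𝓝 (u l)) := by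
    have := e2.continuousAt.tendsto
    rw [neg_zero, zero_smul, add_zero] at this
    exact this.mono_left nhdsWithin_le_nhds
  set w : L2Td d := fderiv ℝ u l α - fderiv ℝ u l (-α) with hw
  have t3 : Tendsto (fun s : ℝ => s⁻¹ • (u (l + s • α) - u (l + (-s) • α))) (𝓝[>] 0) (𝓝 w) := by
    have := (e1.sub e2).tendsto_slope_zero_right
    simpa [hw] using this
  -- Each extraction is made along the previous sequence, so that the three almost everywhere limits
  -- hold along one common sequence.
  obtain ⟨s1, hs1, h1⟩ := exists_seq_tendsto_ae_of_tendsto t1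
  obtain ⟨s2, hs2, h2⟩ := exists_seq_tendsto_ae_of_tendsto (t2.comp hs1)
  obtain ⟨s3, hs3, h3⟩ := exists_seq_tendsto_ae_of_tendsto (t3.comp (hs1.comp hs2))
  refine ⟨fun n => s1 (s2 (s3 n)), w, hs1.comp (hs2.comp hs3), ?_⟩
  have h4 : ∀ᵐ ξ, ∀ n : ℕ, ((s1 (s2 n))⁻¹ • (u (l + s1 (s2 n) • α) - u (l + (-s1 (s2 n)) • α))
      : L2Td d) ξ = ((s1 (s2 n))⁻¹ : ℝ) •
        (u (l + s1 (s2 n) • α) ξ - u (l + (-s1 (s2 n)) • α) ξ) := by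
    refine ae_all_iff.2 fun n => ?_
    filter_upwards [Lp.coeFn_smul (s1 (s2 n))⁻¹ (u (l + s1 (s2 n) • α) - u (l + (-s1 (s2 n)) • α)),
      Lp.coeFn_sub (u (l + s1 (s2 n) • α)) (u (l + (-s1 (s2 n)) • α))] with ξ a b
    rw [a, Pi.smul_apply, b, Pi.sub_apply]
  filter_upwards [h1, h2, h3, h4] with ξ a1 a2 a3 a4
  refine ⟨(Complex.continuous_re.tendsto _).comp (a1.comp (hs2.comp hs3)),
    (Complex.continuous_re.tendsto _).comp (a2.comp hs3), ?_⟩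
  refine ((Complex.continuous_re.tendsto _).comp a3).congr fun n => ?_
  simp only [Function.comp_apply]
  rw [a4, Complex.smul_re, Complex.sub_re, smul_eq_mul]
  ring

namespace IsPeriodicJumpKernel

/-- Apply the gap identity to l ± sα with t = 1/2 and divide by s². If the second derivative were
nonpositive, the integrals would tend to 0, and by Fatou the limit density, a positive weight times
a square wherever a > 0, would vanish. With w the limit of (u(l + sα) - u(l - sα))/s, this says that
w/v has increments 2α·z along the jumps, so α = 0. -/
theorem hessian_pos (h : IsPeriodicJumpKernel a Λ) {l : Rd d} (hl : l ∈ GammaSet h) {α : Rd d}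
    (hα : α ≠ 0) : 0 < fderiv ℝ (fderiv ℝ (theta h)) l α α := by
  by_contra hcon
  rw [not_lt] at hcon
  obtain ⟨v, ψ, hp⟩ := h.exists_perronPair hl
  obtain ⟨u, hu, hul, hθ, hev⟩ := h.exists_smooth_eigenfunction hl hp two_ne_zero
  obtain ⟨s, w, hs, hsae⟩ := exists_seq_ae_tendsto_difference
    (hu.differentiableAt (by simp)) α
  have hs' : Tendsto s atTop (𝓝 0) := tendsto_nhds_of_tendsto_nhdsWithin hs
  have hs0 : ∀ᶠ n in atTop, 0 < s n := hs.eventually self_mem_nhdsWithin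
  have hψm := (Lp.stronglyMeasurable ψ).measurable
  have hum : ∀ l', Measurable (u l') := fun l' => (Lp.stronglyMeasurable (u l')).measurable
  have htend : Tendsto (fun n => l + s n • α) atTop (𝓝 l) := by
    simpa using (hs'.smul_const α).const_add l
  have htend' : Tendsto (fun n => l + (-s n) • α) atTop (𝓝 l) := by
    simpa using (hs'.neg.smul_const α).const_add l
  set g : ℕ → Td d × Rd d → ℝ := fun n p =>
    gapDensity a Λ (1 / 2) l (s n • α) ((-s n) • α) ψ (u (l + s n • α)) (u (l + (-s n) • α)) p /
      s n ^ 2 with hg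
  set Q : ℕ → ℝ := fun n =>
    (theta h (l + s n • α) + theta h (l + (-s n) • α) - 2 * theta h l) / s n ^ 2 with hQdef
  have hQ : Tendsto Q atTop (𝓝 (fderiv ℝ (fderiv ℝ (theta h)) l α α)) :=
    (ContDiffAt.tendsto_symmetric_difference hθ α).comp hs
  have hgm : ∀ n, AEMeasurable (fun p => ENNReal.ofReal (g n p))
      ((volume : Measure (Td d)).prod volume) := fun n =>
    ((h.measurable_gapDensity (1 / 2) l _ _ hψm (hum _) (hum _)).div_const _).ennreal_ofReal
  -- The identity gives the integral exactly as (Q/2)c. The normalization ⟨ψ, u⟩ = 1 yields 0 < c ≤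
  -- 1, which bounds this for either sign of Q because `ENNReal.ofReal` truncates at 0.
  have hbound : ∀ᶠ n in atTop,
      ∫⁻ p, ENNReal.ofReal (g n p) ∂(volume : Measure (Td d)).prod volume ≤
        ENNReal.ofReal (Q n / 2) := by
    filter_upwards [hs0, htend.eventually hev, htend'.eventually hev] with n hn h1 h2
    have hc : (1 / 2 : ℝ) • (s n • α) + (1 - 1 / 2 : ℝ) • ((-s n) • α) = 0 := by module
    obtain ⟨c, hc0, hc1, hint⟩ := h.lintegral_gapDensity (by norm_num) (by norm_num) hc
      h1.2.2.2 h2.2.2.2 hp.pos' h1.2.1 h2.2.1 hp.eigen'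
    rw [h1.2.2.1, h2.2.2.1, Complex.one_re] at hc1
    have hn2 : 0 ≤ (s n ^ 2)⁻¹ := by positivity
    have e1 : ∀ p, ENNReal.ofReal (g n p) = ENNReal.ofReal (s n ^ 2)⁻¹ *
        ENNReal.ofReal (gapDensity a Λ (1 / 2) l (s n • α) ((-s n) • α) ψ (u (l + s n • α))
          (u (l + (-s n) • α)) p) := fun p => by
      rw [← ENNReal.ofReal_mul hn2, inv_mul_eq_div]
    simp only [e1]
    rw [lintegral_const_mul' _ _ ENNReal.ofReal_ne_top, hint, ← ENNReal.ofReal_mul hn2]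
    have e2 : (s n ^ 2)⁻¹ * ((1 / 2 * theta h (l + s n • α) +
        (1 - 1 / 2) * theta h (l + (-s n) • α) - theta h l) * c) = Q n / 2 * c := by
      rw [hQdef]
      ring
    rw [e2]
    rcases le_total 0 (Q n) with h0 | h0
    · refine ENNReal.ofReal_le_ofReal (mul_le_of_le_one_right (by linarith) (by linarith))
    · rw [ENNReal.ofReal_of_nonpos (mul_nonpos_of_nonpos_of_nonneg (by linarith) hc0.le)]
      exact zero_le
  have hlim : Tendsto (fun n => ENNReal.ofReal (Q n / 2)) atTop (𝓝 0) := by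
    have := (ENNReal.continuous_ofReal.tendsto _).comp (hQ.div_const 2)
    rwa [ENNReal.ofReal_of_nonpos (by linarith)] at this
  have hlim' : Tendsto (fun n => ∫⁻ p, ENNReal.ofReal (g n p)
      ∂(volume : Measure (Td d)).prod volume) atTop (𝓝 0) :=
    tendsto_of_tendsto_of_tendsto_of_le_of_le' tendsto_const_nhds hlim
      (Eventually.of_forall fun n => zero_le) hbound
  have hconv : ∀ᵐ p ∂(volume : Measure (Td d)).prod volume, Tendsto (fun n => g n p) atTop
      (𝓝 ((ψ p.1).re * ((v p.1).re * (shiftKernel a Λ l p.1 p.2 *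
        ((Real.exp ((Real.log (v (p.1 - toTorus p.2)).re - Real.log (v p.1).re) / 2) * (1 / 2) *
          (-2 * inner ℝ α p.2 +
            (w (p.1 - toTorus p.2)).re / (v (p.1 - toTorus p.2)).re -
              (w p.1).re / (v p.1).re)) ^ 2 / 2))))) := by
    rw [hul] at hsae
    filter_upwards [ae_prod_fst hsae, ae_prod_shift hsae, ae_prod_fst hp.pos, ae_prod_shift hp.pos]
      with p a1 a2 a3 a4
    refine tendsto_gapDensity a Λ l α ψ hs' (hs0.mono fun n hn => hn.ne') ?_
    rintro ξ (rfl | rfl)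
    · exact ⟨a3.1, a1⟩
    · exact ⟨a4.1, a2⟩
  have hzero : ∀ᵐ p ∂(volume : Measure (Td d)).prod volume,
      liminf (fun n => ENNReal.ofReal (g n p)) atTop = 0 := by
    have hm : AEMeasurable (fun p => liminf (fun n => ENNReal.ofReal (g n p)) atTop)
        ((volume : Measure (Td d)).prod volume) := by
      refine aemeasurable_of_tendsto_metrizable_ae' hgm ?_
      filter_upwards [hconv] with p hp'
      have := (ENNReal.continuous_ofReal.tendsto _).comp hp'
      rwa [Function.comp_def, ← Tendsto.liminf_eq this] at this
    refine (lintegral_eq_zero_iff' hm).1 (le_antisymm ?_ zero_le)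
    refine (lintegral_liminf_le' hgm).trans ?_
    rw [hlim'.liminf_eq]
  -- Halving w/v turns increments 2α·z into α·z.
  refine hα (h.eq_zero_of_ae_prod (f := fun ξ => (w ξ).re / (v ξ).re / 2) ?_)
  filter_upwards [hzero, hconv, ae_prod_fst hp.pos, ae_prod_fst hp.pos'] with p a1 a2 a3 a4 ha
  have e1 := ((ENNReal.continuous_ofReal.tendsto _).comp a2).liminf_eq
  rw [Function.comp_def, a1] at e1
  have e2 := nonpos_of_mul_nonpos_right (nonpos_of_mul_nonpos_right (nonpos_of_mul_nonpos_right
    (ENNReal.ofReal_eq_zero.1 e1.symm) a4.1) a3.1) (h.shiftKernel_pos l p.1 ha)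
  have e3 : Real.exp ((Real.log (v (p.1 - toTorus p.2)).re - Real.log (v p.1).re) / 2) * (1 / 2) *
      (-2 * inner ℝ α p.2 + (w (p.1 - toTorus p.2)).re / (v (p.1 - toTorus p.2)).re -
        (w p.1).re / (v p.1).re) = 0 :=
    pow_eq_zero_iff two_ne_zero |>.1 (le_antisymm (by linarith) (sq_nonneg _))
  have e4 := (mul_eq_zero.1 e3).resolve_left (by positivity)
  linarith

theorem posDef_hessianMatrix (h : IsPeriodicJumpKernel a Λ) {l : Rd d} (hl : l ∈ GammaSet h) :
    (hessianMatrix (theta h) l).PosDef := by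
  have hθ : ContDiffAt ℝ 2 (theta h) l := h.contDiffAt_theta hl two_ne_zero
  set B := fderiv ℝ (fderiv ℝ (theta h)) l with hB
  have hM : ∀ i j, hessianMatrix (theta h) l i j =
      B (EuclideanSpace.single i 1) (EuclideanSpace.single j 1) := fun i j => by
    rw [hessianMatrix, Matrix.of_apply, iteratedFDeriv_two_apply]
    rfl
  have hsymm : IsSymmSndFDerivAt ℝ (theta h) l := hθ.isSymmSndFDerivAt (by simp)
  refine Matrix.PosDef.of_dotProduct_mulVec_pos ?_ fun x hx => ?_
  · ext i j
    rw [Matrix.conjTranspose_apply, hM, hM, star_trivial]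
    exact hsymm _ _
  · have hx' : (WithLp.toLp 2 x : Rd d) ≠ 0 := by
      simpa using hx
    have hsum : (WithLp.toLp 2 x : Rd d) = ∑ i, x i • EuclideanSpace.single i (1 : ℝ) := by
      ext j
      simp [Finset.sum_apply, Pi.single_apply]
    have hpos := h.hessian_pos hl hx'
    have e : B (WithLp.toLp 2 x) (WithLp.toLp 2 x) =
        star x ⬝ᵥ Matrix.mulVec (hessianMatrix (theta h) l) x := by
      rw [hsum]
      simp only [map_sum, map_smul, FunLike.coe_sum, Finset.sum_apply,
        FunLike.coe_smul, Pi.smul_apply, smul_eq_mul, dotProduct, Matrix.mulVec, hM,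
        star_trivial, Finset.mul_sum]
      rw [Finset.sum_comm]
      refine Finset.sum_congr rfl fun i _ => Finset.sum_congr rfl fun j _ => ?_
      ring
    rw [← e]
    exact hpos

end IsPeriodicJumpKernel

end HessianPositive

theorem mainTheorem5 {d : ℕ} {a : Rd d → ℝ} {Λ : Rd d → Rd d → ℝ}
    (h : IsPeriodicJumpKernel a Λ) :
    (∀ l ∈ GammaSet h, IsPrincipalEigenvalue (skewedOperator h l) (theta h l)) ∧
    IsOpen (GammaSet h) ∧
    ContDiffOn ℝ 2 (theta h) (GammaSet h) ∧
    (∀ l ∈ GammaSet h, (hessianMatrix (theta h) l).PosDef) ∧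
    (∀ l₁ ∈ GammaSet h, ∀ l₂ ∈ GammaSet h, l₁ ≠ l₂ → ∀ t : ℝ, 0 < t → t < 1 →
      t • l₁ + (1 - t) • l₂ ∈ GammaSet h →
        theta h (t • l₁ + (1 - t) • l₂) < t * theta h l₁ + (1 - t) * theta h l₂) := by
  exact ⟨fun l hl => h.isPrincipalEigenvalue hl, h.isOpen_GammaSet,
    fun l hl => (h.contDiffAt_theta hl two_ne_zero).contDiffWithinAt,
    fun l hl => h.posDef_hessianMatrix hl,
    fun l₁ hl₁ l₂ hl₂ hne t ht0 ht1 hl => h.theta_lt hl₁ hl₂ hne ht0 ht1 hl⟩
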